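/- \textbf{Setting.} Let $U\subset\mathbb{R}^n$ be an open coordinate domain with coordinates $(q^i)$, $\mathcal{G}$ a smooth Riemannian metric on $U$, $V\colon U\to\mathbb{R}$ smooth, and $\mathcal{D}$ a distribution on $U$ with smooth frame $e_A=\rho_A^i\,\partial/\partial q^i$, $A=1,\dots,k$. Write $(\mathcal{G}^{\mathcal{D}})_{AB}=\mathcal{G}(e_A,e_B)$, with inverse matrix $(\mathcal{G}^{\mathcal{D}})^{AB}$. Let $\Gamma_{AB}^C$ be the Christoffel symbols, $\nabla_{e_A}e_B=\Gamma_{AB}^Ce_C$, of the unique connection on $\mathcal{D}$ that is compatible with $\mathcal{G}^{\mathcal{D}}$ and satisfies $\nabla_XY-\nabla_YX=\mathcal{P}[X,Y]$, where $\mathcal{P}$ is the $\mathcal{G}$-orthogonal projection to $\mathcal{D}$. Elements of $\mathcal{D}$ are written $(q^i,v^A)$ for $v^Ae_A(q)$. Put $$f^A(q,v)=\Gamma_{CB}^Av^Cv^B+(\mathcal{G}^{\mathcal{D}})^{AB}\rho_B^i\frac{\partial V}{\partial q^i}.$$ \textbf{Tracking problem.} Fix $T>0$, $\omega>0$, $\varepsilon\in\mathbb{R}$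 (in the tracking problem proper $\varepsilon>0$), an initial state $(q_0,v_0)\in\mathcal{D}$, a continuous reference $\gamma_r=(q_r,v_r)\colon[0,T]\to\mathcal{D}$, a $C^1$ terminal cost $\Phi\colon\mathcal{D}\to\mathbb{R}$, and $r\colon\mathcal{D}\times\mathcal{D}\to\mathbb{R}^d$ such that $r(\cdot,\gamma_r(T))$ is $C^1$. Let $\mathcal{C}(t,q,v,u)=\frac12\big(\|q-q_r(t)\|^2+\|v-v_r(t)\|^2+\varepsilon\|u\|^2\big)$ with Euclidean norms of the coordinates. The problem is to minimize $\mathcal{J}=\int_0^T\mathcal{C}\,dt+\omega\Phi(\gamma(T))$ over $C^1$ curves $\gamma=(q,v)\colon[0,T]\to\mathcal{D}$ and continuous $u\colon[0,T]\to\mathbb{R}^k$ with $$\dot q^i=\rho_A^i(q)v^A,\qquad \dot v^A=-f^A(q,v)+u^A,\qquad \gamma(0)=(q_0,v_0),\qquad r(\gamma(T),\gamma_r(T))=0.$$ Let $\mathcal{D}^{(2)}\subset T\mathcal{D}$ be the set of velocities $(q,v,\dot q,\dot v)$ of admissible curves in $\mathcal{D}$ (those with $\dot q^i=\rho_A^iv^A$).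 For $\lambda_0\ge0$ let $\mathcal{L}(t,q,v,\dot v)=\lambda_0\,\mathcal{C}\big(t,q,v,\dot v+f(q,v)\big)$ on $\mathcal{D}^{(2)}$ and $\widetilde{\mathcal{L}}=\mathcal{L}-\lambda_i(\dot q^i-\rho_A^iv^A)$. For $\lambda_T\in\mathbb{R}^d$ let $$\widetilde{\mathcal{J}}(q,v,\lambda,\lambda_T)=\omega\Phi(\gamma(T))+\lambda_T\cdot r(\gamma(T),\gamma_r(T))+\int_0^T\widetilde{\mathcal{L}}\,dt .$$ A critical point of $\widetilde{\mathcal{J}}$ is a $(q,v,\lambda,\lambda_T)$ at which the first variation vanishes for all $C^1$ variations of $(q,v)$ that vanish at $t=0$, all continuous variations of $\lambda$, and all variations of $\lambda_T$. Consider the equations $$(\mathrm{EL})\qquad \dot\lambda_i=-\Big(\frac{\partial\mathcal{L}}{\partial q^i}+\lambda_j\frac{\partial\rho_A^j}{\partial q^i}v^A\Big),\qquad \dot q^i=\rho_A^iv^A,\qquad \frac{d}{dt}\frac{\partial\mathcal{L}}{\partial\dot v^A}=\frac{\partial\mathcal{L}}{\partial v^A}+\rho_A^i\lambda_i$$ on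 $[0,T]$ and, for a function $\mu\colon[0,T]\to\mathbb{R}^k$ and a weight $w$ (equal to $\omega$ unless stated otherwise), the terminal conditions $$(\mathrm{T})\qquad r(\gamma(T),\gamma_r(T))=0,\quad \lambda_i(T)=w\frac{\partial\Phi}{\partial q^i}+\lambda_T\cdot\frac{\partial r}{\partial q^i},\quad \mu_A(T)=w\frac{\partial\Phi}{\partial v^A}+\lambda_T\cdot\frac{\partial r}{\partial v^A},$$ where the derivatives are taken at $\gamma(T)$, those of $r$ in its first argument. \textbf{Claims.} 1. (Recasting.) $\mathcal{D}^{(2)}$ is the set of $(q,v,\dot q,\dot v)$ with $q\in U$ and $\dot q^i=\rho_A^i(q)v^A$. A triple $(q,v,u)$ satisfies the constraints of the tracking problem if and only if $(q,v)$ is a $C^1$ curve in $\mathcal{D}$ that satisfies the boundary conditions and whose velocity stays in $\mathcal{D}^{(2)}$, and $u=\dot v+f(q,v)$. In that case $\mathcal{J}=\int_0^T\mathcal{L}\,dt+\omega\Phi(\gamma(T))$ with $\lambda_0=1$. Hence $(q,v,u)$ solves the tracking problem if and only if $(q,v)$ minimizes this functional among such curves and $u=\dot v+f(q,v)$. 2.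 (Extremals satisfy EL.) Let $(q,v)$ be such a minimizer. (a) There are $\lambda_0\ge0$ and $\lambda$, with $(\lambda_0,\lambda)\neq(0,0)$, satisfying (EL). (b) There are $\lambda_0\ge0$, $\lambda_T$ with $(\lambda_0,\lambda_T)\ne(0,0)$, and $\lambda$, satisfying (EL) and (T) with $w=\lambda_0\omega$ and $\mu_A=-\partial\mathcal{L}/\partial\dot v^A$. (c) If the state equations linearized along $(q,v)$ are controllable on $[0,T]$, then (EL) holds with $\lambda_0=1$ for some $\lambda$; if moreover the derivative of $r(\cdot,\gamma_r(T))$ at $\gamma(T)$ is surjective, then $(q,v,\lambda,\lambda_T)$ is a critical point of $\widetilde{\mathcal{J}}$ with $\lambda_0=1$ for some continuous $\lambda$ and some $\lambda_T$. 3. (Critical points.) For every $\lambda_0\ge0$, every $C^1$ curve $(q,v)$ in $\mathcal{D}$ with the given initial state, every continuous $\lambda$ and every $\lambda_T$: $(q,v,\lambda,\lambda_T)$ is a critical point of $\widetilde{\mathcal{J}}$ if and only if (EL) and (T) hold, with $\mu_A=-\partial\mathcal{L}/\partial\dot v^A$. 4. (Regularity.) Let $\lambda_0>0$. If $\varepsilon\neq0$,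 the matrix $\big(\partial^2\mathcal{L}/\partial\dot v^A\partial\dot v^B\big)$ is nonsingular everywhere, that is, the problem is regular. If $\varepsilon=0$ and $k\ge1$, the problem is not regular. 5. (Equivalence with the Pontryagin maximum principle.) Let $\lambda_0>0$, $\varepsilon\ne0$, and $\mathcal{H}=\lambda_0\mathcal{C}(t,q,v,u)+\lambda_i\rho_A^iv^A+\mu_A(-f^A(q,v)+u^A)$. For every $C^1$ curve $(q,v)$ in $\mathcal{D}$ with the given initial state and all $\lambda,\mu,u$, the following are equivalent: (i) the state equations, the costate equations $\dot\lambda_i=-\partial\mathcal{H}/\partial q^i$, $\dot\mu_A=-\partial\mathcal{H}/\partial v^A$, and the stationarity condition $\partial\mathcal{H}/\partial u^A=0$ hold on $[0,T]$; (ii) (EL) holds, $u=\dot v+f(q,v)$ and $\mu_A=-\partial\mathcal{L}/\partial\dot v^A$. With boundary conditions: for continuous $\lambda$ and every $\lambda_T$, (i) together with (T) holds if and only if $(q,v,\lambda,\lambda_T)$ is a critical point of $\widetilde{\mathcal{J}}$, $u=\dot v+f(q,v)$ and $\mu_A=-\partial\mathcal{L}/\partial\dot v^A$. If $\varepsilon>0$,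 the stationarity condition is equivalent to $u(t)$ minimizing $\mathcal{H}(t,q(t),v(t),\lambda(t),\mu(t),\cdot)$ over $\mathbb{R}^k$ for every $t\in[0,T]$. -/

import Mathlib

open Set MeasureTheory
open scoped ContDiff Topology

noncomputable section

namespace Nonholonomic

/-- Coordinate space with the Euclidean norm. -/
abbrev E (n : ℕ) : Type := EuclideanSpace ℝ (Fin n)

/-- The partial derivative `∂f/∂x^i` at `x`. -/
def pd {n : ℕ} (f : E n → ℝ) (x : E n) (i : Fin n) : ℝ :=
  fderiv ℝ f x (EuclideanSpace.single i 1)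

/-- A mechanical system with linear velocity constraints, in an open coordinate domain of the
configuration manifold: the metric `G`, the potential `V`, and a frame `e_1, …, e_k` of the
constraint distribution `D` (of rank `k`). -/
structure System (n k : ℕ) where
  dom : Set (E n)
  isOpen_dom : IsOpen dom
  G : E n → Matrix (Fin n) (Fin n) ℝ
  smooth_G : ∀ i j, ContDiffOn ℝ ∞ (fun q => G q i j) dom
  posDef_G : ∀ q ∈ dom, (G q).PosDef
  V : E n → ℝ
  smooth_V : ContDiffOn ℝ ∞ V dom
  e : Fin k → E n → E n
  smooth_e : ∀ A, ContDiffOn ℝ ∞ (e A) dom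
  indep_e : ∀ q ∈ dom, LinearIndependent ℝ (fun A => e A q)

namespace System

variable {n k : ℕ} (S : System n k)

/-- The components `ρ_A^i(q)` of the frame, `e_A = ρ_A^i ∂/∂q^i`. -/
def rho (A : Fin k) (i : Fin n) (q : E n) : ℝ := S.e A q i

/-- The vector `ρ_A^i(q) v^A ∂/∂q^i = v^A e_A(q)`. -/
def anchor (q : E n) (v : E k) : E n := ∑ A, v A • S.e A q

/-- The metric `𝒢_q(x, y)`. -/
def metric (q : E n) (x y : E n) : ℝ := ∑ i, ∑ j, G S q i j * x i * y j

/-- The matrix `(𝒢^D)_{AB} = 𝒢(e_A, e_B)`. -/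
def gD (q : E n) : Matrix (Fin k) (Fin k) ℝ :=
  Matrix.of fun A B => S.metric q (S.e A q) (S.e B q)

/-- The components, in the frame, of the `𝒢`-orthogonal projection of `x` to `D_q`. -/
def projCoeff (q : E n) (x : E n) (A : Fin k) : ℝ :=
  ∑ B, (S.gD q)⁻¹ A B * S.metric q x (S.e B q)

/-- The structure functions `C_{AB}^C` of the nonholonomic bracket,
`⟦e_A, e_B⟧ = 𝒫 [e_A, e_B] = C_{AB}^C e_C`. -/
def bracketCoeff (A B C : Fin k) (q : E n) : ℝ :=
  S.projCoeff q (VectorField.lieBracket ℝ (S.e A) (S.e B) q) C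

/-- The derivative `e_A(f)` of a function along a frame field. -/
def frameDeriv (A : Fin k) (f : E n → ℝ) (q : E n) : ℝ := fderiv ℝ f q (S.e A q)

/-- Twice `𝒢^D(∇_{e_A} e_B, e_D)`, by the Koszul formula for the nonholonomic bracket. -/
def koszul (A B D : Fin k) (q : E n) : ℝ :=
  S.frameDeriv A (fun x => S.gD x B D) q + S.frameDeriv B (fun x => S.gD x A D) q
    - S.frameDeriv D (fun x => S.gD x A B) q
    + ∑ F, (S.bracketCoeff A B F q * S.gD q F D - S.bracketCoeff A D F q * S.gD q F B
        - S.bracketCoeff B D F q * S.gD q F A)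

/-- The Christoffel symbols `Γ_{AB}^C`, `∇_{e_A} e_B = Γ_{AB}^C e_C`, of the Levi-Civita
connection of `𝒢^D` and the nonholonomic bracket. The facts `christoffel_torsion`,
`christoffel_metric` and `christoffel_unique` below show that these are the symbols determined by
the two characteristic properties of that connection. -/
def christoffel (A B C : Fin k) (q : E n) : ℝ :=
  (1 / 2) * ∑ D, (S.gD q)⁻¹ C D * S.koszul A B D q

/-- The component `Γ_{CB}^A v^C v^B + (𝒢^D)^{AB} ρ_B^i ∂V/∂q^i` of
`∇_γ γ + grad V` without the acceleration term. -/
def force (q : E n) (v : E k) : E k :=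
  WithLp.toLp 2 fun A =>
    (∑ C, ∑ B, S.christoffel C B A q * v C * v B)
      + ∑ B, ∑ i, (S.gD q)⁻¹ A B * S.rho B i q * pd S.V q i

/-- The set `D^(2) ⊂ TD` of the velocities `(q, v, q̇, v̇)` of admissible curves in `D`. -/
def D2 : Set (E n × E k × E n × E k) :=
  {a | ∃ δ > 0, ∃ (q : ℝ → E n) (v : ℝ → E k),
    (∀ t ∈ Ioo (-δ) δ, q t ∈ S.dom ∧ HasDerivAt q (S.anchor (q t) (v t)) t
      ∧ DifferentiableAt ℝ v t)
    ∧ a = (q 0, v 0, deriv q 0, deriv v 0)}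

/-! ### The Christoffel symbols are the ones of the Levi-Civita connection -/

theorem metric_comm {q : E n} (hq : q ∈ S.dom) (x y : E n) :
    S.metric q x y = S.metric q y x := by
  have h := (S.posDef_G q hq).isHermitian
  unfold metric
  rw [Finset.sum_comm]
  refine Finset.sum_congr rfl fun j _ => Finset.sum_congr rfl fun i _ => ?_
  have h2 : S.G q i j = S.G q j i := by
    have := h.apply i j
    simpa using this.symm
  rw [h2]; ring

theorem gD_comm {q : E n} (hq : q ∈ S.dom) (A B : Fin k) : S.gD q A B = S.gD q B A :=
  S.metric_comm hq _ _

theorem gD_quadratic (q : E n) (c : Fin k → ℝ) :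
    ∑ A, ∑ B, c A * S.gD q A B * c B
      = S.metric q (∑ A, c A • S.e A q) (∑ A, c A • S.e A q) := by
  have h : ∀ i, (∑ A, c A • S.e A q) i = ∑ A, c A * S.e A q i := fun i => by simp
  simp only [metric, h, gD, Matrix.of_apply]
  simp only [Finset.mul_sum, Finset.sum_mul]
  have h1 : ∀ (i j : Fin n), (∑ B, ∑ A, S.G q i j * (c A * S.e A q i) * (c B * S.e B q j))
      = ∑ A, ∑ B, S.G q i j * (c A * S.e A q i) * (c B * S.e B q j) :=
    fun i j => Finset.sum_comm
  simp only [h1]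
  rw [Finset.sum_congr rfl fun i _ => Finset.sum_comm]
  rw [Finset.sum_comm]
  refine Finset.sum_congr rfl fun A _ => ?_
  rw [Finset.sum_congr rfl fun i _ => Finset.sum_comm]
  rw [Finset.sum_comm]
  refine Finset.sum_congr rfl fun B _ => Finset.sum_congr rfl fun i _ =>
    Finset.sum_congr rfl fun j _ => ?_
  ring

theorem isUnit_det_gD {q : E n} (hq : q ∈ S.dom) : IsUnit (S.gD q).det := by
  rw [isUnit_iff_ne_zero]
  intro h0
  obtain ⟨c, hc, hc0⟩ := Matrix.exists_mulVec_eq_zero_iff.mpr h0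
  have h1 : ∑ A, ∑ B, c A * S.gD q A B * c B = 0 := by
    refine Finset.sum_eq_zero fun A _ => ?_
    have h2 : ∑ B, S.gD q A B * c B = 0 := congrFun hc0 A
    have h3 : ∑ B, c A * S.gD q A B * c B = c A * ∑ B, S.gD q A B * c B := by
      rw [Finset.mul_sum]
      exact Finset.sum_congr rfl fun B _ => by ring
    rw [h3, h2, mul_zero]
  rw [S.gD_quadratic] at h1
  set x : E n := ∑ A, c A • S.e A q with hx
  have hx0 : x ≠ 0 := fun h => hc (funext fun A =>
    (Fintype.linearIndependent_iff.mp (S.indep_e q hq)) c h A)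
  have hpos := (S.posDef_G q hq).dotProduct_mulVec_pos (x := fun i => x i)
    (fun h => hx0 (by ext i; exact congrFun h i))
  refine hpos.ne' ?_
  rw [← h1]
  simp only [metric, dotProduct, Matrix.mulVec, Finset.mul_sum]
  refine Finset.sum_congr rfl fun i _ => Finset.sum_congr rfl fun j _ => ?_
  simp only [Pi.star_apply, star_trivial]
  ring

theorem sum_gD_inv {q : E n} (hq : q ∈ S.dom) (w : Fin k → ℝ) (B : Fin k) :
    ∑ C, (∑ D, (S.gD q)⁻¹ C D * w D) * S.gD q C B = w B := by
  have h := Matrix.mul_nonsing_inv (S.gD q) (S.isUnit_det_gD hq)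
  have h1 : Matrix.mulVec (S.gD q) (Matrix.mulVec (S.gD q)⁻¹ w) = w := by
    rw [Matrix.mulVec_mulVec, h, Matrix.one_mulVec]
  have h2 := congrFun h1 B
  simp only [Matrix.mulVec, dotProduct] at h2
  rw [← h2]
  exact Finset.sum_congr rfl fun C _ => by rw [S.gD_comm hq C B]; ring

theorem gD_cancel {q : E n} (hq : q ∈ S.dom) {a b : Fin k → ℝ}
    (h : ∀ B, ∑ C, a C * S.gD q C B = ∑ C, b C * S.gD q C B) : a = b := by
  have hu := (Matrix.isUnit_iff_isUnit_det _).mpr (S.isUnit_det_gD hq)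
  exact Matrix.vecMul_injective_of_isUnit hu (funext h)

/-- `projCoeff` gives the orthogonal projection: `𝒢(𝒫 x, e_B) = 𝒢(x, e_B)` for all `B`. -/
theorem projCoeff_spec {q : E n} (hq : q ∈ S.dom) (x : E n) (B : Fin k) :
    ∑ C, S.projCoeff q x C * S.gD q C B = S.metric q x (S.e B q) :=
  S.sum_gD_inv hq _ B

theorem christoffel_lower {q : E n} (hq : q ∈ S.dom) (A B D : Fin k) :
    ∑ C, S.christoffel A B C q * S.gD q C D = (1 / 2) * S.koszul A B D q := by
  have h := S.sum_gD_inv hq (fun F => (1 / 2) * S.koszul A B F q) D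
  rw [← h]
  refine Finset.sum_congr rfl fun C _ => ?_
  unfold christoffel
  rw [Finset.mul_sum]
  congr 1
  exact Finset.sum_congr rfl fun F _ => by ring

theorem bracketCoeff_antisymm (A B C : Fin k) (q : E n) :
    S.bracketCoeff A B C q = -S.bracketCoeff B A C q := by
  unfold bracketCoeff
  rw [VectorField.lieBracket_swap]
  simp [projCoeff, metric, Finset.sum_neg_distrib]

theorem gD_frameDeriv_comm {q : E n} (hq : q ∈ S.dom) (A B C : Fin k) :
    S.frameDeriv A (fun x => S.gD x B C) q = S.frameDeriv A (fun x => S.gD x C B) q := by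
  unfold frameDeriv
  have h : (fun x => S.gD x B C) =ᶠ[𝓝 q] fun x => S.gD x C B := by
    filter_upwards [S.isOpen_dom.mem_nhds hq] with x hx using S.gD_comm hx B C
  rw [h.fderiv_eq]

/-- `⟦e_A, e_B⟧ = ∇_{e_A} e_B - ∇_{e_B} e_A`. -/
theorem christoffel_torsion {q : E n} (hq : q ∈ S.dom) (A B C : Fin k) :
    S.bracketCoeff A B C q = S.christoffel A B C q - S.christoffel B A C q := by
  have h : (fun C => S.bracketCoeff A B C q)
      = fun C => S.christoffel A B C q - S.christoffel B A C q := by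
    refine S.gD_cancel hq fun D => ?_
    simp only [sub_mul, Finset.sum_sub_distrib]
    rw [S.christoffel_lower hq, S.christoffel_lower hq]
    unfold koszul
    rw [S.gD_frameDeriv_comm hq D A B]
    simp only [Finset.sum_sub_distrib]
    simp only [S.bracketCoeff_antisymm B A, neg_mul, Finset.sum_neg_distrib]
    ring
  exact congrFun h C

/-- `e_A(𝒢^D(e_B, e_C)) = 𝒢^D(∇_{e_A} e_B, e_C) + 𝒢^D(e_B, ∇_{e_A} e_C)`. -/
theorem christoffel_metric {q : E n} (hq : q ∈ S.dom) (A B C : Fin k) :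
    S.frameDeriv A (fun x => S.gD x B C) q
      = ∑ D, S.christoffel A B D q * S.gD q D C + ∑ D, S.christoffel A C D q * S.gD q B D := by
  have h1 : ∑ D, S.christoffel A C D q * S.gD q B D
      = ∑ D, S.christoffel A C D q * S.gD q D B :=
    Finset.sum_congr rfl fun D _ => by rw [S.gD_comm hq]
  rw [h1, S.christoffel_lower hq, S.christoffel_lower hq]
  unfold koszul
  rw [S.gD_frameDeriv_comm hq A C B]
  simp only [Finset.sum_sub_distrib]
  simp only [S.bracketCoeff_antisymm C B, neg_mul, Finset.sum_neg_distrib]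
  ring

/-- The two properties determine the Christoffel symbols. -/
theorem christoffel_unique {q : E n} (hq : q ∈ S.dom) (Γ : Fin k → Fin k → Fin k → ℝ)
    (htor : ∀ A B C, S.bracketCoeff A B C q = Γ A B C - Γ B A C)
    (hmet : ∀ A B C, S.frameDeriv A (fun x => S.gD x B C) q
      = ∑ D, Γ A B D * S.gD q D C + ∑ D, Γ A C D * S.gD q B D) (A B C : Fin k) :
    Γ A B C = S.christoffel A B C q := by
  have hmet' : ∀ A B C, S.frameDeriv A (fun x => S.gD x B C) q
      = ∑ D, Γ A B D * S.gD q D C + ∑ D, Γ A C D * S.gD q D B := fun A B C => by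
    rw [hmet]
    congr 1
    exact Finset.sum_congr rfl fun D _ => by rw [S.gD_comm hq]
  have h : (fun C => Γ A B C) = fun C => S.christoffel A B C q := by
    refine S.gD_cancel hq fun D => ?_
    rw [S.christoffel_lower hq]
    unfold koszul
    rw [hmet', hmet', hmet']
    simp only [htor, sub_mul, Finset.sum_sub_distrib]
    ring
  exact congrFun h C

end System

/-- The data of the optimal trajectory tracking problem on the fixed interval `[0, T]`:
reference trajectory `(q_r, v_r)` in `D`, regularization parameter `ε`, weight `ω` (`weight`), terminal cost
`Φ`, terminal constraint `r` with values in `ℝ^d`, and initial state `(q_0, v_0) ∈ D`. The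
parameter `ε` is positive in the problem proper; its sign is left free here, so that the singular
value `ε = 0` makes sense. -/
structure Tracking {n k : ℕ} (S : System n k) (d : ℕ) where
  T : ℝ
  T_pos : 0 < T
  ε : ℝ
  weight : ℝ
  weight_pos : 0 < weight
  qr : ℝ → E n
  vr : ℝ → E k
  continuous_qr : ContinuousOn qr (Icc 0 T)
  continuous_vr : ContinuousOn vr (Icc 0 T)
  qr_mem : ∀ t ∈ Icc 0 T, qr t ∈ S.dom
  q0 : E n
  v0 : E k
  q0_mem : q0 ∈ S.dom
  Φ : E n × E k → ℝ
  contDiff_Φ : ContDiffOn ℝ 1 Φ (S.dom ×ˢ univ)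
  r : E n × E k → E n × E k → E d
  contDiff_r : ContDiffOn ℝ 1 (fun z => r z (qr T, vr T)) (S.dom ×ˢ univ)

namespace Tracking

variable {n k d : ℕ} {S : System n k} (P : Tracking S d)

/-- The time interval `[0, T]`. -/
def I : Set ℝ := Icc 0 P.T

/-- The velocity of a curve on `[0, T]` (one-sided at the end points). -/
def dot {F : Type*} [NormedAddCommGroup F] [NormedSpace ℝ F] (c : ℝ → F) (t : ℝ) : F :=
  derivWithin c P.I t

/-- The running cost `𝒞`, at time `t`. -/
def cost (t : ℝ) (q : E n) (v u : E k) : ℝ :=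
  (1 / 2) * (‖q - P.qr t‖ ^ 2 + ‖v - P.vr t‖ ^ 2 + P.ε * ‖u‖ ^ 2)

/-- The terminal constraint function `r(·, γ_r(T))`. -/
def rT (z : E n × E k) : E d := P.r z (P.qr P.T, P.vr P.T)

/-- A continuously differentiable curve `(q(t), v(t))`, `t ∈ [0, T]`, in `D` that starts at the
prescribed initial state. -/
structure IsCurve (q : ℝ → E n) (v : ℝ → E k) : Prop where
  contDiff_q : ContDiffOn ℝ 1 q P.I
  contDiff_v : ContDiffOn ℝ 1 v P.I
  mem_dom : ∀ t ∈ P.I, q t ∈ S.dom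
  init_q : q 0 = P.q0
  init_v : v 0 = P.v0

/-! ### The tracking problem as an optimal control problem -/

/-- `(q, v, u)` solves the fully actuated nonholonomic equations and satisfies the boundary
conditions. -/
structure IsControlled (q : ℝ → E n) (v u : ℝ → E k) : Prop where
  curve : P.IsCurve q v
  continuous_u : ContinuousOn u P.I
  eq_q : ∀ t ∈ P.I, HasDerivWithinAt q (S.anchor (q t) (v t)) P.I t
  eq_v : ∀ t ∈ P.I, HasDerivWithinAt v (-S.force (q t) (v t) + u t) P.I t
  terminal : P.rT (q P.T, v P.T) = 0

/-- The cost functional `𝒥`. -/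
def J (q : ℝ → E n) (v u : ℝ → E k) : ℝ :=
  (∫ t in (0 : ℝ)..P.T, P.cost t (q t) (v t) (u t)) + P.weight * P.Φ (q P.T, v P.T)

/-- `(q, v, u)` solves the optimal trajectory tracking problem. -/
def IsSolution (q : ℝ → E n) (v u : ℝ → E k) : Prop :=
  P.IsControlled q v u ∧ ∀ q' v' u', P.IsControlled q' v' u' → P.J q v u ≤ P.J q' v' u'

/-- The state equations linearized along `(q, v)` are controllable on `[0, T]`. -/
def LinearizedControllable (q : ℝ → E n) (v : ℝ → E k) : Prop :=
  ∀ (a : E n) (b : E k), ∃ (x : ℝ → E n) (y w : ℝ → E k),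
    ContinuousOn w P.I ∧ x 0 = 0 ∧ y 0 = 0 ∧ x P.T = a ∧ y P.T = b ∧
    ∀ t ∈ P.I,
      HasDerivWithinAt x
        (fderiv ℝ (fun z => S.anchor z (v t)) (q t) (x t) + S.anchor (q t) (y t)) P.I t ∧
      HasDerivWithinAt y
        (-(fderiv ℝ (fun z => S.force z (v t)) (q t) (x t)
            + fderiv ℝ (fun z => S.force (q t) z) (v t) (y t)) + w t) P.I t

/-! ### The variational problem on `D^(2)` -/

/-- The Lagrangian `ℒ` on `D^(2)` in the coordinates `(q, v, v̇)`, at time `t`, with cost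
multiplier `lam0`. -/
def lagr (lam0 t : ℝ) (q : E n) (v w : E k) : ℝ :=
  lam0 * P.cost t q v (w + S.force q v)

/-- The curve satisfies the boundary conditions, and its velocity lies in `D^(2)`. -/
structure IsConstrained (q : ℝ → E n) (v : ℝ → E k) : Prop where
  curve : P.IsCurve q v
  mem_D2 : ∀ t ∈ P.I, (q t, v t, P.dot q t, P.dot v t) ∈ S.D2
  terminal : P.rT (q P.T, v P.T) = 0

/-- The action of `ℒ` (with `lam0 = 1`) plus the terminal cost. -/
def action (q : ℝ → E n) (v : ℝ → E k) : ℝ :=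
  (∫ t in (0 : ℝ)..P.T, P.lagr 1 t (q t) (v t) (P.dot v t)) + P.weight * P.Φ (q P.T, v P.T)

/-- `(q, v)` solves the constrained variational problem. -/
def IsConstrainedMin (q : ℝ → E n) (v : ℝ → E k) : Prop :=
  P.IsConstrained q v ∧ ∀ q' v', P.IsConstrained q' v' → P.action q v ≤ P.action q' v'

/-- The control `u^A = v̇^A + Γ_{CB}^A v^C v^B + (𝒢^D)^{AB} ρ_B^i ∂V/∂q^i` along a curve. -/
def control (q : ℝ → E n) (v : ℝ → E k) (t : ℝ) : E k := P.dot v t + S.force (q t) (v t)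

/-- The augmented Lagrangian `ℒ - λ_i (q̇^i - ρ_A^i v^A)`. -/
def augLagr (lam0 t : ℝ) (q : E n) (v : E k) (qdot : E n) (w : E k) (lam : E n) : ℝ :=
  P.lagr lam0 t q v w - ∑ i, lam i * (qdot i - ∑ A, S.rho A i q * v A)

/-- The augmented functional `𝒥̃`. -/
def augAction (lam0 : ℝ) (q : ℝ → E n) (v : ℝ → E k) (lam : ℝ → E n) (lamT : E d) : ℝ :=
  P.weight * P.Φ (q P.T, v P.T) + ∑ a, lamT a * P.rT (q P.T, v P.T) a
    + ∫ t in (0 : ℝ)..P.T, P.augLagr lam0 t (q t) (v t) (P.dot q t) (P.dot v t) (lam t)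

/-- `(q, v, λ, λ_T)` is a critical point of `𝒥̃` for the variations that fix `(q(0), v(0))`. -/
def IsCritical (lam0 : ℝ) (q : ℝ → E n) (v : ℝ → E k) (lam : ℝ → E n) (lamT : E d) : Prop :=
  ∀ (x : ℝ → E n) (y : ℝ → E k) (l : ℝ → E n) (m : E d),
    ContDiffOn ℝ 1 x P.I → ContDiffOn ℝ 1 y P.I → ContinuousOn l P.I → x 0 = 0 → y 0 = 0 →
    HasDerivAt (fun s : ℝ => P.augAction lam0 (fun t => q t + s • x t) (fun t => v t + s • y t)
      (fun t => lam t + s • l t) (lamT + s • m)) 0 0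

/-- `∂ℒ/∂v̇^A` along a curve. -/
def momentum (lam0 : ℝ) (q : ℝ → E n) (v : ℝ → E k) (t : ℝ) : E k :=
  WithLp.toLp 2 fun A => pd (fun w => P.lagr lam0 t (q t) (v t) w) (P.dot v t) A

/-- The second-order Euler-Lagrange equations of the augmented Lagrangian. -/
structure EulerLagrange (lam0 : ℝ) (q : ℝ → E n) (v : ℝ → E k) (lam : ℝ → E n) : Prop where
  eq_lam : ∀ t ∈ P.I, ∀ i, HasDerivWithinAt (fun s => lam s i)
    (-(pd (fun x => P.lagr lam0 t x (v t) (P.dot v t)) (q t) i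
        + ∑ j, ∑ A, lam t j * pd (S.rho A j) (q t) i * v t A)) P.I t
  eq_q : ∀ t ∈ P.I, ∀ i, HasDerivWithinAt (fun s => q s i) (∑ A, S.rho A i (q t) * v t A) P.I t
  eq_v : ∀ t ∈ P.I, ∀ A, HasDerivWithinAt (fun s => P.momentum lam0 q v s A)
    (pd (fun y => P.lagr lam0 t (q t) y (P.dot v t)) (v t) A
        + ∑ i, S.rho A i (q t) * lam t i) P.I t

/-- The terminal constraint and the transversality conditions for costates `λ`, `μ`, with weight
`w` of the terminal cost. -/
structure Transversality (w : ℝ) (q : ℝ → E n) (v : ℝ → E k) (lam : ℝ → E n) (mu : ℝ → E k)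
    (lamT : E d) : Prop where
  terminal : P.rT (q P.T, v P.T) = 0
  lam_T : ∀ i, lam P.T i = w * pd (fun x => P.Φ (x, v P.T)) (q P.T) i
    + ∑ a, lamT a * pd (fun x => P.rT (x, v P.T) a) (q P.T) i
  mu_T : ∀ A, mu P.T A = w * pd (fun y => P.Φ (q P.T, y)) (v P.T) A
    + ∑ a, lamT a * pd (fun y => P.rT (q P.T, y) a) (v P.T) A

/-- The matrix `∂²ℒ/∂v̇^A∂v̇^B`. -/
def hessian (lam0 t : ℝ) (q : E n) (v w : E k) : Matrix (Fin k) (Fin k) ℝ :=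
  Matrix.of fun A B => pd (fun w' => pd (fun w'' => P.lagr lam0 t q v w'') w' B) w A

/-- The problem is regular: the matrix `∂²ℒ/∂v̇^A∂v̇^B` is nonsingular everywhere. -/
def Regular (lam0 : ℝ) : Prop :=
  ∀ t ∈ P.I, ∀ q ∈ S.dom, ∀ v w : E k, (P.hessian lam0 t q v w).det ≠ 0

/-! ### Pontryagin's maximum principle -/

/-- The Hamiltonian. -/
def ham (lam0 t : ℝ) (q : E n) (v : E k) (lam : E n) (mu u : E k) : ℝ :=
  lam0 * P.cost t q v u + ∑ i, ∑ A, lam i * S.rho A i q * v A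
    + ∑ A, mu A * (-S.force q v + u) A

/-- The state and costate equations. -/
structure HamiltonEquations (lam0 : ℝ) (q : ℝ → E n) (v : ℝ → E k) (lam : ℝ → E n)
    (mu u : ℝ → E k) : Prop where
  eq_q : ∀ t ∈ P.I, HasDerivWithinAt q (S.anchor (q t) (v t)) P.I t
  eq_v : ∀ t ∈ P.I, HasDerivWithinAt v (-S.force (q t) (v t) + u t) P.I t
  eq_lam : ∀ t ∈ P.I, ∀ i, HasDerivWithinAt (fun s => lam s i)
    (-pd (fun x => P.ham lam0 t x (v t) (lam t) (mu t) (u t)) (q t) i) P.I t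
  eq_mu : ∀ t ∈ P.I, ∀ A, HasDerivWithinAt (fun s => mu s A)
    (-pd (fun y => P.ham lam0 t (q t) y (lam t) (mu t) (u t)) (v t) A) P.I t

/-- The stationarity condition `∂ℋ/∂u = 0`. -/
def Stationary (lam0 : ℝ) (q : ℝ → E n) (v : ℝ → E k) (lam : ℝ → E n) (mu u : ℝ → E k) : Prop :=
  ∀ t ∈ P.I, ∀ A, pd (fun z => P.ham lam0 t (q t) (v t) (lam t) (mu t) z) (u t) A = 0

/-- The control minimizes the Hamiltonian. -/
def Minimizing (lam0 : ℝ) (q : ℝ → E n) (v : ℝ → E k) (lam : ℝ → E n) (mu u : ℝ → E k) : Prop :=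
  ∀ t ∈ P.I, ∀ z, P.ham lam0 t (q t) (v t) (lam t) (mu t) (u t)
    ≤ P.ham lam0 t (q t) (v t) (lam t) (mu t) z

end Tracking

end Nonholonomic

end

/-!
The fully actuated system can realize every `C¹` velocity curve `v`, so the tracking problem is a
variational problem for `(q, v)` under the constraint `q̇ = v^A e_A(q)` alone. It is treated as a
constrained extremum problem on the Banach space of the pairs `(q, v̇)` of continuous functions on
`[0, T]`, the constraint being written as an integral equation. Superposition operators
`x ↦ f ∘ x` of `C¹` functions are strictly differentiable there
(`hasStrictFDerivAt_superpose`), and this gives the derivative of the action, of the constraint,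
and of `𝒥̃` along any variation (`IsCurve.hasDerivAt_augAction`).

For a minimizer, Mathlib's Lagrange multiplier theorem yields a multiplier for the integral
equation, one for the terminal condition, and `λ₀`. The derivative of the integral equation in the
direction of `q` is `1 - V` with a Volterra operator `V`, hence onto
(`surjective_one_sub_volterra`); so the last two multipliers cannot both vanish, and the first one
disappears when only variations compatible with the linearized constraint are used
(`IsCurve.exists_terminal_multiplier`). The costate `λ` is the solution of the adjoint equation with
the terminal value that transversality prescribes. Integration by parts against it removes the
variation of `q`, and the lemma of du Bois-Reymond for the free variation of `v` gives the remaining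
Euler-Lagrange equation together with the terminal value of `∂ℒ/∂v̇` (`IsCurve.exists_costate`).
With `r` as terminal constraint this is the transversality statement; with fixed end points it gives
multipliers that do not both vanish at `T`. If `λ₀ = 0`, then `λ` is orthogonal to all solutions of
the linearized state equations, so controllability forces `λ(T) = 0` and hence excludes this case.

Critical points of `𝒥̃` are characterized by the same lemma of du Bois-Reymond, applied to the
variations of `q` and of `v` separately. The equivalence with the maximum principle comes from the
explicit gradients of `ℒ` and `ℋ`: stationarity says `μ = -λ₀ ε u`, which is `-∂ℒ/∂v̇` for the control
of the curve, and the costate equations then are the Euler-Lagrange equations. The Hessian is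
`λ₀ ε` times the identity.
-/

noncomputable section

namespace Nonholonomic

/-! ### Continuous curves on a compact interval -/

section Curves

variable {T : ℝ} {X Y : Type*} [NormedAddCommGroup X] [NormedAddCommGroup Y]

/-- A function that is continuous on `[0, T]`, as an element of the Banach space
`C([0, T], X)`. -/
def restr (c : ℝ → X) (hc : ContinuousOn c (Icc 0 T)) : C(Icc (0 : ℝ) T, X) :=
  ⟨(Icc 0 T).domRestrict c, hc.domRestrict⟩

@[simp]
theorem restr_apply (c : ℝ → X) (hc : ContinuousOn c (Icc 0 T)) (t : Icc (0 : ℝ) T) :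
    restr c hc t = c t := rfl

theorem continuous_IccExtend (hT : 0 ≤ T) (x : C(Icc (0 : ℝ) T, X)) :
    Continuous (IccExtend hT x) :=
  x.continuous.Icc_extend'

theorem norm_IccExtend_le (hT : 0 ≤ T) (x : C(Icc (0 : ℝ) T, X)) (s : ℝ) :
    ‖IccExtend hT x s‖ ≤ ‖x‖ :=
  x.norm_coe_le_norm _

variable [NormedSpace ℝ X] [NormedSpace ℝ Y]

/-- The integration operator `x ↦ (t ↦ ∫₀ᵗ x)` on `C([0, T], X)`. -/
def primitive (hT : 0 ≤ T) : C(Icc (0 : ℝ) T, X) →L[ℝ] C(Icc (0 : ℝ) T, X) :=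
  LinearMap.mkContinuous
    { toFun := fun x => ⟨fun t => ∫ s in (0 : ℝ)..t, IccExtend hT x s,
        (intervalIntegral.continuous_primitive
          (fun a b => (continuous_IccExtend hT x).intervalIntegrable a b) 0).comp
          continuous_subtype_val⟩
      map_add' := fun x y => by
        ext t
        exact intervalIntegral.integral_add ((continuous_IccExtend hT x).intervalIntegrable _ _)
          ((continuous_IccExtend hT y).intervalIntegrable _ _)
      map_smul' := fun c x => by
        ext t
        exact intervalIntegral.integral_smul c _ } T
    (fun x => by
      refine (ContinuousMap.norm_le _ (by positivity)).2 fun t => ?_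
      have h := intervalIntegral.norm_integral_le_of_norm_le_const (a := (0 : ℝ)) (b := (t : ℝ))
        (fun s _ => norm_IccExtend_le hT x s)
      refine h.trans ?_
      rw [sub_zero, abs_of_nonneg t.2.1, mul_comm]
      exact mul_le_mul_of_nonneg_right t.2.2 (norm_nonneg _))

theorem primitive_apply (hT : 0 ≤ T) (x : C(Icc (0 : ℝ) T, X)) (t : Icc (0 : ℝ) T) :
    primitive hT x t = ∫ s in (0 : ℝ)..t, IccExtend hT x s := rfl

theorem primitive_zero (hT : 0 ≤ T) (x : C(Icc (0 : ℝ) T, X)) :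
    IccExtend hT (primitive hT x) 0 = 0 := by
  rw [IccExtend_of_mem hT _ (left_mem_Icc.2 hT), primitive_apply, intervalIntegral.integral_same]

theorem hasDerivWithinAt_primitive [CompleteSpace X] (hT : 0 ≤ T) (x : C(Icc (0 : ℝ) T, X))
    {t : ℝ} (ht : t ∈ Icc 0 T) :
    HasDerivWithinAt (IccExtend hT (primitive hT x)) (IccExtend hT x t) (Icc 0 T) t := by
  have h := (intervalIntegral.integral_hasDerivAt_right
    ((continuous_IccExtend hT x).intervalIntegrable 0 t)
    ((continuous_IccExtend hT x).stronglyMeasurableAtFilter _ _)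
    (continuous_IccExtend hT x).continuousAt).hasDerivWithinAt (s := Icc 0 T)
  refine h.congr (fun s hs => ?_) ?_
  · rw [IccExtend_of_mem hT _ hs, primitive_apply]
  · rw [IccExtend_of_mem hT _ ht, primitive_apply]

/-- The operator of pointwise application of a continuous family of operators. -/
def pointwise {K : Type*} [TopologicalSpace K] [CompactSpace K] (A : C(K, X →L[ℝ] Y)) :
    C(K, X) →L[ℝ] C(K, Y) :=
  LinearMap.mkContinuous
    { toFun := fun x => ⟨fun t => A t (x t), A.continuous.clm_apply x.continuous⟩
      map_add' := fun x y => by ext t; simp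
      map_smul' := fun c x => by ext t; simp } ‖A‖
    (fun x => (ContinuousMap.norm_le _ (by positivity)).2 fun t =>
      ((A t).le_opNorm _).trans (mul_le_mul (A.norm_coe_le_norm t) (x.norm_coe_le_norm t)
        (norm_nonneg _) ((norm_nonneg (A t)).trans (A.norm_coe_le_norm t))))

@[simp]
theorem pointwise_apply {K : Type*} [TopologicalSpace K] [CompactSpace K] (A : C(K, X →L[ℝ] Y))
    (x : C(K, X)) (t : K) : pointwise A x t = A t (x t) := rfl

/-! ### Linear differential equations -/

theorem norm_volterra_pow_apply_le (hT : 0 ≤ T) (A : C(Icc (0 : ℝ) T, X →L[ℝ] X))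
    (m : ℕ) (x : C(Icc (0 : ℝ) T, X)) (t : Icc (0 : ℝ) T) :
    ‖(((primitive hT).comp (pointwise A)) ^ m) x t‖
      ≤ (‖A‖ * t) ^ m / m.factorial * ‖x‖ := by
  induction m generalizing t with
  | zero => simpa using x.norm_coe_le_norm t
  | succ m ih =>
    rw [pow_succ', mul_apply_eq_comp, ContinuousLinearMap.comp_apply, primitive_apply]
    have hle : ∀ s ∈ Ioc (0 : ℝ) t,
        ‖IccExtend hT (pointwise A ((((primitive hT).comp (pointwise A)) ^ m) x)) s‖
          ≤ ‖A‖ ^ (m + 1) / m.factorial * ‖x‖ * s ^ m := by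
      intro s hs
      have hs' : s ∈ Icc (0 : ℝ) T := ⟨hs.1.le, hs.2.trans t.2.2⟩
      rw [IccExtend_of_mem hT _ hs', pointwise_apply]
      refine ((A _).le_opNorm _).trans ?_
      refine (mul_le_mul (A.norm_coe_le_norm _) (ih ⟨s, hs'⟩) (norm_nonneg _)
        (norm_nonneg _)).trans (le_of_eq ?_)
      simp only [mul_pow]
      ring
    refine (intervalIntegral.norm_integral_le_of_norm_le t.2.1
      (Filter.Eventually.of_forall fun s hs => hle s hs)
      (Continuous.intervalIntegrable (by fun_prop) _ _)).trans (le_of_eq ?_)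
    rw [intervalIntegral.integral_const_mul, integral_pow, Nat.factorial_succ]
    have : (m.factorial : ℝ) ≠ 0 := by positivity
    push_cast
    simp only [mul_pow]
    field_simp
    ring

/-- A Volterra operator is quasinilpotent, so `1 - V` is onto: some power of `V` has norm
less than `1`, and `1 - V ^ m = (1 - V) (1 + ⋯ + V ^ (m - 1))`. -/
theorem surjective_one_sub_volterra [CompleteSpace X] (hT : 0 ≤ T)
    (A : C(Icc (0 : ℝ) T, X →L[ℝ] X)) (h : C(Icc (0 : ℝ) T, X)) :
    ∃ x, x - primitive hT (pointwise A x) = h := by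
  set V := (primitive hT).comp (pointwise A) with hV
  obtain ⟨m, hm⟩ := ((FloorSemiring.tendsto_pow_div_factorial_atTop (‖A‖ * T)).eventually
    (gt_mem_nhds (zero_lt_one))).exists
  have hnorm : ‖V ^ m‖ < 1 := by
    refine lt_of_le_of_lt (ContinuousLinearMap.opNorm_le_bound _ (by positivity) fun x => ?_) hm
    refine (ContinuousMap.norm_le _ (by positivity)).2 fun t => ?_
    refine (norm_volterra_pow_apply_le hT A m x t).trans ?_
    have h0 : 0 ≤ (t : ℝ) := t.2.1
    have h1 : (t : ℝ) ≤ T := t.2.2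
    gcongr
  have hu : (1 - V) * ((∑ i ∈ Finset.range m, V ^ i) * ↑(Units.oneSub (V ^ m) hnorm)⁻¹) = 1 := by
    rw [← mul_assoc, mul_neg_geom_sum, ← Units.val_oneSub (V ^ m) hnorm, Units.mul_inv]
  refine ⟨((∑ i ∈ Finset.range m, V ^ i) * ↑(Units.oneSub (V ^ m) hnorm)⁻¹) h, ?_⟩
  have h2 := congrArg (fun L : C(Icc (0 : ℝ) T, X) →L[ℝ] C(Icc (0 : ℝ) T, X) => L h) hu
  exact h2

theorem exists_linear_ode_forward [CompleteSpace X] (hT : 0 ≤ T) {A : ℝ → X →L[ℝ] X}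
    (hA : ContinuousOn A (Icc 0 T)) {b : ℝ → X} (hb : ContinuousOn b (Icc 0 T)) (x₀ : X) :
    ∃ x : ℝ → X, x 0 = x₀ ∧ ∀ t ∈ Icc 0 T, HasDerivWithinAt x (A t (x t) + b t) (Icc 0 T) t := by
  obtain ⟨x, hx⟩ := surjective_one_sub_volterra hT (restr A hA)
    (ContinuousMap.const _ x₀ + primitive hT (restr b hb))
  have hx' : ∀ t ∈ Icc 0 T, IccExtend hT x t = x₀ + IccExtend hT
      (primitive hT (pointwise (restr A hA) x + restr b hb)) t := by
    intro t ht
    have h1 := congrArg (fun c : C(Icc (0 : ℝ) T, X) => c ⟨t, ht⟩) (sub_eq_iff_eq_add.1 hx)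
    rw [IccExtend_of_mem hT _ ht, IccExtend_of_mem hT _ ht, map_add]
    refine h1.trans ?_
    simp only [ContinuousMap.add_apply, ContinuousMap.const_apply]
    abel
  refine ⟨IccExtend hT x, ?_, fun t ht => ?_⟩
  · rw [hx' 0 (left_mem_Icc.2 hT), primitive_zero, add_zero]
  · have h := (hasDerivWithinAt_primitive hT
      (pointwise (restr A hA) x + restr b hb) ht).const_add x₀
    refine (h.congr hx' (hx' t ht)).congr_deriv ?_
    rw [IccExtend_of_mem hT _ ht, IccExtend_of_mem hT _ ht]
    rfl

theorem exists_linear_ode_backward [CompleteSpace X] (hT : 0 ≤ T) {A : ℝ → X →L[ℝ] X}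
    (hA : ContinuousOn A (Icc 0 T)) {b : ℝ → X} (hb : ContinuousOn b (Icc 0 T)) (x₁ : X) :
    ∃ x : ℝ → X, x T = x₁ ∧ ∀ t ∈ Icc 0 T, HasDerivWithinAt x (A t (x t) + b t) (Icc 0 T) t := by
  have hmaps : MapsTo (fun t => T - t) (Icc 0 T) (Icc 0 T) := fun t ht =>
    ⟨sub_nonneg.2 ht.2, sub_le_self _ ht.1⟩
  have hc : ContinuousOn (fun t : ℝ => T - t) (Icc 0 T) := by fun_prop
  obtain ⟨y, hy0, hy⟩ := exists_linear_ode_forward hT (hA.comp hc hmaps).neg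
    (hb.comp hc hmaps).neg x₁
  refine ⟨fun t => y (T - t), by simpa using hy0, fun t ht => ?_⟩
  have h := (hy (T - t) (hmaps ht)).scomp t
    (((hasDerivAt_id t).const_sub T).hasDerivWithinAt (s := Icc 0 T)) hmaps
  refine h.congr_deriv ?_
  simp [add_comm]

/-! ### The fundamental lemma of the calculus of variations -/

theorem integral_eq_sub_of_hasDerivWithinAt_Icc [CompleteSpace X] (hT : 0 ≤ T) {f f' : ℝ → X}
    (hf : ∀ t ∈ Icc 0 T, HasDerivWithinAt f (f' t) (Icc 0 T) t)
    (hf' : ContinuousOn f' (Icc 0 T)) : ∫ t in (0 : ℝ)..T, f' t = f T - f 0 :=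
  intervalIntegral.integral_eq_sub_of_hasDerivAt_of_le hT
    (fun t ht => (hf t ht).continuousWithinAt)
    (fun t ht => (hf t (Ioo_subset_Icc_self ht)).hasDerivAt (Icc_mem_nhds ht.1 ht.2))
    (hf'.intervalIntegrable_of_Icc hT)

theorem eq_zero_of_integral_inner_self {W : Type*} [NormedAddCommGroup W] [InnerProductSpace ℝ W]
    (hT : 0 < T) {w : ℝ → W} (hw : ContinuousOn w (Icc 0 T))
    (h : ∫ t in (0 : ℝ)..T, inner ℝ (w t) (w t) = 0) : ∀ t ∈ Icc 0 T, w t = 0 := by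
  by_contra! hne
  obtain ⟨t, ht, hwt⟩ := hne
  exact (intervalIntegral.integral_pos hT (f := fun t => inner ℝ (w t) (w t)) (by fun_prop)
    (fun s _ => real_inner_self_nonneg) ⟨t, ht, real_inner_self_pos.2 hwt⟩).ne' h

/-- The lemma of du Bois-Reymond, with a free right end point. -/
theorem du_bois_reymond {W : Type*} [NormedAddCommGroup W] [InnerProductSpace ℝ W]
    [CompleteSpace W] (hT : 0 < T) {a b : ℝ → W} (ha : ContinuousOn a (Icc 0 T))
    (hb : ContinuousOn b (Icc 0 T)) (c : W)
    (h : ∀ y y' : ℝ → W, (∀ t ∈ Icc 0 T, HasDerivWithinAt y (y' t) (Icc 0 T) t) →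
      ContinuousOn y' (Icc 0 T) → y 0 = 0 →
      (∫ t in (0 : ℝ)..T, (inner ℝ (a t) (y t) + inner ℝ (b t) (y' t))) + inner ℝ c (y T) = 0) :
    b T = -c ∧ ∀ t ∈ Icc 0 T, HasDerivWithinAt b (a t) (Icc 0 T) t := by
  set p : ℝ → W := IccExtend hT.le (primitive hT.le (restr a ha)) with hp
  have hp' : ∀ t ∈ Icc 0 T, HasDerivWithinAt p (a t) (Icc 0 T) t := fun t ht => by
    have := hasDerivWithinAt_primitive hT.le (restr a ha) ht
    rwa [IccExtend_of_mem hT.le _ ht] at this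
  have hpc : ContinuousOn p (Icc 0 T) := (continuous_IccExtend _ _).continuousOn
  -- The function `w` has to vanish; its primitive `y` is the variation that shows it.
  set w : ℝ → W := fun t => b t - (p t - p T - c) with hw
  have hwc : ContinuousOn w (Icc 0 T) := by fun_prop
  set y : ℝ → W := IccExtend hT.le (primitive hT.le (restr w hwc)) with hy
  have hy' : ∀ t ∈ Icc 0 T, HasDerivWithinAt y (w t) (Icc 0 T) t := fun t ht => by
    have := hasDerivWithinAt_primitive hT.le (restr w hwc) ht
    rwa [IccExtend_of_mem hT.le _ ht] at this
  have hyc : ContinuousOn y (Icc 0 T) := (continuous_IccExtend _ _).continuousOn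
  have hy0 : y 0 = 0 := primitive_zero _ _
  have h1 := h y w hy' hwc hy0
  have h2 := integral_eq_sub_of_hasDerivWithinAt_Icc hT.le
    (f := fun t => inner ℝ (p t - p T - c) (y t))
    (f' := fun t => inner ℝ (p t - p T - c) (w t) + inner ℝ (a t) (y t))
    (fun t ht => (((hp' t ht).sub_const (p T)).sub_const c).inner ℝ (hy' t ht)) (by fun_prop)
  have hi : ∀ {f : ℝ → ℝ}, ContinuousOn f (Icc 0 T) → IntervalIntegrable f volume 0 T :=
    fun hf => hf.intervalIntegrable_of_Icc hT.le
  have h3 : ∫ t in (0 : ℝ)..T, inner ℝ (w t) (w t) = 0 := by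
    have h4 : ∫ t in (0 : ℝ)..T, inner ℝ (w t) (w t)
        = (∫ t in (0 : ℝ)..T, (inner ℝ (a t) (y t) + inner ℝ (b t) (w t)))
          - ∫ t in (0 : ℝ)..T, (inner ℝ (p t - p T - c) (w t) + inner ℝ (a t) (y t)) := by
      rw [← intervalIntegral.integral_sub (hi (by fun_prop)) (hi (by fun_prop))]
      congr 1
      ext t
      have : inner ℝ (w t) (w t) = inner ℝ (b t) (w t) - inner ℝ (p t - p T - c) (w t) := by
        rw [← inner_sub_left]
      rw [this]
      ring
    rw [h4, h2, hy0]
    simp only [sub_self, zero_sub, inner_zero_right, sub_zero, inner_neg_left, sub_neg_eq_add]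
    exact h1
  have hw0 : ∀ t ∈ Icc 0 T, w t = 0 := eq_zero_of_integral_inner_self hT hwc h3
  have hb' : ∀ t ∈ Icc 0 T, b t = p t - p T - c := fun t ht => sub_eq_zero.1 (hw0 t ht)
  refine ⟨by rw [hb' T (right_mem_Icc.2 hT.le)]; abel, fun t ht => ?_⟩
  exact (((hp' t ht).sub_const (p T)).sub_const c).congr hb' (hb' t ht)

end Curves

/-! ### Superposition operators -/

section Superposition

variable {K X Y : Type*} [TopologicalSpace K] [NormedAddCommGroup X] [NormedAddCommGroup Y]

open Classical in
/-- The superposition operator `x ↦ f ∘ x` on continuous functions, for a function `f` that need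
not be continuous everywhere; its value is `0` where `f ∘ x` is not continuous. -/
def superpose (f : X → Y) (x : C(K, X)) : C(K, Y) :=
  if h : Continuous fun t => f (x t) then ⟨fun t => f (x t), h⟩ else 0

theorem superpose_apply {f : X → Y} {Ω : Set X} (hf : ContinuousOn f Ω) {x : C(K, X)}
    (hx : ∀ t, x t ∈ Ω) (t : K) : superpose f x t = f (x t) := by
  have h : Continuous fun t => f (x t) := hf.comp_continuous x.continuous hx
  rw [superpose, dif_pos h]
  rfl

theorem eventually_forall_mem [CompactSpace K] {Ω : Set X} (hΩ : IsOpen Ω) {x₀ : C(K, X)}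
    (hx₀ : ∀ t, x₀ t ∈ Ω) : ∀ᶠ x : C(K, X) in 𝓝 x₀, ∀ t, x t ∈ Ω := by
  have h := (ContinuousMap.isOpen_setOfPred_mapsTo (isCompact_univ (X := K)) hΩ).mem_nhds
    (show x₀ ∈ {f : C(K, X) | MapsTo f univ Ω} from fun t _ => hx₀ t)
  filter_upwards [h] with x hx t using hx (mem_univ t)

variable [NormedSpace ℝ X] [NormedSpace ℝ Y]

/-- The derivative of `f` along a curve. -/
def derivAlong {f : X → Y} {Ω : Set X} (hΩ : IsOpen Ω) (hf : ContDiffOn ℝ 1 f Ω) (x : C(K, X))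
    (hx : ∀ t, x t ∈ Ω) : C(K, X →L[ℝ] Y) :=
  ⟨fun t => fderiv ℝ f (x t),
    (hf.continuousOn_fderiv_of_isOpen hΩ le_rfl).comp_continuous x.continuous hx⟩

variable [CompactSpace K]

/-- The superposition operator of a `C¹` function is strictly differentiable: by compactness of
`K`, the derivative of `f` varies little over a uniform neighbourhood of the curve. -/
theorem hasStrictFDerivAt_superpose {f : X → Y} {Ω : Set X} (hΩ : IsOpen Ω)
    (hf : ContDiffOn ℝ 1 f Ω) (x₀ : C(K, X)) (hx₀ : ∀ t, x₀ t ∈ Ω) :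
    HasStrictFDerivAt (superpose f) (pointwise (derivAlong hΩ hf x₀ hx₀)) x₀ := by
  refine .of_isLittleO (Asymptotics.isLittleO_iff.2 fun c hc => ?_)
  have hcd := hf.continuousOn_fderiv_of_isOpen hΩ le_rfl
  have htube : ∀ᶠ e in 𝓝 (0 : X), ∀ t ∈ (univ : Set K),
      x₀ t + e ∈ Ω ∧ ‖fderiv ℝ f (x₀ t + e) - fderiv ℝ f (x₀ t)‖ < c := by
    refine isCompact_univ.eventually_forall_of_forall_eventually fun t _ => ?_
    have h1 : ContinuousAt (fun z : X × K => x₀ z.2 + z.1) (0, t) := by fun_prop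
    have h2 : ContinuousAt (fun z : X × K => x₀ z.2) (0, t) := by fun_prop
    have hm : Ω ∈ 𝓝 (x₀ t + 0) := by simpa using hΩ.mem_nhds (hx₀ t)
    have h3 : ContinuousAt (fun z : X × K => ‖fderiv ℝ f (x₀ z.2 + z.1) - fderiv ℝ f (x₀ z.2)‖)
        (0, t) := by
      refine (ContinuousAt.sub ?_ ?_).norm
      · exact ContinuousAt.comp (f := fun z : X × K => x₀ z.2 + z.1) (hcd.continuousAt hm) h1
      · exact ContinuousAt.comp (f := fun z : X × K => x₀ z.2)
          (hcd.continuousAt (hΩ.mem_nhds (hx₀ t))) h2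
    exact (h1.eventually hm).and (h3.eventually (gt_mem_nhds (by simpa using hc)))
  obtain ⟨δ, hδ, hball⟩ := Metric.eventually_nhds_iff_ball.1 htube
  have key : ∀ x : C(K, X), x ∈ Metric.ball x₀ δ → ∀ t, x t ∈ Metric.ball (x₀ t) δ :=
    fun x hx t => (ContinuousMap.dist_apply_le_dist t).trans_lt hx
  have hmem : ∀ t, ∀ z ∈ Metric.ball (x₀ t) δ,
      z ∈ Ω ∧ ‖fderiv ℝ f z - fderiv ℝ f (x₀ t)‖ < c := fun t z hz => by
    have := hball (z - x₀ t) (by simpa [dist_eq_norm] using hz) t (mem_univ t)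
    simpa using this
  filter_upwards [(Metric.isOpen_ball.prod Metric.isOpen_ball).mem_nhds
    (show (x₀, x₀) ∈ Metric.ball x₀ δ ×ˢ Metric.ball x₀ δ from
      ⟨Metric.mem_ball_self hδ, Metric.mem_ball_self hδ⟩)] with z hz
  refine (ContinuousMap.norm_le _ (by positivity)).2 fun t => ?_
  rw [ContinuousMap.sub_apply, ContinuousMap.sub_apply, pointwise_apply,
    superpose_apply hf.continuousOn fun t => (hmem t _ (key _ hz.1 t)).1,
    superpose_apply hf.continuousOn fun t => (hmem t _ (key _ hz.2 t)).1]
  refine ((convex_ball (x₀ t) δ).norm_image_sub_le_of_norm_hasFDerivWithin_le' (C := c)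
    (fun y hy => ((hf.differentiableOn one_ne_zero).differentiableAt
      (hΩ.mem_nhds (hmem t y hy).1)).hasFDerivAt.hasFDerivWithinAt)
    (fun y hy => (hmem t y hy).2.le) (key _ hz.2 t) (key _ hz.1 t)).trans ?_
  exact mul_le_mul_of_nonneg_left ((z.1 - z.2).norm_coe_le_norm t) hc.le

end Superposition

/-! ### Smoothness of the data of the system -/

section Smooth

variable {X : Type*} [NormedAddCommGroup X] [NormedSpace ℝ X] {s : Set X} {m : ℕ}

theorem contDiffOn_det {N : WithTop ℕ∞} {M : X → Matrix (Fin m) (Fin m) ℝ}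
    (hM : ∀ i j, ContDiffOn ℝ N (fun x => M x i j) s) :
    ContDiffOn ℝ N (fun x => (M x).det) s := by
  simp only [Matrix.det_apply, Units.smul_def, zsmul_eq_mul]
  exact ContDiffOn.sum fun σ _ => contDiffOn_const.mul (contDiffOn_prod fun i _ => hM _ _)

theorem contDiffOn_inv_matrix {N : WithTop ℕ∞} {M : X → Matrix (Fin m) (Fin m) ℝ}
    (hM : ∀ i j, ContDiffOn ℝ N (fun x => M x i j) s) (hu : ∀ x ∈ s, IsUnit (M x).det)
    (i j : Fin m) : ContDiffOn ℝ N (fun x => (M x)⁻¹ i j) s := by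
  have hd : ContDiffOn ℝ N (fun x => ((M x).det)⁻¹) s :=
    (contDiffOn_det hM).inv fun x hx => (hu x hx).ne_zero
  simp only [Matrix.inv_def, Matrix.smul_apply, smul_eq_mul, Ring.inverse_eq_inv',
    Matrix.adjugate_apply]
  refine hd.mul (contDiffOn_det fun a b => ?_)
  by_cases h : a = j
  · subst h
    simpa using contDiffOn_const
  · simpa [Matrix.updateRow_ne h] using hM a b

theorem contDiffOn_infty_fderiv_apply {Y : Type*} [NormedAddCommGroup Y] [NormedSpace ℝ Y]
    (hs : IsOpen s) {f : X → Y} (hf : ContDiffOn ℝ ∞ f s) {x : X → X}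
    (hx : ContDiffOn ℝ ∞ x s) : ContDiffOn ℝ ∞ (fun z => fderiv ℝ f z (x z)) s :=
  (hf.fderiv_of_isOpen hs (by simp)).clm_apply hx

end Smooth

namespace System

variable {n k : ℕ} (S : System n k)

theorem contDiffOn_e_apply (A : Fin k) (i : Fin n) :
    ContDiffOn ℝ ∞ (fun q => S.e A q i) S.dom :=
  contDiffOn_euclidean.1 (S.smooth_e A) i

theorem contDiffOn_metric {x y : E n → E n} (hx : ContDiffOn ℝ ∞ x S.dom)
    (hy : ContDiffOn ℝ ∞ y S.dom) : ContDiffOn ℝ ∞ (fun q => S.metric q (x q) (y q)) S.dom :=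
  ContDiffOn.sum fun i _ => ContDiffOn.sum fun j _ =>
    ((S.smooth_G i j).mul (contDiffOn_euclidean.1 hx i)).mul (contDiffOn_euclidean.1 hy j)

theorem contDiffOn_gD (A B : Fin k) : ContDiffOn ℝ ∞ (fun q => S.gD q A B) S.dom :=
  S.contDiffOn_metric (S.smooth_e A) (S.smooth_e B)

theorem contDiffOn_gD_inv (A B : Fin k) : ContDiffOn ℝ ∞ (fun q => (S.gD q)⁻¹ A B) S.dom :=
  contDiffOn_inv_matrix S.contDiffOn_gD (fun _ hq => S.isUnit_det_gD hq) A B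

theorem contDiffOn_bracketCoeff (A B C : Fin k) :
    ContDiffOn ℝ ∞ (S.bracketCoeff A B C) S.dom := by
  unfold bracketCoeff projCoeff VectorField.lieBracket
  exact ContDiffOn.sum fun D _ => (S.contDiffOn_gD_inv C D).mul
    (S.contDiffOn_metric
      ((contDiffOn_infty_fderiv_apply S.isOpen_dom (S.smooth_e B) (S.smooth_e A)).sub
        (contDiffOn_infty_fderiv_apply S.isOpen_dom (S.smooth_e A) (S.smooth_e B)))
      (S.smooth_e D))

theorem contDiffOn_frameDeriv (A : Fin k) {f : E n → ℝ} (hf : ContDiffOn ℝ ∞ f S.dom) :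
    ContDiffOn ℝ ∞ (S.frameDeriv A f) S.dom :=
  contDiffOn_infty_fderiv_apply S.isOpen_dom hf (S.smooth_e A)

theorem contDiffOn_koszul (A B C : Fin k) : ContDiffOn ℝ ∞ (S.koszul A B C) S.dom :=
  (((S.contDiffOn_frameDeriv A (S.contDiffOn_gD B C)).add
    (S.contDiffOn_frameDeriv B (S.contDiffOn_gD A C))).sub
    (S.contDiffOn_frameDeriv C (S.contDiffOn_gD A B))).add
    (ContDiffOn.sum fun F _ =>
      (((S.contDiffOn_bracketCoeff A B F).mul (S.contDiffOn_gD F C)).sub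
        ((S.contDiffOn_bracketCoeff A C F).mul (S.contDiffOn_gD F B))).sub
        ((S.contDiffOn_bracketCoeff B C F).mul (S.contDiffOn_gD F A)))

theorem contDiffOn_christoffel (A B C : Fin k) : ContDiffOn ℝ ∞ (S.christoffel A B C) S.dom :=
  contDiffOn_const.mul (ContDiffOn.sum fun D _ =>
    (S.contDiffOn_gD_inv C D).mul (S.contDiffOn_koszul A B D))

theorem contDiffOn_anchor :
    ContDiffOn ℝ ∞ (fun z : E n × E k => S.anchor z.1 z.2) (S.dom ×ˢ univ) := by
  have h2 : ∀ A, ContDiffOn ℝ ∞ (fun z : E n × E k => z.2 A) (S.dom ×ˢ univ) := fun A =>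
    contDiffOn_euclidean.1 contDiff_snd.contDiffOn A
  exact ContDiffOn.sum fun A _ => (h2 A).smul
    ((S.smooth_e A).comp contDiff_fst.contDiffOn fun z hz => hz.1)

theorem contDiffOn_force :
    ContDiffOn ℝ ∞ (fun z : E n × E k => S.force z.1 z.2) (S.dom ×ˢ univ) := by
  have h1 : ∀ {f : E n → ℝ}, ContDiffOn ℝ ∞ f S.dom →
      ContDiffOn ℝ ∞ (fun z : E n × E k => f z.1) (S.dom ×ˢ univ) := fun hf =>
    hf.comp contDiff_fst.contDiffOn fun z hz => hz.1
  have h2 : ∀ A, ContDiffOn ℝ ∞ (fun z : E n × E k => z.2 A) (S.dom ×ˢ univ) := fun A =>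
    contDiffOn_euclidean.1 contDiff_snd.contDiffOn A
  refine contDiffOn_euclidean.2 fun A => ?_
  refine ContDiffOn.add ?_ ?_
  · exact ContDiffOn.sum fun C _ => ContDiffOn.sum fun B _ =>
      ((h1 (S.contDiffOn_christoffel C B A)).mul (h2 C)).mul (h2 B)
  · exact ContDiffOn.sum fun B _ => ContDiffOn.sum fun i _ =>
      ((h1 (S.contDiffOn_gD_inv A B)).mul (h1 (S.contDiffOn_e_apply B i))).mul
        (h1 (contDiffOn_infty_fderiv_apply S.isOpen_dom S.smooth_V contDiffOn_const))

theorem isOpen_phase : IsOpen (S.dom ×ˢ (univ : Set (E k))) := S.isOpen_dom.prod isOpen_univ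

end System

/-! ### Gradients and vector forms of the equations -/

theorem inner_pd {m : ℕ} (f : E m → ℝ) (x h : E m) :
    inner ℝ (WithLp.toLp 2 fun i => pd f x i) h = fderiv ℝ f x h := by
  have hh : h = ∑ i, h i • EuclideanSpace.single i (1 : ℝ) := by
    ext j
    simp [Finset.sum_apply, Pi.single_apply]
  conv_rhs => rw [hh, map_sum]
  simp [PiLp.inner_apply, pd]

theorem hasDerivWithinAt_coord_iff {m : ℕ} {c : ℝ → E m} {c' : E m} {s : Set ℝ} {t : ℝ} :
    HasDerivWithinAt c c' s t ↔ ∀ i, HasDerivWithinAt (fun r => c r i) (c' i) s t := by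
  simp only [hasDerivWithinAt_iff_hasFDerivWithinAt]
  rw [hasFDerivWithinAt_euclidean]
  refine forall_congr' fun i => ?_
  have : (EuclideanSpace.proj i).comp (ContinuousLinearMap.toSpanSingleton ℝ c')
      = ContinuousLinearMap.toSpanSingleton ℝ (c' i) := by
    ext; simp
  rw [this]

theorem continuousOn_adjoint {m l : ℕ} {A : ℝ → E m →L[ℝ] E l} {s : Set ℝ}
    (h : ContinuousOn A s) : ContinuousOn (fun t => ContinuousLinearMap.adjoint (A t)) s := by
  have h1 : Isometry fun B : E m →L[ℝ] E l => ContinuousLinearMap.adjoint B :=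
    LinearIsometryEquiv.isometry _
  exact h1.continuous.comp_continuousOn h

namespace System

variable {n k : ℕ} (S : System n k)

/-- The linear map `v ↦ v^A e_A(q)`. -/
def anchorL (q : E n) : E k →L[ℝ] E n :=
  ∑ A, (EuclideanSpace.proj A : E k →L[ℝ] ℝ).smulRight (S.e A q)

@[simp]
theorem anchorL_apply (q : E n) (v : E k) : S.anchorL q v = S.anchor q v := by
  simp [anchorL, anchor]

/-- The partial derivative of the anchor in the direction of the base. -/
def anchorQ (q : E n) (v : E k) : E n →L[ℝ] E n := fderiv ℝ (fun z => S.anchor z v) q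

theorem anchor_apply (q : E n) (v : E k) (i : Fin n) :
    S.anchor q v i = ∑ A, S.rho A i q * v A := by
  simp [anchor, rho, mul_comm]

theorem differentiableAt_e {q : E n} (hq : q ∈ S.dom) (A : Fin k) :
    DifferentiableAt ℝ (S.e A) q :=
  ((S.smooth_e A).differentiableOn (by simp)).differentiableAt (S.isOpen_dom.mem_nhds hq)

theorem differentiableAt_anchor {q : E n} (hq : q ∈ S.dom) (v : E k) :
    DifferentiableAt ℝ (fun z : E n × E k => S.anchor z.1 z.2) (q, v) :=
  (S.contDiffOn_anchor.differentiableOn (by simp)).differentiableAt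
    (S.isOpen_phase.mem_nhds ⟨hq, mem_univ _⟩)

theorem differentiableAt_force {q : E n} (hq : q ∈ S.dom) (v : E k) :
    DifferentiableAt ℝ (fun z : E n × E k => S.force z.1 z.2) (q, v) :=
  (S.contDiffOn_force.differentiableOn (by simp)).differentiableAt
    (S.isOpen_phase.mem_nhds ⟨hq, mem_univ _⟩)

theorem fderiv_anchor {q : E n} (hq : q ∈ S.dom) (v : E k) (x : E n) (y : E k) :
    fderiv ℝ (fun z : E n × E k => S.anchor z.1 z.2) (q, v) (x, y)
      = S.anchorQ q v x + S.anchor q y := by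
  have h := (S.differentiableAt_anchor hq v).hasFDerivAt
  have h1 : HasFDerivAt (fun z => S.anchor z v) _ q :=
    HasFDerivAt.comp (f := fun a => (a, v)) q h
      ((hasFDerivAt_id q).prodMk (hasFDerivAt_const v q))
  have h2 : HasFDerivAt (fun w => S.anchor q w) _ v :=
    HasFDerivAt.comp (f := fun a => (q, a)) v h ((hasFDerivAt_const q v).prodMk (hasFDerivAt_id v))
  have h3 : HasFDerivAt (fun w => S.anchor q w) (S.anchorL q) v :=
    (S.anchorL q).hasFDerivAt.congr_of_eventuallyEq
      (.of_forall fun w => (S.anchorL_apply q w).symm)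
  have h4 := congrArg (fun L : E k →L[ℝ] E n => L y) (h2.unique h3)
  rw [anchorQ, h1.fderiv, ← anchorL_apply, ← h4]
  simp [← map_add]

theorem anchorQ_single {q : E n} (hq : q ∈ S.dom) (v : E k) (i j : Fin n) :
    S.anchorQ q v (EuclideanSpace.single i 1) j = ∑ A, pd (S.rho A j) q i * v A := by
  have h1 : HasFDerivAt (fun z => S.anchor z v) (∑ A, v A • fderiv ℝ (S.e A) q) q :=
    HasFDerivAt.fun_sum fun A _ => (S.differentiableAt_e hq A).hasFDerivAt.const_smul (v A)
  have h2 : ∀ A, pd (S.rho A j) q i = fderiv ℝ (S.e A) q (EuclideanSpace.single i 1) j := by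
    intro A
    have h3 : HasFDerivAt (S.rho A j) _ q :=
      (EuclideanSpace.proj j : E n →L[ℝ] ℝ).hasFDerivAt.comp q
        (S.differentiableAt_e hq A).hasFDerivAt
    rw [pd, h3.fderiv]
    rfl
  rw [anchorQ, h1.fderiv]
  simp [h2, mul_comm]

theorem adjoint_anchorQ_apply {q : E n} (hq : q ∈ S.dom) (v : E k) (l : E n) (i : Fin n) :
    ContinuousLinearMap.adjoint (S.anchorQ q v) l i
      = ∑ j, ∑ A, l j * pd (S.rho A j) q i * v A := by
  have h : ContinuousLinearMap.adjoint (S.anchorQ q v) l i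
      = inner ℝ (EuclideanSpace.single i (1 : ℝ))
          (ContinuousLinearMap.adjoint (S.anchorQ q v) l) := by
    simp [EuclideanSpace.inner_single_left]
  rw [h, ContinuousLinearMap.adjoint_inner_right, PiLp.inner_apply]
  refine Finset.sum_congr rfl fun j _ => ?_
  rw [S.anchorQ_single hq]
  simp [Finset.mul_sum, mul_assoc]

theorem adjoint_anchorL_apply (q : E n) (l : E n) (A : Fin k) :
    ContinuousLinearMap.adjoint (S.anchorL q) l A = ∑ i, S.rho A i q * l i := by
  have h : ContinuousLinearMap.adjoint (S.anchorL q) l A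
      = inner ℝ (EuclideanSpace.single A (1 : ℝ))
          (ContinuousLinearMap.adjoint (S.anchorL q) l) := by
    simp [EuclideanSpace.inner_single_left]
  rw [h, ContinuousLinearMap.adjoint_inner_right, PiLp.inner_apply]
  refine Finset.sum_congr rfl fun j _ => ?_
  rw [anchorL_apply, anchor_apply]
  simp [mul_comm]

theorem continuousOn_anchorL : ContinuousOn S.anchorL S.dom := by
  unfold anchorL
  refine continuousOn_finsetSum _ fun A _ => ?_
  exact ((ContinuousLinearMap.smulRightL ℝ (E k) (E n)
    (EuclideanSpace.proj A : E k →L[ℝ] ℝ)).continuous.comp_continuousOn (S.smooth_e A).continuousOn)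

theorem continuousOn_anchorQ :
    ContinuousOn (fun z : E n × E k => S.anchorQ z.1 z.2) (S.dom ×ˢ univ) := by
  have h := (S.contDiffOn_anchor.continuousOn_fderiv_of_isOpen S.isOpen_phase (by simp))
  have h2 : ContinuousOn (fun z : E n × E k =>
      (fderiv ℝ (fun z : E n × E k => S.anchor z.1 z.2) z).comp
        (ContinuousLinearMap.inl ℝ (E n) (E k))) (S.dom ×ˢ univ) :=
    h.clm_comp continuousOn_const
  refine h2.congr fun z hz => ?_
  ext1 x
  have := S.fderiv_anchor hz.1 z.2 x 0
  rw [← S.anchorL_apply z.1 0, map_zero, add_zero] at this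
  exact this.symm

end System

namespace Tracking

variable {n k d : ℕ} {S : System n k} (P : Tracking S d)

theorem zero_mem_I : (0 : ℝ) ∈ P.I := left_mem_Icc.2 P.T_pos.le

theorem T_mem_I : P.T ∈ P.I := right_mem_Icc.2 P.T_pos.le

theorem uniqueDiffOn_I : UniqueDiffOn ℝ P.I := uniqueDiffOn_Icc P.T_pos

/-- The Lagrangian with the reference state as an additional argument: in this form it depends
smoothly on all its arguments, although the reference curve is only continuous in time. -/
def lagrRef (lam0 : ℝ) (z : (E n × E k) × E n × E k × E k) : ℝ :=
  lam0 * ((1 / 2) * (‖z.2.1 - z.1.1‖ ^ 2 + ‖z.2.2.1 - z.1.2‖ ^ 2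
    + P.ε * ‖z.2.2.2 + S.force z.2.1 z.2.2.1‖ ^ 2))

/-- The domain of `lagrRef`. -/
def lagrDom (_ : Tracking S d) : Set ((E n × E k) × E n × E k × E k) := univ ×ˢ S.dom ×ˢ univ

theorem isOpen_lagrDom : IsOpen P.lagrDom := isOpen_univ.prod (S.isOpen_dom.prod isOpen_univ)

theorem contDiffOn_lagrRef (lam0 : ℝ) : ContDiffOn ℝ 1 (P.lagrRef lam0) P.lagrDom := by
  have hf : ContDiffOn ℝ 1 (fun z : (E n × E k) × E n × E k × E k => S.force z.2.1 z.2.2.1)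
      P.lagrDom :=
    (S.contDiffOn_force.of_le (by simp)).comp
      (f := fun z : (E n × E k) × E n × E k × E k => (z.2.1, z.2.2.1))
      (ContDiff.contDiffOn (by fun_prop)) fun z hz => ⟨hz.2.1, mem_univ _⟩
  refine contDiffOn_const.mul (contDiffOn_const.mul ?_)
  refine ContDiffOn.add (ContDiff.contDiffOn ?_) (contDiffOn_const.mul ?_)
  · exact (ContDiff.norm_sq ℝ (by fun_prop)).add (ContDiff.norm_sq ℝ (by fun_prop))
  · exact ContDiffOn.norm_sq ℝ (ContDiffOn.add (ContDiff.contDiffOn (by fun_prop)) hf)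

/-- The gradient `∂ℒ/∂q`. -/
def gradQ (lam0 t : ℝ) (q : E n) (v w : E k) : E n :=
  WithLp.toLp 2 fun i => pd (fun x => P.lagr lam0 t x v w) q i

/-- The gradient `∂ℒ/∂v`. -/
def gradV (lam0 t : ℝ) (q : E n) (v w : E k) : E k :=
  WithLp.toLp 2 fun A => pd (fun y => P.lagr lam0 t q y w) v A

/-- The gradient `∂ℒ/∂v̇`. -/
def gradW (lam0 t : ℝ) (q : E n) (v w : E k) : E k :=
  WithLp.toLp 2 fun A => pd (fun z => P.lagr lam0 t q v z) w A

theorem differentiableAt_lagrRef (lam0 : ℝ) {z : (E n × E k) × E n × E k × E k}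
    (hz : z ∈ P.lagrDom) : DifferentiableAt ℝ (P.lagrRef lam0) z :=
  ((P.contDiffOn_lagrRef lam0).differentiableOn one_ne_zero).differentiableAt
    (P.isOpen_lagrDom.mem_nhds hz)

theorem fderiv_lagrRef (lam0 t : ℝ) {q : E n} (hq : q ∈ S.dom) (v w : E k) (x : E n) (y z : E k) :
    fderiv ℝ (P.lagrRef lam0) ((P.qr t, P.vr t), q, v, w) (0, x, y, z)
      = inner ℝ (P.gradQ lam0 t q v w) x + inner ℝ (P.gradV lam0 t q v w) y
        + inner ℝ (P.gradW lam0 t q v w) z := by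
  have h := (P.differentiableAt_lagrRef lam0
    (z := ((P.qr t, P.vr t), q, v, w)) ⟨mem_univ _, hq, mem_univ _⟩).hasFDerivAt
  have h1 : HasFDerivAt (fun a => P.lagr lam0 t a v w) _ q :=
    HasFDerivAt.comp (f := fun a => ((P.qr t, P.vr t), a, v, w)) q h
      ((hasFDerivAt_const _ q).prodMk ((hasFDerivAt_id q).prodMk (hasFDerivAt_const _ q)))
  have h2 : HasFDerivAt (fun a => P.lagr lam0 t q a w) _ v :=
    HasFDerivAt.comp (f := fun a => ((P.qr t, P.vr t), q, a, w)) v h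
      ((hasFDerivAt_const _ v).prodMk ((hasFDerivAt_const _ v).prodMk
      ((hasFDerivAt_id v).prodMk (hasFDerivAt_const _ v))))
  have h3 : HasFDerivAt (fun a => P.lagr lam0 t q v a) _ w :=
    HasFDerivAt.comp (f := fun a => ((P.qr t, P.vr t), q, v, a)) w h
      ((hasFDerivAt_const _ w).prodMk ((hasFDerivAt_const _ w).prodMk
      ((hasFDerivAt_const _ w).prodMk (hasFDerivAt_id w))))
  rw [gradQ, gradV, gradW, inner_pd, inner_pd, inner_pd, h1.fderiv, h2.fderiv, h3.fderiv]
  simp [← map_add]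

theorem pd_lagr_smul {m : ℕ} (lam0 : ℝ) (t : ℝ) (a : E m → E n) (b c : E m → E k) (x : E m)
    (i : Fin m) : pd (fun y => P.lagr lam0 t (a y) (b y) (c y)) x i
      = lam0 * pd (fun y => P.lagr 1 t (a y) (b y) (c y)) x i := by
  have h : (fun y => P.lagr lam0 t (a y) (b y) (c y))
      = lam0 • fun y => P.lagr 1 t (a y) (b y) (c y) := by
    ext y
    simp [lagr]
  rw [pd, h, fderiv_const_smul_field]
  rfl

theorem gradQ_smul (lam0 t : ℝ) (q : E n) (v w : E k) :
    P.gradQ lam0 t q v w = lam0 • P.gradQ 1 t q v w := by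
  ext i
  exact P.pd_lagr_smul lam0 t (fun x => x) (fun _ => v) (fun _ => w) q i

theorem gradV_smul (lam0 t : ℝ) (q : E n) (v w : E k) :
    P.gradV lam0 t q v w = lam0 • P.gradV 1 t q v w := by
  ext i
  exact P.pd_lagr_smul lam0 t (fun _ => q) (fun y => y) (fun _ => w) v i

theorem gradW_smul (lam0 t : ℝ) (q : E n) (v w : E k) :
    P.gradW lam0 t q v w = lam0 • P.gradW 1 t q v w := by
  ext i
  exact P.pd_lagr_smul lam0 t (fun _ => q) (fun _ => v) (fun z => z) w i

theorem momentum_smul (lam0 : ℝ) (q : ℝ → E n) (v : ℝ → E k) (t : ℝ) :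
    P.momentum lam0 q v t = lam0 • P.momentum 1 q v t :=
  P.gradW_smul lam0 t (q t) (v t) (P.dot v t)

/-- The Euler-Lagrange equations in vector form. -/
theorem eulerLagrange_iff {lam0 : ℝ} {q : ℝ → E n} {v : ℝ → E k} {lam : ℝ → E n}
    (hq : ∀ t ∈ P.I, q t ∈ S.dom) :
    P.EulerLagrange lam0 q v lam ↔
      (∀ t ∈ P.I, HasDerivWithinAt lam (-(P.gradQ lam0 t (q t) (v t) (P.dot v t)
        + ContinuousLinearMap.adjoint (S.anchorQ (q t) (v t)) (lam t))) P.I t)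
      ∧ (∀ t ∈ P.I, HasDerivWithinAt q (S.anchor (q t) (v t)) P.I t)
      ∧ (∀ t ∈ P.I, HasDerivWithinAt (P.momentum lam0 q v)
        (P.gradV lam0 t (q t) (v t) (P.dot v t)
          + ContinuousLinearMap.adjoint (S.anchorL (q t)) (lam t)) P.I t) := by
  have h1 : ∀ t ∈ P.I, ∀ i, (-(P.gradQ lam0 t (q t) (v t) (P.dot v t)
        + ContinuousLinearMap.adjoint (S.anchorQ (q t) (v t)) (lam t))) i
      = -(pd (fun x => P.lagr lam0 t x (v t) (P.dot v t)) (q t) i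
        + ∑ j, ∑ A, lam t j * pd (S.rho A j) (q t) i * v t A) := fun t ht i => by
    rw [PiLp.neg_apply, PiLp.add_apply, S.adjoint_anchorQ_apply (hq t ht)]
    rfl
  have h2 : ∀ t, ∀ A, (P.gradV lam0 t (q t) (v t) (P.dot v t)
          + ContinuousLinearMap.adjoint (S.anchorL (q t)) (lam t)) A
      = pd (fun y => P.lagr lam0 t (q t) y (P.dot v t)) (v t) A
        + ∑ i, S.rho A i (q t) * lam t i := fun t A => by
    rw [PiLp.add_apply, S.adjoint_anchorL_apply]
    rfl
  constructor
  · intro h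
    refine ⟨fun t ht => hasDerivWithinAt_coord_iff.2 fun i => ?_,
      fun t ht => hasDerivWithinAt_coord_iff.2 fun i => ?_,
      fun t ht => hasDerivWithinAt_coord_iff.2 fun A => ?_⟩
    · rw [h1 t ht]; exact h.eq_lam t ht i
    · rw [S.anchor_apply]; exact h.eq_q t ht i
    · rw [h2]; exact h.eq_v t ht A
  · rintro ⟨a, b, c⟩
    refine ⟨fun t ht i => ?_, fun t ht i => ?_, fun t ht A => ?_⟩
    · rw [← h1 t ht]; exact hasDerivWithinAt_coord_iff.1 (a t ht) i
    · rw [← S.anchor_apply]; exact hasDerivWithinAt_coord_iff.1 (b t ht) i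
    · rw [← h2]; exact hasDerivWithinAt_coord_iff.1 (c t ht) A

/-! ### Continuity along curves -/

variable {P} {q : ℝ → E n} {v : ℝ → E k}

theorem IsCurve.continuousOn_q (h : P.IsCurve q v) : ContinuousOn q P.I := h.contDiff_q.continuousOn

theorem IsCurve.continuousOn_v (h : P.IsCurve q v) : ContinuousOn v P.I := h.contDiff_v.continuousOn

theorem continuousOn_dot {X : Type*} [NormedAddCommGroup X] [NormedSpace ℝ X] {c : ℝ → X}
    (h : ContDiffOn ℝ 1 c P.I) : ContinuousOn (P.dot c) P.I :=
  h.continuousOn_derivWithin P.uniqueDiffOn_I le_rfl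

theorem hasDerivWithinAt_dot {X : Type*} [NormedAddCommGroup X] [NormedSpace ℝ X] {c : ℝ → X}
    (h : ContDiffOn ℝ 1 c P.I) {t : ℝ} (ht : t ∈ P.I) :
    HasDerivWithinAt c (P.dot c t) P.I t :=
  (h.differentiableOn one_ne_zero t ht).hasDerivWithinAt

theorem dot_eq {X : Type*} [NormedAddCommGroup X] [NormedSpace ℝ X] {c : ℝ → X} {c' : X} {t : ℝ}
    (h : HasDerivWithinAt c c' P.I t) (ht : t ∈ P.I) : P.dot c t = c' :=
  h.derivWithin (P.uniqueDiffOn_I t ht)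

theorem contDiffOn_of_hasDerivWithinAt {X : Type*} [NormedAddCommGroup X] [NormedSpace ℝ X]
    {c c' : ℝ → X} (h : ∀ t ∈ P.I, HasDerivWithinAt c (c' t) P.I t) (hc : ContinuousOn c' P.I) :
    ContDiffOn ℝ 1 c P.I := by
  rw [show (1 : WithTop ℕ∞) = 0 + 1 from rfl, contDiffOn_succ_iff_derivWithin P.uniqueDiffOn_I]
  refine ⟨fun t ht => (h t ht).differentiableWithinAt, by simp, contDiffOn_zero.2 ?_⟩
  exact hc.congr fun t ht => dot_eq (h t ht) ht

/-- The curve `(q, v, v̇)` together with the reference curve. -/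
def lift (P : Tracking S d) (q : ℝ → E n) (v : ℝ → E k) (t : ℝ) :
    (E n × E k) × E n × E k × E k :=
  ((P.qr t, P.vr t), q t, v t, P.dot v t)

theorem IsCurve.continuousOn_lift (h : P.IsCurve q v) : ContinuousOn (P.lift q v) P.I :=
  (P.continuous_qr.prodMk P.continuous_vr).prodMk
    (h.continuousOn_q.prodMk (h.continuousOn_v.prodMk (continuousOn_dot h.contDiff_v)))

theorem IsCurve.mapsTo_lift (h : P.IsCurve q v) : MapsTo (P.lift q v) P.I P.lagrDom :=
  fun t ht => ⟨mem_univ _, h.mem_dom t ht, mem_univ _⟩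

theorem IsCurve.continuousOn_fderiv_lagrRef (h : P.IsCurve q v) (lam0 : ℝ) :
    ContinuousOn (fun t => fderiv ℝ (P.lagrRef lam0) (P.lift q v t)) P.I :=
  ((P.contDiffOn_lagrRef lam0).continuousOn_fderiv_of_isOpen P.isOpen_lagrDom le_rfl).comp
    h.continuousOn_lift h.mapsTo_lift

theorem IsCurve.continuousOn_gradQ (h : P.IsCurve q v) (lam0 : ℝ) :
    ContinuousOn (fun t => P.gradQ lam0 t (q t) (v t) (P.dot v t)) P.I := by
  refine (PiLp.continuous_toLp 2 _).comp_continuousOn (continuousOn_pi.2 fun i => ?_)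
  refine ((h.continuousOn_fderiv_lagrRef lam0).clm_apply
    (continuousOn_const (c := (0, EuclideanSpace.single i 1, 0, 0)))).congr fun t ht => ?_
  have := P.fderiv_lagrRef lam0 t (h.mem_dom t ht) (v t) (P.dot v t)
    (EuclideanSpace.single i 1) 0 0
  rw [inner_zero_right, inner_zero_right, add_zero, add_zero, gradQ, inner_pd] at this
  exact this.symm

theorem IsCurve.continuousOn_gradV (h : P.IsCurve q v) (lam0 : ℝ) :
    ContinuousOn (fun t => P.gradV lam0 t (q t) (v t) (P.dot v t)) P.I := by
  refine (PiLp.continuous_toLp 2 _).comp_continuousOn (continuousOn_pi.2 fun i => ?_)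
  refine ((h.continuousOn_fderiv_lagrRef lam0).clm_apply
    (continuousOn_const (c := (0, 0, EuclideanSpace.single i 1, 0)))).congr fun t ht => ?_
  have := P.fderiv_lagrRef lam0 t (h.mem_dom t ht) (v t) (P.dot v t)
    0 (EuclideanSpace.single i 1) 0
  rw [inner_zero_right, inner_zero_right, zero_add, add_zero, gradV, inner_pd] at this
  exact this.symm

theorem IsCurve.continuousOn_momentum (h : P.IsCurve q v) (lam0 : ℝ) :
    ContinuousOn (P.momentum lam0 q v) P.I := by
  refine (PiLp.continuous_toLp 2 _).comp_continuousOn (continuousOn_pi.2 fun i => ?_)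
  refine ((h.continuousOn_fderiv_lagrRef lam0).clm_apply
    (continuousOn_const (c := (0, 0, 0, EuclideanSpace.single i 1)))).congr fun t ht => ?_
  have := P.fderiv_lagrRef lam0 t (h.mem_dom t ht) (v t) (P.dot v t)
    0 0 (EuclideanSpace.single i 1)
  rw [inner_zero_right, inner_zero_right, add_zero, zero_add, gradW, inner_pd] at this
  exact this.symm

theorem IsCurve.continuousOn_anchor (h : P.IsCurve q v) :
    ContinuousOn (fun t => S.anchor (q t) (v t)) P.I :=
  ContinuousOn.comp (g := fun z : E n × E k => S.anchor z.1 z.2) (f := fun t => (q t, v t))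
    S.contDiffOn_anchor.continuousOn (h.continuousOn_q.prodMk h.continuousOn_v)
    fun t ht => ⟨h.mem_dom t ht, mem_univ _⟩

theorem IsCurve.continuousOn_force (h : P.IsCurve q v) :
    ContinuousOn (fun t => S.force (q t) (v t)) P.I :=
  ContinuousOn.comp (g := fun z : E n × E k => S.force z.1 z.2) (f := fun t => (q t, v t))
    S.contDiffOn_force.continuousOn (h.continuousOn_q.prodMk h.continuousOn_v)
    fun t ht => ⟨h.mem_dom t ht, mem_univ _⟩

theorem IsCurve.continuousOn_anchorL (h : P.IsCurve q v) :
    ContinuousOn (fun t => S.anchorL (q t)) P.I :=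
  S.continuousOn_anchorL.comp h.continuousOn_q h.mem_dom

theorem IsCurve.continuousOn_anchorQ (h : P.IsCurve q v) :
    ContinuousOn (fun t => S.anchorQ (q t) (v t)) P.I :=
  ContinuousOn.comp (g := fun z : E n × E k => S.anchorQ z.1 z.2) (f := fun t => (q t, v t))
    S.continuousOn_anchorQ (h.continuousOn_q.prodMk h.continuousOn_v)
    fun t ht => ⟨h.mem_dom t ht, mem_univ _⟩

end Tracking

/-! ### The first variation -/

section Integral

variable {T : ℝ} {X : Type*} [NormedAddCommGroup X] [NormedSpace ℝ X]

/-- Evaluation of a continuous curve at the right end point. -/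
def evalEnd (hT : 0 ≤ T) : C(Icc (0 : ℝ) T, X) →L[ℝ] X :=
  ContinuousMap.evalCLM ℝ ⟨T, right_mem_Icc.2 hT⟩

@[simp]
theorem evalEnd_apply (hT : 0 ≤ T) (x : C(Icc (0 : ℝ) T, X)) :
    evalEnd hT x = x ⟨T, right_mem_Icc.2 hT⟩ := rfl

/-- The integral over `[0, T]` as a functional on `C([0, T], X)`. -/
def integralL (hT : 0 ≤ T) : C(Icc (0 : ℝ) T, X) →L[ℝ] X := (evalEnd hT).comp (primitive hT)

theorem integralL_eq (hT : 0 ≤ T) {x : C(Icc (0 : ℝ) T, X)} {c : ℝ → X}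
    (h : ∀ t : Icc (0 : ℝ) T, x t = c t) : integralL hT x = ∫ t in (0 : ℝ)..T, c t := by
  change ∫ t in (0 : ℝ)..T, IccExtend hT x t = _
  refine intervalIntegral.integral_congr fun t ht => ?_
  rw [uIcc_of_le hT] at ht
  simp only [IccExtend_of_mem hT _ ht]
  exact h ⟨t, ht⟩

theorem hasDerivAt_integral_comp_line (hT : 0 ≤ T) {f : X → ℝ} {Ω : Set X} (hΩ : IsOpen Ω)
    (hf : ContDiffOn ℝ 1 f Ω) {c ξ : ℝ → X} (hc : ContinuousOn c (Icc 0 T))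
    (hξ : ContinuousOn ξ (Icc 0 T)) (hcΩ : MapsTo c (Icc 0 T) Ω) :
    HasDerivAt (fun s : ℝ => ∫ t in (0 : ℝ)..T, f (c t + s • ξ t))
      (∫ t in (0 : ℝ)..T, fderiv ℝ f (c t) (ξ t)) 0 := by
  have hx : ∀ t, restr c hc t ∈ Ω := fun t => hcΩ t.2
  have hline : HasDerivAt (fun s : ℝ => restr c hc + s • restr ξ hξ) (restr ξ hξ) 0 := by
    simpa using ((hasDerivAt_id (0 : ℝ)).smul_const (restr ξ hξ)).const_add (restr c hc)
  have h1 := (integralL hT).hasFDerivAt.comp_hasDerivAt (0 : ℝ)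
    (HasFDerivAt.comp_hasDerivAt (l := superpose f) (0 : ℝ)
      (by simpa using (hasStrictFDerivAt_superpose hΩ hf (restr c hc) hx).hasFDerivAt) hline)
  rw [integralL_eq hT (c := fun t => fderiv ℝ f (c t) (ξ t)) (fun t => rfl)] at h1
  refine h1.congr_of_eventuallyEq ?_
  have h2 : Filter.Tendsto (fun s : ℝ => restr c hc + s • restr ξ hξ) (𝓝 0)
      (𝓝 (restr c hc)) := by simpa using hline.continuousAt.tendsto
  filter_upwards [h2.eventually (eventually_forall_mem hΩ hx)] with s hs
  exact (integralL_eq hT fun t => superpose_apply hf.continuousOn hs t).symm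

end Integral

namespace Tracking

variable {n k d : ℕ} {S : System n k} (P : Tracking S d)

theorem differentiableAt_Φ {q : E n} (hq : q ∈ S.dom) (v : E k) :
    DifferentiableAt ℝ P.Φ (q, v) :=
  (P.contDiff_Φ.differentiableOn one_ne_zero).differentiableAt
    (S.isOpen_phase.mem_nhds ⟨hq, mem_univ _⟩)

theorem differentiableAt_rT {q : E n} (hq : q ∈ S.dom) (v : E k) :
    DifferentiableAt ℝ P.rT (q, v) :=
  (P.contDiff_r.differentiableOn one_ne_zero).differentiableAt
    (S.isOpen_phase.mem_nhds ⟨hq, mem_univ _⟩)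

/-- The derivative of the running action `∫ ℒ` along a variation `(x, y)` with `ẏ = y'`. -/
def runningVar (lam0 : ℝ) (q : ℝ → E n) (v : ℝ → E k) (x : ℝ → E n) (y y' : ℝ → E k) : ℝ :=
  ∫ t in (0 : ℝ)..P.T, (inner ℝ (P.gradQ lam0 t (q t) (v t) (P.dot v t)) (x t)
    + inner ℝ (P.gradV lam0 t (q t) (v t) (P.dot v t)) (y t)
    + inner ℝ (P.momentum lam0 q v t) (y' t))

/-- The first variation of `𝒥̃` along `(x, y, l, m)`. -/
def firstVar (lam0 : ℝ) (q : ℝ → E n) (v : ℝ → E k) (lam : ℝ → E n) (lamT : E d)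
    (x : ℝ → E n) (y : ℝ → E k) (l : ℝ → E n) (m : E d) : ℝ :=
  P.weight * fderiv ℝ P.Φ (q P.T, v P.T) (x P.T, y P.T)
    + (inner ℝ lamT (fderiv ℝ P.rT (q P.T, v P.T) (x P.T, y P.T))
      + inner ℝ m (P.rT (q P.T, v P.T)))
    + ∫ t in (0 : ℝ)..P.T, (inner ℝ (P.gradQ lam0 t (q t) (v t) (P.dot v t)) (x t)
        + inner ℝ (P.gradV lam0 t (q t) (v t) (P.dot v t)) (y t)
        + inner ℝ (P.momentum lam0 q v t) (P.dot y t)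
        - (inner ℝ (lam t) (P.dot x t - (S.anchorQ (q t) (v t) (x t) + S.anchor (q t) (y t)))
          + inner ℝ (l t) (P.dot q t - S.anchor (q t) (v t))))

/-- The augmented Lagrangian with the reference state as an additional argument. -/
def augRef (lam0 : ℝ) (z : ((E n × E k) × E n × E k × E k) × (E n × E n)) : ℝ :=
  P.lagrRef lam0 z.1 - inner ℝ z.2.2 (z.2.1 - S.anchor z.1.2.1 z.1.2.2.1)

theorem isOpen_augDom : IsOpen (P.lagrDom ×ˢ (univ : Set (E n × E n))) :=
  P.isOpen_lagrDom.prod isOpen_univ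

theorem contDiffOn_augRef (lam0 : ℝ) : ContDiffOn ℝ 1 (P.augRef lam0) (P.lagrDom ×ˢ univ) := by
  have h1 : ContDiffOn ℝ 1 (fun z : ((E n × E k) × E n × E k × E k) × (E n × E n) =>
      S.anchor z.1.2.1 z.1.2.2.1) (P.lagrDom ×ˢ univ) :=
    (S.contDiffOn_anchor.of_le (by simp)).comp
      (f := fun z : ((E n × E k) × E n × E k × E k) × (E n × E n) => (z.1.2.1, z.1.2.2.1))
      (ContDiff.contDiffOn (by fun_prop)) fun z hz => ⟨hz.1.2.1, mem_univ _⟩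
  refine ((P.contDiffOn_lagrRef lam0).comp contDiff_fst.contDiffOn fun z hz => hz.1).sub ?_
  exact ContDiffOn.inner ℝ (ContDiff.contDiffOn (by fun_prop))
    ((ContDiff.contDiffOn (by fun_prop)).sub h1)

theorem augLagr_eq (lam0 t : ℝ) (q : E n) (v : E k) (p : E n) (w : E k) (lam : E n) :
    P.augLagr lam0 t q v p w lam = P.augRef lam0 (((P.qr t, P.vr t), q, v, w), (p, lam)) := by
  unfold augLagr augRef
  congr 1
  rw [PiLp.inner_apply]
  refine Finset.sum_congr rfl fun i _ => ?_
  rw [PiLp.sub_apply, S.anchor_apply]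
  simp [mul_comm]

theorem fderiv_augRef (lam0 t : ℝ) {q : E n} (hq : q ∈ S.dom) (v w : E k) (p lam : E n)
    (x : E n) (y z : E k) (p' l : E n) :
    fderiv ℝ (P.augRef lam0) (((P.qr t, P.vr t), q, v, w), (p, lam)) ((0, x, y, z), (p', l))
      = inner ℝ (P.gradQ lam0 t q v w) x + inner ℝ (P.gradV lam0 t q v w) y
        + inner ℝ (P.gradW lam0 t q v w) z
        - (inner ℝ lam (p' - (S.anchorQ q v x + S.anchor q y)) + inner ℝ l (p - S.anchor q v)) := by
  have h1 := HasFDerivAt.comp (f := fun z : ((E n × E k) × E n × E k × E k) × (E n × E n) => z.1)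
    (((P.qr t, P.vr t), q, v, w), (p, lam))
    (P.differentiableAt_lagrRef lam0 (z := ((P.qr t, P.vr t), q, v, w))
      ⟨mem_univ _, hq, mem_univ _⟩).hasFDerivAt hasFDerivAt_fst
  have h2 := HasFDerivAt.comp
    (f := fun z : ((E n × E k) × E n × E k × E k) × (E n × E n) => (z.1.2.1, z.1.2.2.1))
    (((P.qr t, P.vr t), q, v, w), (p, lam)) (S.differentiableAt_anchor hq v).hasFDerivAt
    (ContinuousLinearMap.hasFDerivAt
      (((ContinuousLinearMap.fst ℝ (E n) (E k × E k)).comp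
        ((ContinuousLinearMap.snd ℝ (E n × E k) (E n × E k × E k)).comp
          (ContinuousLinearMap.fst ℝ _ (E n × E n)))).prod
      ((ContinuousLinearMap.fst ℝ (E k) (E k)).comp ((ContinuousLinearMap.snd ℝ (E n) (E k × E k)).comp
        ((ContinuousLinearMap.snd ℝ (E n × E k) (E n × E k × E k)).comp
          (ContinuousLinearMap.fst ℝ _ (E n × E n)))))))
  have hl : HasFDerivAt (fun z : ((E n × E k) × E n × E k × E k) × (E n × E n) => z.2.2)
      _ (((P.qr t, P.vr t), q, v, w), (p, lam)) :=
    ((ContinuousLinearMap.snd ℝ (E n) (E n)).comp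
      (ContinuousLinearMap.snd ℝ ((E n × E k) × E n × E k × E k) (E n × E n))).hasFDerivAt
  have hp : HasFDerivAt (fun z : ((E n × E k) × E n × E k × E k) × (E n × E n) => z.2.1)
      _ (((P.qr t, P.vr t), q, v, w), (p, lam)) :=
    ((ContinuousLinearMap.fst ℝ (E n) (E n)).comp
      (ContinuousLinearMap.snd ℝ ((E n × E k) × E n × E k × E k) (E n × E n))).hasFDerivAt
  have h3 := h1.sub (hl.inner ℝ (hp.sub h2))
  have h4 : HasFDerivAt (P.augRef lam0) _ (((P.qr t, P.vr t), q, v, w), (p, lam)) := h3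
  rw [h4.fderiv, ← P.fderiv_lagrRef lam0 t hq v w x y z, ← S.fderiv_anchor hq v x y]
  simp

variable {P} {q : ℝ → E n} {v : ℝ → E k}

theorem IsCurve.hasDerivAt_augAction (h : P.IsCurve q v) (lam0 : ℝ) {lam : ℝ → E n} (lamT : E d)
    (hlam : ContinuousOn lam P.I) {x : ℝ → E n} {y : ℝ → E k} {l : ℝ → E n} (m : E d)
    (hx : ContDiffOn ℝ 1 x P.I) (hy : ContDiffOn ℝ 1 y P.I) (hl : ContinuousOn l P.I) :
    HasDerivAt (fun s : ℝ => P.augAction lam0 (fun t => q t + s • x t) (fun t => v t + s • y t)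
      (fun t => lam t + s • l t) (lamT + s • m)) (P.firstVar lam0 q v lam lamT x y l m) 0 := by
  have hline : HasDerivAt (fun s : ℝ => (q P.T + s • x P.T, v P.T + s • y P.T)) (x P.T, y P.T) 0 := by
    have a : HasDerivAt (fun s : ℝ => q P.T + s • x P.T) (x P.T) 0 := by
      simpa using ((hasDerivAt_id (0 : ℝ)).smul_const (x P.T)).const_add (q P.T)
    have b : HasDerivAt (fun s : ℝ => v P.T + s • y P.T) (y P.T) 0 := by
      simpa using ((hasDerivAt_id (0 : ℝ)).smul_const (y P.T)).const_add (v P.T)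
    exact a.prodMk b
  have hΦ : HasFDerivAt P.Φ (fderiv ℝ P.Φ (q P.T, v P.T)) (q P.T + (0 : ℝ) • x P.T,
      v P.T + (0 : ℝ) • y P.T) := by
    simpa using (P.differentiableAt_Φ (h.mem_dom _ P.T_mem_I) _).hasFDerivAt
  have hr : HasFDerivAt P.rT (fderiv ℝ P.rT (q P.T, v P.T)) (q P.T + (0 : ℝ) • x P.T,
      v P.T + (0 : ℝ) • y P.T) := by
    simpa using (P.differentiableAt_rT (h.mem_dom _ P.T_mem_I) _).hasFDerivAt
  have h1 := (hΦ.comp_hasDerivAt (0 : ℝ) hline).const_mul P.weight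
  have hlm : HasDerivAt (fun s : ℝ => lamT + s • m) m 0 := by
    simpa using ((hasDerivAt_id (0 : ℝ)).smul_const m).const_add lamT
  have h2 := hlm.inner ℝ (hr.comp_hasDerivAt (0 : ℝ) hline)
  have h3 := hasDerivAt_integral_comp_line P.T_pos.le P.isOpen_augDom (P.contDiffOn_augRef lam0)
    (c := fun t => (P.lift q v t, (P.dot q t, lam t)))
    (ξ := fun t => ((0, x t, y t, P.dot y t), (P.dot x t, l t)))
    (h.continuousOn_lift.prodMk ((continuousOn_dot h.contDiff_q).prodMk hlam))
    ((continuousOn_const.prodMk (hx.continuousOn.prodMk (hy.continuousOn.prodMk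
      (continuousOn_dot hy)))).prodMk ((continuousOn_dot hx).prodMk hl))
    (fun t ht => ⟨h.mapsTo_lift ht, mem_univ _⟩)
  have h4 := (h1.add h2).add h3
  refine (h4.congr_deriv ?_).congr_of_eventuallyEq (.of_forall fun s => ?_)
  · rw [firstVar]
    congr 1
    · simp
    · refine intervalIntegral.integral_congr fun t ht => ?_
      rw [uIcc_of_le P.T_pos.le] at ht
      exact P.fderiv_augRef lam0 t (h.mem_dom t ht) (v t) (P.dot v t) (P.dot q t) (lam t)
        (x t) (y t) (P.dot y t) (P.dot x t) (l t)
  · simp only [augAction, Pi.add_apply, Function.comp]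
    congr 1
    · congr 1
      rw [PiLp.inner_apply]
      exact Finset.sum_congr rfl fun i _ => by simp [mul_comm]
    · refine intervalIntegral.integral_congr fun t ht => ?_
      rw [uIcc_of_le P.T_pos.le] at ht
      have a : P.dot (fun t => q t + s • x t) t = P.dot q t + s • P.dot x t :=
        dot_eq ((hasDerivWithinAt_dot h.contDiff_q ht).add
          ((hasDerivWithinAt_dot hx ht).const_smul s)) ht
      have b : P.dot (fun t => v t + s • y t) t = P.dot v t + s • P.dot y t :=
        dot_eq ((hasDerivWithinAt_dot h.contDiff_v ht).add
          ((hasDerivWithinAt_dot hy ht).const_smul s)) ht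
      simp only [augLagr_eq, a, b]
      simp [lift]

end Tracking

/-! ### Critical points of the augmented functional -/

theorem clm_ext_single {m : ℕ} {L M : E m →L[ℝ] ℝ}
    (h : ∀ i, L (EuclideanSpace.single i 1) = M (EuclideanSpace.single i 1)) : L = M := by
  ext x
  have hx : x = ∑ i, x i • EuclideanSpace.single i (1 : ℝ) := by
    ext j
    simp [Finset.sum_apply, Pi.single_apply]
  rw [hx, map_sum, map_sum]
  exact Finset.sum_congr rfl fun i _ => by rw [map_smul, map_smul, h]

theorem pd_left {n k : ℕ} {g : E n × E k → ℝ} {q : E n} {v : E k}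
    (hg : DifferentiableAt ℝ g (q, v)) (i : Fin n) :
    pd (fun x => g (x, v)) q i = fderiv ℝ g (q, v) (EuclideanSpace.single i 1, 0) := by
  have h : HasFDerivAt (fun x => g (x, v)) _ q :=
    HasFDerivAt.comp (f := fun x => (x, v)) q hg.hasFDerivAt
      ((hasFDerivAt_id q).prodMk (hasFDerivAt_const v q))
  rw [pd, h.fderiv]
  simp

theorem pd_right {n k : ℕ} {g : E n × E k → ℝ} {q : E n} {v : E k}
    (hg : DifferentiableAt ℝ g (q, v)) (A : Fin k) :
    pd (fun y => g (q, y)) v A = fderiv ℝ g (q, v) (0, EuclideanSpace.single A 1) := by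
  have h : HasFDerivAt (fun y => g (q, y)) _ v :=
    HasFDerivAt.comp (f := fun y => (q, y)) v hg.hasFDerivAt
      ((hasFDerivAt_const q v).prodMk (hasFDerivAt_id v))
  rw [pd, h.fderiv]
  simp

theorem fderiv_coord {X : Type*} [NormedAddCommGroup X] [NormedSpace ℝ X] {m : ℕ} {g : X → E m}
    {x : X} (hg : DifferentiableAt ℝ g x) (a : Fin m) (h : X) :
    DifferentiableAt ℝ (fun z => g z a) x ∧ fderiv ℝ (fun z => g z a) x h = fderiv ℝ g x h a := by
  have h1 : HasFDerivAt (fun z => g z a) _ x :=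
    (EuclideanSpace.proj a : E m →L[ℝ] ℝ).hasFDerivAt.comp x hg.hasFDerivAt
  exact ⟨h1.differentiableAt, by rw [h1.fderiv]; rfl⟩

namespace Tracking

variable {n k d : ℕ} {S : System n k} (P : Tracking S d)

/-- The derivative at `(q, v)` of the terminal functional `w Φ + λ_T · r`. -/
def terminalVar (w : ℝ) (q : E n) (v : E k) (lamT : E d) : E n × E k →L[ℝ] ℝ :=
  w • fderiv ℝ P.Φ (q, v) + (innerSL ℝ lamT).comp (fderiv ℝ P.rT (q, v))

theorem terminalVar_apply (w : ℝ) (q : E n) (v : E k) (lamT : E d) (z : E n × E k) :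
    P.terminalVar w q v lamT z
      = w * fderiv ℝ P.Φ (q, v) z + inner ℝ lamT (fderiv ℝ P.rT (q, v) z) := by
  simp [terminalVar]

theorem terminalVar_apply_eq_sum (w : ℝ) (q : E n) (v : E k) (lamT : E d) (z : E n × E k) :
    P.terminalVar w q v lamT z
      = w * fderiv ℝ P.Φ (q, v) z + ∑ a, lamT a * fderiv ℝ P.rT (q, v) z a := by
  rw [terminalVar_apply, PiLp.inner_apply]
  simp [mul_comm]

/-- The terminal conditions in vector form. -/
theorem transversality_iff {w : ℝ} {q : ℝ → E n} {v : ℝ → E k} {lam : ℝ → E n} {mu : ℝ → E k}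
    {lamT : E d} (hq : q P.T ∈ S.dom) :
    P.Transversality w q v lam mu lamT ↔ P.rT (q P.T, v P.T) = 0
      ∧ (∀ x, inner ℝ (lam P.T) x = P.terminalVar w (q P.T) (v P.T) lamT (x, 0))
      ∧ (∀ y, inner ℝ (mu P.T) y = P.terminalVar w (q P.T) (v P.T) lamT (0, y)) := by
  have hΦ := P.differentiableAt_Φ hq (v P.T)
  have hr := P.differentiableAt_rT hq (v P.T)
  have h1 : ∀ i, w * pd (fun x => P.Φ (x, v P.T)) (q P.T) i
      + ∑ a, lamT a * pd (fun x => P.rT (x, v P.T) a) (q P.T) i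
      = P.terminalVar w (q P.T) (v P.T) lamT (EuclideanSpace.single i 1, 0) := fun i => by
    rw [terminalVar_apply_eq_sum, pd_left hΦ]
    congr 1
    refine Finset.sum_congr rfl fun a _ => ?_
    have h := fderiv_coord hr a (EuclideanSpace.single i 1, 0)
    rw [pd_left h.1, h.2]
  have h2 : ∀ A, w * pd (fun y => P.Φ (q P.T, y)) (v P.T) A
      + ∑ a, lamT a * pd (fun y => P.rT (q P.T, y) a) (v P.T) A
      = P.terminalVar w (q P.T) (v P.T) lamT (0, EuclideanSpace.single A 1) := fun A => by
    rw [terminalVar_apply_eq_sum, pd_right hΦ]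
    congr 1
    refine Finset.sum_congr rfl fun a _ => ?_
    have h := fderiv_coord hr a ((0 : E n), EuclideanSpace.single A 1)
    rw [pd_right h.1, h.2]
  constructor
  · intro h
    refine ⟨h.terminal, fun x => ?_, fun y => ?_⟩
    · have h3 : innerSL ℝ (lam P.T) = (P.terminalVar w (q P.T) (v P.T) lamT).comp
          (ContinuousLinearMap.inl ℝ (E n) (E k)) := clm_ext_single fun i => by
        have := h.lam_T i
        rw [h1] at this
        simpa [EuclideanSpace.inner_single_right] using this
      exact congrArg (fun L : E n →L[ℝ] ℝ => L x) h3
    · have h3 : innerSL ℝ (mu P.T) = (P.terminalVar w (q P.T) (v P.T) lamT).comp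
          (ContinuousLinearMap.inr ℝ (E n) (E k)) := clm_ext_single fun i => by
        have := h.mu_T i
        rw [h2] at this
        simpa [EuclideanSpace.inner_single_right] using this
      exact congrArg (fun L : E k →L[ℝ] ℝ => L y) h3
  · rintro ⟨h0, hx, hy⟩
    refine ⟨h0, fun i => ?_, fun A => ?_⟩
    · rw [h1, ← hx]; simp [EuclideanSpace.inner_single_right]
    · rw [h2, ← hy]; simp [EuclideanSpace.inner_single_right]

variable {P} {q : ℝ → E n} {v : ℝ → E k} {lam0 : ℝ} {lam : ℝ → E n}

theorem IsCurve.isCritical_iff (h : P.IsCurve q v) {lamT : E d} (hlam : ContinuousOn lam P.I) :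
    P.IsCritical lam0 q v lam lamT ↔ ∀ (x : ℝ → E n) (y : ℝ → E k) (l : ℝ → E n) (m : E d),
      ContDiffOn ℝ 1 x P.I → ContDiffOn ℝ 1 y P.I → ContinuousOn l P.I → x 0 = 0 → y 0 = 0 →
      P.firstVar lam0 q v lam lamT x y l m = 0 := by
  refine forall_congr' fun x => forall_congr' fun y => forall_congr' fun l =>
    forall_congr' fun m => forall_congr' fun hx => forall_congr' fun hy =>
    forall_congr' fun hl => forall_congr' fun _ => forall_congr' fun _ => ?_
  have hd := h.hasDerivAt_augAction lam0 lamT hlam m hx hy hl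
  exact ⟨fun hc => hd.unique hc, fun hc => hc ▸ hd⟩

/-- Integration by parts in the running action: along solutions of the Euler-Lagrange equations,
the integrand of the first variation is the derivative of `⟨∂ℒ/∂v̇, y⟩ - ⟨λ, x⟩`. -/
theorem EulerLagrange.integral_eq (h : P.IsCurve q v) (hEL : P.EulerLagrange lam0 q v lam)
    {x x' : ℝ → E n} {y y' : ℝ → E k}
    (hx : ∀ t ∈ P.I, HasDerivWithinAt x (x' t) P.I t) (hx' : ContinuousOn x' P.I)
    (hy : ∀ t ∈ P.I, HasDerivWithinAt y (y' t) P.I t) (hy' : ContinuousOn y' P.I)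
    (hx0 : x 0 = 0) (hy0 : y 0 = 0) :
    ∫ t in (0 : ℝ)..P.T, (inner ℝ (P.gradQ lam0 t (q t) (v t) (P.dot v t)) (x t)
        + inner ℝ (P.gradV lam0 t (q t) (v t) (P.dot v t)) (y t)
        + inner ℝ (P.momentum lam0 q v t) (y' t)
        - inner ℝ (lam t) (x' t - (S.anchorQ (q t) (v t) (x t) + S.anchor (q t) (y t))))
      = inner ℝ (P.momentum lam0 q v P.T) (y P.T) - inner ℝ (lam P.T) (x P.T) := by
  obtain ⟨h1, -, h3⟩ := (P.eulerLagrange_iff h.mem_dom).1 hEL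
  have hlam : ContinuousOn lam P.I := fun t ht => (h1 t ht).continuousWithinAt
  have hxc : ContinuousOn x P.I := fun t ht => (hx t ht).continuousWithinAt
  have hyc : ContinuousOn y P.I := fun t ht => (hy t ht).continuousWithinAt
  have hQ := h.continuousOn_gradQ lam0
  have hV := h.continuousOn_gradV lam0
  have hM := h.continuousOn_momentum lam0
  have haQ := (continuousOn_adjoint h.continuousOn_anchorQ).clm_apply hlam
  have haL := (continuousOn_adjoint h.continuousOn_anchorL).clm_apply hlam
  have key := integral_eq_sub_of_hasDerivWithinAt_Icc P.T_pos.le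
    (f := fun t => inner ℝ (P.momentum lam0 q v t) (y t) - inner ℝ (lam t) (x t))
    (fun t ht => ((h3 t ht).inner ℝ (hy t ht)).sub ((h1 t ht).inner ℝ (hx t ht)))
    (((hM.inner hy').add ((hV.add haL).inner hyc)).sub
      ((hlam.inner hx').add ((hQ.add haQ).neg.inner hxc)))
  simp only [hx0, hy0, inner_zero_right, sub_self, sub_zero] at key
  rw [← key]
  refine intervalIntegral.integral_congr fun t _ => ?_
  simp only [inner_add_left, inner_neg_left, ContinuousLinearMap.adjoint_inner_left,
    inner_sub_right, inner_add_right, S.anchorL_apply]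
  ring

theorem IsCurve.isCritical_of_eulerLagrange (h : P.IsCurve q v) {lamT : E d}
    (hlam : ContinuousOn lam P.I) (hEL : P.EulerLagrange lam0 q v lam)
    (hT : P.Transversality P.weight q v lam (-P.momentum lam0 q v) lamT) :
    P.IsCritical lam0 q v lam lamT := by
  refine (h.isCritical_iff hlam).2 fun x y l m hx hy hl hx0 hy0 => ?_
  obtain ⟨hr, hTq, hTv⟩ := (P.transversality_iff (h.mem_dom _ P.T_mem_I)).1 hT
  have h1 := hEL.integral_eq h (fun t ht => hasDerivWithinAt_dot hx ht) (continuousOn_dot hx)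
    (fun t ht => hasDerivWithinAt_dot hy ht) (continuousOn_dot hy) hx0 hy0
  have h2 : ∫ t in (0 : ℝ)..P.T, (inner ℝ (P.gradQ lam0 t (q t) (v t) (P.dot v t)) (x t)
        + inner ℝ (P.gradV lam0 t (q t) (v t) (P.dot v t)) (y t)
        + inner ℝ (P.momentum lam0 q v t) (P.dot y t)
        - (inner ℝ (lam t) (P.dot x t - (S.anchorQ (q t) (v t) (x t) + S.anchor (q t) (y t)))
          + inner ℝ (l t) (P.dot q t - S.anchor (q t) (v t))))
      = inner ℝ (P.momentum lam0 q v P.T) (y P.T) - inner ℝ (lam P.T) (x P.T) := by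
    rw [← h1]
    refine intervalIntegral.integral_congr fun t ht => ?_
    rw [uIcc_of_le P.T_pos.le] at ht
    have := dot_eq (((P.eulerLagrange_iff h.mem_dom).1 hEL).2.1 t ht) ht
    simp only [this, sub_self, inner_zero_right, add_zero]
  have h3 := hTq (x P.T)
  have h4 := hTv (y P.T)
  have h5 : P.terminalVar P.weight (q P.T) (v P.T) lamT (x P.T, y P.T)
      = P.terminalVar P.weight (q P.T) (v P.T) lamT (x P.T, 0)
        + P.terminalVar P.weight (q P.T) (v P.T) lamT (0, y P.T) := by
    rw [← map_add]; simp
  rw [firstVar, h2, hr, inner_zero_right, add_zero, ← terminalVar_apply, h5, ← h3, ← h4,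
    Pi.neg_apply, inner_neg_left]
  ring

theorem IsCurve.eulerLagrange_of_isCritical (h : P.IsCurve q v) {lamT : E d}
    (hlam : ContinuousOn lam P.I) (hc : P.IsCritical lam0 q v lam lamT) :
    P.EulerLagrange lam0 q v lam
      ∧ P.Transversality P.weight q v lam (-P.momentum lam0 q v) lamT := by
  rw [h.isCritical_iff hlam] at hc
  have hQ := h.continuousOn_gradQ lam0
  have hV := h.continuousOn_gradV lam0
  have hM := h.continuousOn_momentum lam0
  have haQ := (continuousOn_adjoint h.continuousOn_anchorQ).clm_apply hlam
  have haL := (continuousOn_adjoint h.continuousOn_anchorL).clm_apply hlam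
  have hdot : ∀ {X : Type} [NormedAddCommGroup X] [NormedSpace ℝ X] (t : ℝ),
      P.dot (fun _ => (0 : X)) t = 0 := fun t => by simp [dot]
  have hz : ∀ t, S.anchor (q t) (0 : E k) = 0 := fun t => by rw [← S.anchorL_apply, map_zero]
  -- the variation of `λ_T` along the residual, then that of `λ` along the defect
  have hr : P.rT (q P.T, v P.T) = 0 := by
    have h1 := hc (fun _ => 0) (fun _ => 0) (fun _ => 0) (P.rT (q P.T, v P.T)) contDiffOn_const
      contDiffOn_const continuousOn_const rfl rfl
    simpa [firstVar, hdot, hz, Prod.mk_zero_zero] using h1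
  have heq : ∀ t ∈ P.I, P.dot q t - S.anchor (q t) (v t) = 0 := by
    have hcont : ContinuousOn (fun t => P.dot q t - S.anchor (q t) (v t)) P.I :=
      (continuousOn_dot h.contDiff_q).sub h.continuousOn_anchor
    have h1 := hc (fun _ => 0) (fun _ => 0) _ 0 contDiffOn_const
      contDiffOn_const hcont rfl rfl
    refine eq_zero_of_integral_inner_self P.T_pos hcont ?_
    simpa only [firstVar, hdot, hz, map_zero, inner_zero_right, inner_zero_left, add_zero,
      zero_add, sub_zero, zero_sub, Prod.mk_zero_zero, mul_zero, intervalIntegral.integral_neg,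
      neg_eq_zero] using h1
  set τ := P.terminalVar P.weight (q P.T) (v P.T) lamT with hτ
  have hlamDBR := du_bois_reymond P.T_pos
    (a := fun t => P.gradQ lam0 t (q t) (v t) (P.dot v t)
      + ContinuousLinearMap.adjoint (S.anchorQ (q t) (v t)) (lam t))
    (b := fun t => -lam t) (hQ.add haQ) hlam.neg
    ((InnerProductSpace.toDual ℝ (E n)).symm (τ.comp (ContinuousLinearMap.inl ℝ (E n) (E k))))
    (fun x x' hx hx' hx0 => by
      have h1 := hc x (fun _ => 0) (fun _ => 0) 0 (contDiffOn_of_hasDerivWithinAt hx hx')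
        contDiffOn_const continuousOn_const hx0 rfl
      rw [firstVar, inner_zero_left, add_zero, ← terminalVar_apply, ← hτ] at h1
      rw [InnerProductSpace.toDual_symm_apply]
      refine (add_comm _ _).trans (Eq.trans ?_ h1)
      refine congrArg₂ (· + ·) rfl (intervalIntegral.integral_congr fun t ht => ?_)
      rw [uIcc_of_le P.T_pos.le] at ht
      simp only [hdot, hz, dot_eq (hx t ht) ht, inner_zero_right, inner_zero_left, add_zero,
        inner_add_left, inner_neg_left, ContinuousLinearMap.adjoint_inner_left, inner_sub_right]
      ring)
  have hmuDBR := du_bois_reymond P.T_pos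
    (a := fun t => P.gradV lam0 t (q t) (v t) (P.dot v t)
      + ContinuousLinearMap.adjoint (S.anchorL (q t)) (lam t))
    (b := P.momentum lam0 q v) (hV.add haL) hM
    ((InnerProductSpace.toDual ℝ (E k)).symm (τ.comp (ContinuousLinearMap.inr ℝ (E n) (E k))))
    (fun y y' hy hy' hy0 => by
      have h1 := hc (fun _ => 0) y (fun _ => 0) 0 contDiffOn_const
        (contDiffOn_of_hasDerivWithinAt hy hy') continuousOn_const rfl hy0
      rw [firstVar, inner_zero_left, add_zero, ← terminalVar_apply, ← hτ] at h1
      rw [InnerProductSpace.toDual_symm_apply]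
      refine (add_comm _ _).trans (Eq.trans ?_ h1)
      refine congrArg₂ (· + ·) rfl (intervalIntegral.integral_congr fun t ht => ?_)
      rw [uIcc_of_le P.T_pos.le] at ht
      simp only [hdot, dot_eq (hy t ht) ht, inner_zero_right, inner_zero_left, add_zero, map_zero,
        zero_add, zero_sub, inner_neg_right, sub_neg_eq_add,
        inner_add_left, ContinuousLinearMap.adjoint_inner_left, S.anchorL_apply]
      ring)
  refine ⟨(P.eulerLagrange_iff h.mem_dom).2 ⟨fun t ht => ?_, fun t ht => ?_, hmuDBR.2⟩,
    (P.transversality_iff (h.mem_dom _ P.T_mem_I)).2 ⟨hr, fun x => ?_, fun y => ?_⟩⟩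
  · exact ((hlamDBR.2 t ht).neg).congr (fun s _ => (neg_neg _).symm) (neg_neg _).symm
  · rw [← sub_eq_zero.1 (heq t ht)]
    exact hasDerivWithinAt_dot h.contDiff_q ht
  · rw [neg_injective hlamDBR.1, InnerProductSpace.toDual_symm_apply]
    rfl
  · rw [Pi.neg_apply, hmuDBR.1, neg_neg, InnerProductSpace.toDual_symm_apply]
    rfl

end Tracking

/-! ### The multiplier rule -/

section Pairing

variable {K X Y : Type*} [TopologicalSpace K] [CompactSpace K]
  [NormedAddCommGroup X] [NormedSpace ℝ X] [NormedAddCommGroup Y] [NormedSpace ℝ Y]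

/-- The pairing `(x, y) ↦ (t ↦ (x t, y t))` of continuous functions. -/
def pairing : C(K, X) × C(K, Y) →L[ℝ] C(K, X × Y) :=
  LinearMap.mkContinuous
    { toFun := fun z => z.1.prodMk z.2
      map_add' := fun _ _ => rfl
      map_smul' := fun _ _ => rfl } 1
    (fun z => by
      rw [one_mul]
      refine (ContinuousMap.norm_le _ (norm_nonneg _)).2 fun t => ?_
      exact max_le_max (z.1.norm_coe_le_norm t) (z.2.norm_coe_le_norm t))

end Pairing

theorem primitive_restr_eq {T : ℝ} {X : Type*} [NormedAddCommGroup X] [NormedSpace ℝ X]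
    [CompleteSpace X] (hT : 0 ≤ T) {c c' : ℝ → X}
    (hc : ∀ t ∈ Icc 0 T, HasDerivWithinAt c (c' t) (Icc 0 T) t) (hc' : ContinuousOn c' (Icc 0 T))
    (t : Icc (0 : ℝ) T) : primitive hT (restr c' hc') t = c t - c 0 := by
  have hsub : Icc 0 (t : ℝ) ⊆ Icc 0 T := Icc_subset_Icc_right t.2.2
  have h := integral_eq_sub_of_hasDerivWithinAt_Icc t.2.1
    (fun s hs => (hc s (hsub hs)).mono hsub) (hc'.mono hsub)
  rw [← h, primitive_apply]
  refine intervalIntegral.integral_congr fun s hs => ?_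
  rw [uIcc_of_le t.2.1] at hs
  simp only [IccExtend_of_mem hT _ (hsub hs)]
  rfl

namespace Tracking

variable {n k d : ℕ} {S : System n k} (P : Tracking S d)

/-- The Banach space of the pairs `(q, v̇)`. -/
abbrev Pairs : Type := C(Icc (0 : ℝ) P.T, E n) × C(Icc (0 : ℝ) P.T, E k)

/-- The linear part of the map `(q, v̇) ↦ (q, v)`. -/
def stateL : P.Pairs →L[ℝ] C(Icc (0 : ℝ) P.T, E n × E k) :=
  pairing.comp ((ContinuousLinearMap.fst ℝ _ _).prod
    ((primitive P.T_pos.le).comp (ContinuousLinearMap.snd ℝ _ _)))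

/-- The map `(q, v̇) ↦ (q, v)`, where `v(0) = v_0`. -/
def state (b : P.Pairs) : C(Icc (0 : ℝ) P.T, E n × E k) :=
  ContinuousMap.const _ (0, P.v0) + P.stateL b

theorem stateL_apply (b : P.Pairs) (t : Icc (0 : ℝ) P.T) :
    P.stateL b t = (b.1 t, primitive P.T_pos.le b.2 t) := rfl

theorem state_apply (b : P.Pairs) (t : Icc (0 : ℝ) P.T) :
    P.state b t = (b.1 t, P.v0 + primitive P.T_pos.le b.2 t) := by
  simp [state, stateL_apply]

/-- The linear part of the map `(q, v̇) ↦ (q, v, v̇)`. -/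
def jetL : P.Pairs →L[ℝ] C(Icc (0 : ℝ) P.T, (E n × E k) × E n × E k × E k) :=
  pairing.comp ((0 : P.Pairs →L[ℝ] C(Icc (0 : ℝ) P.T, E n × E k)).prod
    (pairing.comp ((ContinuousLinearMap.fst ℝ _ _).prod (pairing.comp
      (((primitive P.T_pos.le).comp (ContinuousLinearMap.snd ℝ _ _)).prod
        (ContinuousLinearMap.snd ℝ _ _))))))

theorem jetL_apply (b : P.Pairs) (t : Icc (0 : ℝ) P.T) :
    P.jetL b t = (0, b.1 t, primitive P.T_pos.le b.2 t, b.2 t) := rfl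

/-- The map `(q, v̇) ↦ (q, v, v̇)`, together with the reference curve. -/
def jet (b : P.Pairs) : C(Icc (0 : ℝ) P.T, (E n × E k) × E n × E k × E k) :=
  restr (fun t => ((P.qr t, P.vr t), 0, P.v0, 0))
    ((P.continuous_qr.prodMk P.continuous_vr).prodMk continuousOn_const) + P.jetL b

theorem jet_apply (b : P.Pairs) (t : Icc (0 : ℝ) P.T) :
    P.jet b t = ((P.qr t, P.vr t), b.1 t, P.v0 + primitive P.T_pos.le b.2 t, b.2 t) := by
  simp [jet, jetL_apply]

/-- The action and the terminal cost as a functional of `(q, v̇)`. -/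
def pairAction (b : P.Pairs) : ℝ :=
  integralL P.T_pos.le (superpose (P.lagrRef 1) (P.jet b))
    + P.weight * P.Φ (evalEnd P.T_pos.le (P.state b))

/-- The defect of the constraint `q̇ = ρ_A v^A`, `q(0) = q_0`, in integrated form. -/
def pairDefect (b : P.Pairs) : C(Icc (0 : ℝ) P.T, E n) :=
  b.1 - (ContinuousMap.const _ P.q0 + primitive P.T_pos.le
    (superpose (fun z : E n × E k => S.anchor z.1 z.2) (P.state b)))

theorem pairAction_eq {b : P.Pairs} {q : ℝ → E n} {v : ℝ → E k} (hq : ∀ t ∈ P.I, q t ∈ S.dom)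
    (hb : ∀ t : Icc (0 : ℝ) P.T, P.state b t = (q t, v t))
    (hv : ∀ t : Icc (0 : ℝ) P.T, P.dot v t = b.2 t) : P.pairAction b = P.action q v := by
  have hj : ∀ t : Icc (0 : ℝ) P.T, P.jet b t = P.lift q v t := fun t => by
    have h := hb t
    rw [state_apply, Prod.mk.injEq] at h
    rw [jet_apply, lift, hv, h.1, h.2]
  unfold pairAction action
  congr 1
  · refine integralL_eq _ fun t => ?_
    rw [superpose_apply (P.contDiffOn_lagrRef 1).continuousOn
      (fun s => by rw [hj]; exact ⟨mem_univ _, hq s s.2, mem_univ _⟩), hj]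
    rfl
  · rw [evalEnd_apply, hb]

theorem pairDefect_eq_zero {b : P.Pairs} {q : ℝ → E n} {v : ℝ → E k} (h : P.IsCurve q v)
    (hode : ∀ t ∈ P.I, HasDerivWithinAt q (S.anchor (q t) (v t)) P.I t)
    (hb : ∀ t : Icc (0 : ℝ) P.T, P.state b t = (q t, v t)) : P.pairDefect b = 0 := by
  have h1 : superpose (fun z : E n × E k => S.anchor z.1 z.2) (P.state b)
      = restr (fun t => S.anchor (q t) (v t)) h.continuousOn_anchor := by
    ext1 t
    rw [superpose_apply S.contDiffOn_anchor.continuousOn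
      (fun s => by rw [hb]; exact ⟨h.mem_dom s s.2, mem_univ _⟩), hb]
    rfl
  ext1 t
  have h2 := hb t
  rw [state_apply, Prod.mk.injEq] at h2
  have h3 : primitive P.T_pos.le (superpose (fun z : E n × E k => S.anchor z.1 z.2) (P.state b)) t
      = q t - q 0 := by
    rw [h1]
    exact primitive_restr_eq P.T_pos.le hode h.continuousOn_anchor t
  rw [pairDefect, ContinuousMap.sub_apply, ContinuousMap.add_apply, h3, h2.1, h.init_q]
  simp

theorem isCurve_of_pairDefect_eq_zero {b : P.Pairs} (hb : P.pairDefect b = 0)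
    (hdom : ∀ t, P.state b t ∈ S.dom ×ˢ (univ : Set (E k))) :
    ∃ (q : ℝ → E n) (v : ℝ → E k), P.IsCurve q v
      ∧ (∀ t ∈ P.I, HasDerivWithinAt q (S.anchor (q t) (v t)) P.I t)
      ∧ (∀ t : Icc (0 : ℝ) P.T, P.state b t = (q t, v t))
      ∧ (∀ t : Icc (0 : ℝ) P.T, P.dot v t = b.2 t) := by
  have hT := P.T_pos.le
  set q : ℝ → E n := IccExtend hT b.1 with hq
  set v : ℝ → E k := fun t => P.v0 + IccExtend hT (primitive hT b.2) t with hv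
  have hst : ∀ t : Icc (0 : ℝ) P.T, P.state b t = (q t, v t) := fun t => by
    rw [state_apply, hq, hv]
    simp
  have hdom' : ∀ t ∈ P.I, q t ∈ S.dom := fun t ht => by
    have := hdom ⟨t, ht⟩
    rw [hst] at this
    exact this.1
  have hv' : ∀ t ∈ P.I, HasDerivWithinAt v (IccExtend hT b.2 t) P.I t := fun t ht =>
    (hasDerivWithinAt_primitive hT b.2 ht).const_add P.v0
  set a := superpose (fun z : E n × E k => S.anchor z.1 z.2) (P.state b) with ha
  have hqeq : ∀ t ∈ P.I, q t = P.q0 + IccExtend hT (primitive hT a) t := fun t ht => by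
    have h1 := congrArg (fun c : C(Icc (0 : ℝ) P.T, E n) => c ⟨t, ht⟩) (sub_eq_zero.1 hb)
    rw [hq, IccExtend_of_mem hT _ ht, IccExtend_of_mem hT _ ht]
    exact h1
  have hode : ∀ t ∈ P.I, HasDerivWithinAt q (S.anchor (q t) (v t)) P.I t := fun t ht => by
    have h1 := ((hasDerivWithinAt_primitive hT a ht).const_add P.q0).congr hqeq (hqeq t ht)
    rwa [IccExtend_of_mem hT _ ht, ha, superpose_apply S.contDiffOn_anchor.continuousOn hdom,
      hst] at h1
  refine ⟨q, v, ⟨?_, ?_, hdom', ?_, ?_⟩, hode, hst, fun t => ?_⟩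
  · refine contDiffOn_of_hasDerivWithinAt hode ?_
    refine ContinuousOn.comp (g := fun z : E n × E k => S.anchor z.1 z.2)
      (f := fun t => (q t, v t)) S.contDiffOn_anchor.continuousOn
      (ContinuousOn.prodMk (continuous_IccExtend _ _).continuousOn
        (fun t ht => (hv' t ht).continuousWithinAt)) fun t ht => ⟨hdom' t ht, mem_univ _⟩
  · exact contDiffOn_of_hasDerivWithinAt hv' (continuous_IccExtend _ _).continuousOn
  · rw [hqeq 0 P.zero_mem_I, primitive_zero, add_zero]
  · simp only [hv, primitive_zero, add_zero]
  · rw [dot_eq (hv' t t.2) t.2, IccExtend_of_mem hT _ t.2]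

theorem hasStrictFDerivAt_pairAction {b : P.Pairs}
    (hdom : ∀ t, P.state b t ∈ S.dom ×ˢ (univ : Set (E k))) :
    ∃ φ' : P.Pairs →L[ℝ] ℝ, HasStrictFDerivAt P.pairAction φ' b
      ∧ ∀ c : P.Pairs, φ' c
        = (∫ t in (0 : ℝ)..P.T, fderiv ℝ (P.lagrRef 1) (IccExtend P.T_pos.le (P.jet b) t)
            (IccExtend P.T_pos.le (P.jetL c) t))
          + P.weight * fderiv ℝ P.Φ (evalEnd P.T_pos.le (P.state b))
            (evalEnd P.T_pos.le (P.stateL c)) := by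
  have hjet : ∀ t, P.jet b t ∈ P.lagrDom := fun t => by
    have := hdom t
    rw [state_apply] at this
    rw [jet_apply]
    exact ⟨mem_univ _, this.1, mem_univ _⟩
  have h1 := (integralL P.T_pos.le).hasStrictFDerivAt.comp b
    ((hasStrictFDerivAt_superpose P.isOpen_lagrDom (P.contDiffOn_lagrRef 1) (P.jet b) hjet).comp b
      (P.jetL.hasStrictFDerivAt.const_add _))
  have h2 : HasStrictFDerivAt P.Φ _ (evalEnd P.T_pos.le (P.state b)) :=
    (P.contDiff_Φ.contDiffAt (S.isOpen_phase.mem_nhds (hdom _))).hasStrictFDerivAt one_ne_zero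
  have h3 := (h2.comp b ((evalEnd P.T_pos.le).hasStrictFDerivAt.comp b
    (P.stateL.hasStrictFDerivAt.const_add (ContinuousMap.const _ (0, P.v0))))).const_mul P.weight
  refine ⟨_, h1.add h3, fun c => ?_⟩
  rfl

theorem hasStrictFDerivAt_pairDefect {b : P.Pairs}
    (hdom : ∀ t, P.state b t ∈ S.dom ×ˢ (univ : Set (E k))) :
    HasStrictFDerivAt P.pairDefect
      (ContinuousLinearMap.fst ℝ _ _ - (primitive P.T_pos.le).comp
        ((pointwise (derivAlong S.isOpen_phase (S.contDiffOn_anchor.of_le (by simp))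
          (P.state b) hdom)).comp P.stateL)) b := by
  have h1 := (primitive P.T_pos.le).hasStrictFDerivAt.comp b
    ((hasStrictFDerivAt_superpose S.isOpen_phase (S.contDiffOn_anchor.of_le (by simp))
      (P.state b) hdom).comp b (P.stateL.hasStrictFDerivAt.const_add _))
  exact (ContinuousLinearMap.hasStrictFDerivAt (ContinuousLinearMap.fst ℝ _ _)).sub
    (h1.const_add _)

variable {P} {q : ℝ → E n} {v : ℝ → E k}

/-- Lagrange multipliers for a terminal constraint with values in a finite-dimensional space. The
terminal multiplier and `λ₀` do not both vanish, since the differential constraint alone is a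
submersion: its derivative in the direction of `q` is a Volterra perturbation of the identity. -/
theorem IsCurve.exists_terminal_multiplier (h : P.IsCurve q v)
    (hode : ∀ t ∈ P.I, HasDerivWithinAt q (S.anchor (q t) (v t)) P.I t)
    {F : Type*} [NormedAddCommGroup F] [NormedSpace ℝ F] [CompleteSpace F] {g : E n × E k → F}
    (hg : ContDiffAt ℝ 1 g (q P.T, v P.T))
    (hmin : ∀ q' v', P.IsCurve q' v' →
      (∀ t ∈ P.I, HasDerivWithinAt q' (S.anchor (q' t) (v' t)) P.I t) →
      g (q' P.T, v' P.T) = g (q P.T, v P.T) → P.action q v ≤ P.action q' v') :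
    ∃ (lam0 : ℝ) (ell : Module.Dual ℝ F), 0 ≤ lam0 ∧ (lam0 ≠ 0 ∨ ell ≠ 0) ∧
      ∀ (x x' : ℝ → E n) (y y' : ℝ → E k),
        (∀ t ∈ P.I, x' t = S.anchorQ (q t) (v t) (x t) + S.anchor (q t) (y t)) →
        (∀ t ∈ P.I, HasDerivWithinAt x (x' t) P.I t) → ContinuousOn x' P.I →
        (∀ t ∈ P.I, HasDerivWithinAt y (y' t) P.I t) → ContinuousOn y' P.I →
        x 0 = 0 → y 0 = 0 →
        ell (fderiv ℝ g (q P.T, v P.T) (x P.T, y P.T))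
          + lam0 * (P.weight * fderiv ℝ P.Φ (q P.T, v P.T) (x P.T, y P.T)
            + P.runningVar 1 q v x y y') = 0 := by
  have hT := P.T_pos.le
  set b : P.Pairs := (restr q h.continuousOn_q, restr (P.dot v) (continuousOn_dot h.contDiff_v))
    with hb
  have hst : ∀ t : Icc (0 : ℝ) P.T, P.state b t = (q t, v t) := fun t => by
    have := primitive_restr_eq hT (fun t ht => hasDerivWithinAt_dot h.contDiff_v ht)
      (continuousOn_dot h.contDiff_v) t
    rw [state_apply, this, h.init_v, add_sub_cancel]
    rfl
  have hdom : ∀ t, P.state b t ∈ S.dom ×ˢ (univ : Set (E k)) := fun t => by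
    rw [hst]; exact ⟨h.mem_dom t t.2, mem_univ _⟩
  have hjet : ∀ t : Icc (0 : ℝ) P.T, P.jet b t = P.lift q v t := fun t => by
    have h1 := hst t
    rw [state_apply, Prod.mk.injEq] at h1
    rw [jet_apply, lift, h1.1, h1.2]
    rfl
  have hend : evalEnd hT (P.state b) = (q P.T, v P.T) := hst ⟨P.T, P.T_mem_I⟩
  obtain ⟨φ', hφ, hφ'⟩ := P.hasStrictFDerivAt_pairAction hdom
  have hf1 := P.hasStrictFDerivAt_pairDefect hdom
  have hf2 : HasStrictFDerivAt (fun c : P.Pairs => g (evalEnd hT (P.state c)))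
      ((fderiv ℝ g (q P.T, v P.T)).comp ((evalEnd hT).comp P.stateL)) b :=
    HasStrictFDerivAt.comp (f := fun c : P.Pairs => evalEnd hT (P.state c)) b
      (by rw [hend]; exact hg.hasStrictFDerivAt one_ne_zero)
      ((evalEnd hT).hasStrictFDerivAt.comp b (P.stateL.hasStrictFDerivAt.const_add _))
  have hdef0 : P.pairDefect b = 0 := P.pairDefect_eq_zero h hode hst
  have hact0 : P.pairAction b = P.action q v :=
    P.pairAction_eq h.mem_dom hst fun t => rfl
  have hcont : ContinuousAt P.state b :=
    (P.stateL.continuous.const_add (ContinuousMap.const _ (0, P.v0))).continuousAt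
  have hextr : IsLocalExtrOn P.pairAction
      {c | (P.pairDefect c, g (evalEnd hT (P.state c)))
        = (P.pairDefect b, g (evalEnd hT (P.state b)))} b := by
    refine Or.inl ?_
    refine Filter.eventually_of_mem (inter_mem_nhdsWithin _
      (hcont.eventually (eventually_forall_mem S.isOpen_phase hdom))) ?_
    rintro c ⟨hc, hcdom⟩
    obtain ⟨hc1, hc2⟩ := Prod.mk.inj (mem_ofPred_eq ▸ hc)
    obtain ⟨q', v', hcurve, hode', hst', hdot'⟩ :=
      P.isCurve_of_pairDefect_eq_zero (hc1.trans hdef0) hcdom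
    have hend' : evalEnd hT (P.state c) = (q' P.T, v' P.T) := hst' ⟨P.T, P.T_mem_I⟩
    rw [hend, hend'] at hc2
    change P.pairAction b ≤ P.pairAction c
    rw [hact0, P.pairAction_eq hcurve.mem_dom hst' hdot']
    exact hmin q' v' hcurve hode' hc2
  obtain ⟨Λ, Λ₀, hne, hΛ⟩ := hextr.exists_linear_map_of_hasStrictFDerivAt (hf1.prodMk hf2) hφ
  -- Mathlib's multiplier `Λ` is an algebraic functional; only its second component survives
  set ell : Module.Dual ℝ F := Λ.comp (LinearMap.inr ℝ _ F) with hell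
  have hsplit : ∀ (c : C(Icc (0 : ℝ) P.T, E n)) (e : F), Λ (c, e) = Λ (c, 0) + ell e :=
    fun c e => by
      rw [hell, LinearMap.comp_apply, LinearMap.inr_apply, ← map_add]; simp
  have hder : ∀ (c : P.Pairs) (t : Icc (0 : ℝ) P.T),
      pointwise (derivAlong S.isOpen_phase (S.contDiffOn_anchor.of_le (by simp))
        (P.state b) hdom) (P.stateL c) t
      = S.anchorQ (q t) (v t) (c.1 t) + S.anchor (q t) (primitive hT c.2 t) := fun c t => by
    rw [← S.fderiv_anchor (h.mem_dom t t.2) (v t)]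
    change fderiv ℝ _ (P.state b t) (P.stateL c t) = _
    rw [hst, stateL_apply]
  have hzero : ∀ t, S.anchor (q t) (0 : E k) = 0 := fun t => by rw [← S.anchorL_apply, map_zero]
  have hnontriv : Λ₀ ≠ 0 ∨ ell ≠ 0 := by
    by_contra! h0
    -- otherwise `Λ` vanishes on the values of the derivative of the differential constraint, and
    -- the variations of `q` alone produce all of them
    refine hne (Prod.ext (LinearMap.ext ?_) h0.1)
    rintro ⟨c, e⟩
    obtain ⟨x, hx⟩ := surjective_one_sub_volterra hT (restr _ h.continuousOn_anchorQ) c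
    have h1 := hΛ (x, 0)
    have h2 : pointwise (derivAlong S.isOpen_phase (S.contDiffOn_anchor.of_le (by simp))
        (P.state b) hdom) (P.stateL (x, 0)) = pointwise (restr _ h.continuousOn_anchorQ) x := by
      ext1 t
      rw [hder]
      simp only [map_zero, ContinuousMap.zero_apply, hzero, add_zero]
      rfl
    rw [hsplit, h0.2, LinearMap.zero_apply, add_zero]
    rw [h0.1, zero_smul, add_zero, ContinuousLinearMap.prod_apply, hsplit, h0.2,
      LinearMap.zero_apply, add_zero] at h1
    rw [sub_apply, ContinuousLinearMap.comp_apply,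
      ContinuousLinearMap.comp_apply, h2] at h1
    rw [← hx]
    exact h1
  have key : ∀ (x x' : ℝ → E n) (y y' : ℝ → E k),
      (∀ t ∈ P.I, x' t = S.anchorQ (q t) (v t) (x t) + S.anchor (q t) (y t)) →
      (∀ t ∈ P.I, HasDerivWithinAt x (x' t) P.I t) → ContinuousOn x' P.I →
      (∀ t ∈ P.I, HasDerivWithinAt y (y' t) P.I t) → ContinuousOn y' P.I →
      x 0 = 0 → y 0 = 0 →
      ell (fderiv ℝ g (q P.T, v P.T) (x P.T, y P.T))
        + Λ₀ * (P.weight * fderiv ℝ P.Φ (q P.T, v P.T) (x P.T, y P.T)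
          + P.runningVar 1 q v x y y') = 0 := by
    intro x x' y y' hx' hx hxc hy hyc hx0 hy0
    have hxcont : ContinuousOn x (Icc 0 P.T) := fun t ht => (hx t ht).continuousWithinAt
    have hprimy : ∀ t : Icc (0 : ℝ) P.T, primitive hT (restr y' hyc) t = y t := fun t => by
      rw [primitive_restr_eq hT hy hyc t, hy0, sub_zero]
    have h1 := hΛ (restr x hxcont, restr y' hyc)
    have h2 : pointwise (derivAlong S.isOpen_phase (S.contDiffOn_anchor.of_le (by simp))
        (P.state b) hdom) (P.stateL (restr x hxcont, restr y' hyc)) = restr x' hxc := by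
      ext1 t
      rw [hder, hprimy]
      exact (hx' t t.2).symm
    -- `(x, y')` lies in the kernel of the derivative of the differential constraint
    have h3 : primitive hT (restr x' hxc) = restr x hxcont := by
      ext1 t
      rw [primitive_restr_eq hT hx hxc t, hx0, sub_zero]
      rfl
    have h4 : evalEnd hT (P.stateL (restr x hxcont, restr y' hyc)) = (x P.T, y P.T) := by
      rw [evalEnd_apply, stateL_apply, hprimy]
      rfl
    rw [ContinuousLinearMap.prod_apply, hsplit, sub_apply,
      ContinuousLinearMap.comp_apply, ContinuousLinearMap.comp_apply, h2, h3,
      ContinuousLinearMap.comp_apply, ContinuousLinearMap.comp_apply, h4, hφ', h4, hend] at h1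
    have h5 : (restr x hxcont : C(Icc (0 : ℝ) P.T, E n))
        = ContinuousLinearMap.fst ℝ _ _ (restr x hxcont, restr y' hyc) := rfl
    rw [← h5, sub_self, show ((0 : C(Icc (0 : ℝ) P.T, E n)), (0 : F)) = 0 from rfl, map_zero,
      zero_add, smul_eq_mul] at h1
    rw [← h1, add_comm (P.weight * _)]
    congr 3
    refine intervalIntegral.integral_congr fun t ht => ?_
    rw [uIcc_of_le hT] at ht
    simp only [IccExtend_of_mem hT _ ht, hjet, jetL_apply, hprimy]
    exact (P.fderiv_lagrRef 1 t (h.mem_dom t ht) (v t) (P.dot v t) (x t) (y t) (y' t)).symm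
  -- the pair of multipliers is determined up to sign only
  rcases le_total 0 Λ₀ with hs | hs
  · exact ⟨Λ₀, ell, hs, hnontriv, key⟩
  · refine ⟨-Λ₀, -ell, neg_nonneg.2 hs, by simpa using hnontriv, ?_⟩
    intro x x' y y' a1 a2 a3 a4 a5 a6 a7
    have := key x x' y y' a1 a2 a3 a4 a5 a6 a7
    rw [LinearMap.neg_apply]
    linarith

end Tracking

namespace Tracking

variable {n k d : ℕ} {S : System n k} {P : Tracking S d} {q : ℝ → E n} {v : ℝ → E k}
  {lam0 : ℝ} {lam : ℝ → E n}

/-! ### The costate -/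

theorem runningVar_eq_mul (lam0 : ℝ) (x : ℝ → E n) (y y' : ℝ → E k) :
    P.runningVar lam0 q v x y y' = lam0 * P.runningVar 1 q v x y y' := by
  unfold runningVar
  rw [← intervalIntegral.integral_const_mul]
  refine intervalIntegral.integral_congr fun t _ => ?_
  simp only [P.gradQ_smul lam0, P.gradV_smul lam0, P.momentum_smul lam0, real_inner_smul_left]
  ring

/-- The costate is the solution of the adjoint equation with the terminal value prescribed by
the derivative `θ` of the terminal functional. It turns the variations of `q` into variations of
`v`, which are free, so that the lemma of du Bois-Reymond applies. -/
theorem IsCurve.exists_costate (h : P.IsCurve q v)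
    (hode : ∀ t ∈ P.I, HasDerivWithinAt q (S.anchor (q t) (v t)) P.I t)
    (θ : E n × E k →L[ℝ] ℝ)
    (hθ : ∀ (x x' : ℝ → E n) (y y' : ℝ → E k),
      (∀ t ∈ P.I, x' t = S.anchorQ (q t) (v t) (x t) + S.anchor (q t) (y t)) →
      (∀ t ∈ P.I, HasDerivWithinAt x (x' t) P.I t) → ContinuousOn x' P.I →
      (∀ t ∈ P.I, HasDerivWithinAt y (y' t) P.I t) → ContinuousOn y' P.I →
      x 0 = 0 → y 0 = 0 → θ (x P.T, y P.T) + P.runningVar lam0 q v x y y' = 0) :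
    ∃ lam : ℝ → E n, P.EulerLagrange lam0 q v lam
      ∧ (∀ x, inner ℝ (lam P.T) x = θ (x, 0))
      ∧ (∀ y, inner ℝ ((-P.momentum lam0 q v) P.T) y = θ (0, y)) := by
  have hQ := h.continuousOn_gradQ lam0
  have hV := h.continuousOn_gradV lam0
  have hM := h.continuousOn_momentum lam0
  have hadj := continuousOn_adjoint h.continuousOn_anchorQ
  obtain ⟨lam, hlamT, hlam'⟩ := exists_linear_ode_backward P.T_pos.le hadj.neg hQ.neg
    ((InnerProductSpace.toDual ℝ (E n)).symm (θ.comp (ContinuousLinearMap.inl ℝ (E n) (E k))))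
  have hlamT' : ∀ x, inner ℝ (lam P.T) x = θ (x, 0) := fun x => by
    rw [hlamT, InnerProductSpace.toDual_symm_apply]
    rfl
  have hlam : ContinuousOn lam P.I := fun t ht => (hlam' t ht).continuousWithinAt
  have haL := (continuousOn_adjoint h.continuousOn_anchorL).clm_apply hlam
  have hDBR := du_bois_reymond P.T_pos
    (a := fun t => P.gradV lam0 t (q t) (v t) (P.dot v t)
      + ContinuousLinearMap.adjoint (S.anchorL (q t)) (lam t))
    (b := P.momentum lam0 q v) (hV.add haL) hM
    ((InnerProductSpace.toDual ℝ (E k)).symm (θ.comp (ContinuousLinearMap.inr ℝ (E n) (E k))))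
    (fun y y' hy hy' hy0 => by
      have hyc : ContinuousOn y P.I := fun t ht => (hy t ht).continuousWithinAt
      have haLy : ContinuousOn (fun t => S.anchor (q t) (y t)) P.I :=
        (h.continuousOn_anchorL.clm_apply hyc).congr fun t _ => (S.anchorL_apply _ _).symm
      -- the response `x` of the linearized constraint to the variation `y`
      obtain ⟨x, hx0, hx⟩ := exists_linear_ode_forward P.T_pos.le h.continuousOn_anchorQ haLy 0
      have hxc : ContinuousOn x P.I := fun t ht => (hx t ht).continuousWithinAt
      have hx' : ContinuousOn (fun t => S.anchorQ (q t) (v t) (x t) + S.anchor (q t) (y t)) P.I :=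
        (h.continuousOn_anchorQ.clm_apply hxc).add haLy
      have h1 := hθ x _ y y' (fun t _ => rfl) hx hx' hy hy' hx0 hy0
      have h2 := integral_eq_sub_of_hasDerivWithinAt_Icc P.T_pos.le
        (f := fun t => inner ℝ (lam t) (x t))
        (fun t ht => (hlam' t ht).inner ℝ (hx t ht))
        ((hlam.inner hx').add (((hadj.neg.clm_apply hlam).add hQ.neg).inner hxc))
      have h3 : θ (x P.T, y P.T) = θ (x P.T, 0) + θ (0, y P.T) := by rw [← map_add]; simp
      rw [hx0, inner_zero_right, sub_zero, hlamT'] at h2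
      rw [h3, ← h2, runningVar] at h1
      have hi : ∀ {f : ℝ → ℝ}, ContinuousOn f (Icc 0 P.T) → IntervalIntegrable f volume 0 P.T :=
        fun hf => hf.intervalIntegrable_of_Icc P.T_pos.le
      have h4 := intervalIntegral.integral_add
        (hi ((hlam.inner hx').add (((hadj.neg.clm_apply hlam).add hQ.neg).inner hxc)))
        (hi (((hQ.inner hxc).add (hV.inner hyc)).add (hM.inner hy')))
      rw [InnerProductSpace.toDual_symm_apply, ContinuousLinearMap.comp_apply,
        ContinuousLinearMap.inr_apply]
      refine Eq.trans ?_ ((add_right_comm _ _ _).trans h1)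
      refine congrArg (fun a => a + θ (0, y P.T)) (Eq.trans ?_ h4)
      refine intervalIntegral.integral_congr fun t _ => ?_
      simp only [Pi.add_apply, inner_add_left, inner_add_right,
        ContinuousLinearMap.adjoint_inner_left, S.anchorL_apply, Pi.neg_apply, neg_apply,
        inner_neg_left]
      ring)
  refine ⟨lam, (P.eulerLagrange_iff h.mem_dom).2 ⟨fun t ht => ?_, hode, hDBR.2⟩, hlamT',
    fun y => ?_⟩
  · refine (hlam' t ht).congr_deriv ?_
    simp only [Pi.neg_apply, neg_apply]
    abel
  · rw [Pi.neg_apply, hDBR.1, neg_neg, InnerProductSpace.toDual_symm_apply]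
    rfl

/-- A minimizer under a terminal constraint `g = const` is an extremal that satisfies the
transversality conditions. -/
theorem IsCurve.exists_extremal (h : P.IsCurve q v)
    (hode : ∀ t ∈ P.I, HasDerivWithinAt q (S.anchor (q t) (v t)) P.I t)
    {F : Type*} [NormedAddCommGroup F] [NormedSpace ℝ F] [CompleteSpace F] {g : E n × E k → F}
    (hg : ContDiffAt ℝ 1 g (q P.T, v P.T))
    (hmin : ∀ q' v', P.IsCurve q' v' →
      (∀ t ∈ P.I, HasDerivWithinAt q' (S.anchor (q' t) (v' t)) P.I t) →
      g (q' P.T, v' P.T) = g (q P.T, v P.T) → P.action q v ≤ P.action q' v') :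
    ∃ (lam0 : ℝ) (ell : Module.Dual ℝ F) (lam : ℝ → E n), 0 ≤ lam0 ∧ (lam0 ≠ 0 ∨ ell ≠ 0)
      ∧ P.EulerLagrange lam0 q v lam
      ∧ (∀ x, inner ℝ (lam P.T) x = lam0 * P.weight * fderiv ℝ P.Φ (q P.T, v P.T) (x, 0)
          + ell (fderiv ℝ g (q P.T, v P.T) (x, 0)))
      ∧ (∀ y, inner ℝ ((-P.momentum lam0 q v) P.T) y
        = lam0 * P.weight * fderiv ℝ P.Φ (q P.T, v P.T) (0, y)
          + ell (fderiv ℝ g (q P.T, v P.T) (0, y))) := by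
  obtain ⟨lam0, ell, h0, hne, hvar⟩ := h.exists_terminal_multiplier hode hg hmin
  set θ : E n × E k →L[ℝ] ℝ := (lam0 * P.weight) • fderiv ℝ P.Φ (q P.T, v P.T)
    + LinearMap.toContinuousLinearMap
      (ell.comp (fderiv ℝ g (q P.T, v P.T) : E n × E k →ₗ[ℝ] F)) with hθ
  have hθa : ∀ z, θ z = lam0 * P.weight * fderiv ℝ P.Φ (q P.T, v P.T) z
      + ell (fderiv ℝ g (q P.T, v P.T) z) := fun z => rfl
  obtain ⟨lam, hEL, h1, h2⟩ := h.exists_costate (lam0 := lam0) hode θ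
    (fun x x' y y' a1 a2 a3 a4 a5 a6 a7 => by
      have := hvar x x' y y' a1 a2 a3 a4 a5 a6 a7
      rw [hθa, runningVar_eq_mul, ← this]
      ring)
  exact ⟨lam0, ell, lam, h0, hne, hEL, h1, h2⟩

/-! ### Minimizers are extremals -/

theorem EulerLagrange.smul (hq : ∀ t ∈ P.I, q t ∈ S.dom) (h : P.EulerLagrange lam0 q v lam)
    (c : ℝ) : P.EulerLagrange (c * lam0) q v (fun t => c • lam t) := by
  obtain ⟨h1, h2, h3⟩ := (P.eulerLagrange_iff hq).1 h
  have hm : P.momentum (c * lam0) q v = fun t => c • P.momentum lam0 q v t := by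
    ext1 t
    rw [P.momentum_smul (c * lam0), P.momentum_smul lam0, smul_smul]
  refine (P.eulerLagrange_iff hq).2 ⟨fun t ht => ?_, h2, fun t ht => ?_⟩
  · refine ((h1 t ht).const_smul c).congr_deriv ?_
    rw [P.gradQ_smul (c * lam0), P.gradQ_smul lam0, map_smul, smul_neg, smul_add, smul_smul]
  · rw [hm]
    refine ((h3 t ht).const_smul c).congr_deriv ?_
    rw [P.gradV_smul (c * lam0), P.gradV_smul lam0, map_smul, smul_add, smul_smul]

/-- An abnormal extremal annihilates the reachable set of the linearized state equations. -/
theorem EulerLagrange.eq_zero_of_linearizedControllable (hq : ∀ t ∈ P.I, q t ∈ S.dom)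
    (h : P.EulerLagrange 0 q v lam) (hc : P.LinearizedControllable q v) : lam P.T = 0 := by
  obtain ⟨h1, -, h3⟩ := (P.eulerLagrange_iff hq).1 h
  have hm : P.momentum 0 q v = fun _ => 0 := by
    ext1 t
    rw [P.momentum_smul 0, zero_smul]
  have hL : ∀ t ∈ P.I, ContinuousLinearMap.adjoint (S.anchorL (q t)) (lam t) = 0 := fun t ht => by
    have h4 := h3 t ht
    rw [hm, P.gradV_smul 0, zero_smul, zero_add] at h4
    exact (dot_eq h4 ht).symm.trans (dot_eq (hasDerivWithinAt_const t _ _) ht)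
  -- `⟨λ, x⟩` is constant along solutions `x` of the linearized equations; steer to `λ(T)`
  obtain ⟨x, y, w, -, hx0, -, hxT, -, hxy⟩ := hc (lam P.T) 0
  have h5 := integral_eq_sub_of_hasDerivWithinAt_Icc P.T_pos.le
    (f := fun t => inner ℝ (lam t) (x t)) (f' := fun _ => (0 : ℝ))
    (fun t ht => (((h1 t ht).inner ℝ (hxy t ht).1).congr_deriv (by
      have h6 : inner ℝ (lam t) (S.anchor (q t) (y t)) = 0 := by
        rw [← S.anchorL_apply, ← ContinuousLinearMap.adjoint_inner_left, hL t ht, inner_zero_left]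
      rw [P.gradQ_smul 0, zero_smul, zero_add, inner_neg_left,
        ContinuousLinearMap.adjoint_inner_left, inner_add_right, h6, add_zero]
      exact add_neg_cancel _))) continuousOn_const
  rw [intervalIntegral.integral_zero, hx0, hxT, inner_zero_right, sub_zero] at h5
  exact inner_self_eq_zero.1 h5.symm

end Tracking

namespace System

variable {n k : ℕ} (S : System n k)

/-- Every vector `(q, v, q̇, v̇)` with `q̇ = v^A e_A(q)` is the velocity of an admissible curve:
take `v` affine in time, and for `q` the solution of the resulting differential equation, which is
autonomous once time is made a state variable. -/
theorem D2_eq : S.D2 = {a | a.1 ∈ S.dom ∧ a.2.2.1 = S.anchor a.1 a.2.1} := by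
  ext ⟨q, v, p, w⟩
  constructor
  · rintro ⟨δ, hδ, q', v', h, heq⟩
    simp only [Prod.mk.injEq] at heq
    obtain ⟨rfl, rfl, rfl, -⟩ := heq
    have h0 := h 0 ⟨neg_lt_zero.2 hδ, hδ⟩
    exact ⟨h0.1, h0.2.1.deriv⟩
  · rintro ⟨hq, hp⟩
    have hq : q ∈ S.dom := hq
    have hp : p = S.anchor q v := hp
    have hF : ContDiffAt ℝ 1 (fun z : E n × ℝ => (S.anchor z.1 (v + z.2 • w), (1 : ℝ)))
        (q, 0) := by
      have h1 : ContDiffAt ℝ 1 (fun z : E n × E k => S.anchor z.1 z.2) (q, v + (0 : ℝ) • w) :=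
        (S.contDiffOn_anchor.of_le (by simp)).contDiffAt
          (S.isOpen_phase.mem_nhds ⟨hq, mem_univ _⟩)
      exact (ContDiffAt.comp (f := fun z : E n × ℝ => (z.1, v + z.2 • w)) (q, (0 : ℝ)) h1
        (ContDiff.contDiffAt (by fun_prop))).prodMk contDiffAt_const
    obtain ⟨α, hα0, ε, hε, hα⟩ :=
      hF.exists_forall_mem_closedBall_exists_eq_forall_mem_Ioo_hasDerivAt₀ 0
    rw [zero_sub, zero_add] at hα
    have hα' := hα 0 ⟨neg_lt_zero.2 hε, hε⟩
    have hmem : ∀ᶠ t in 𝓝 (0 : ℝ), (α t).1 ∈ S.dom := by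
      have hc : ContinuousAt (fun t => (α t).1) 0 := hα'.continuousAt.fst
      refine hc.eventually (S.isOpen_dom.mem_nhds ?_)
      simpa [hα0] using hq
    obtain ⟨η, hη, hball⟩ := Metric.eventually_nhds_iff_ball.1 hmem
    have hder : ∀ t ∈ Ioo (-ε) ε, HasDerivAt (fun t => (α t).1)
        (S.anchor (α t).1 (v + (α t).2 • w)) t ∧ HasDerivAt (fun t => v + (α t).2 • w) w t := by
      intro t ht
      have h1 : HasDerivAt (fun t => (α t).1) (S.anchor (α t).1 (v + (α t).2 • w)) t := (hα t ht).fst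
      have h2 : HasDerivAt (fun t => (α t).2) 1 t := (hα t ht).snd
      exact ⟨h1, by simpa using (h2.smul_const w).const_add v⟩
    refine ⟨min ε η, lt_min hε hη, fun t => (α t).1, fun t => v + (α t).2 • w, fun t ht => ?_, ?_⟩
    · have ht' : t ∈ Ioo (-ε) ε :=
        ⟨(neg_le_neg (min_le_left _ _)).trans_lt ht.1, ht.2.trans_le (min_le_left _ _)⟩
      refine ⟨hball t ?_, (hder t ht').1, (hder t ht').2.differentiableAt⟩
      rw [Metric.mem_ball, Real.dist_eq, sub_zero]
      exact (abs_lt.2 ht).trans_le (min_le_right _ _)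
    · have h0 := hder 0 ⟨neg_lt_zero.2 hε, hε⟩
      rw [h0.1.deriv, h0.2.deriv, hp]
      simp [hα0]

end System

namespace Tracking

variable {n k d : ℕ} {S : System n k} {P : Tracking S d} {q : ℝ → E n} {v u : ℝ → E k}
  {lam0 : ℝ} {lam : ℝ → E n}

/-! ### The recast problem -/

theorem IsCurve.isConstrained_iff (h : P.IsCurve q v) :
    P.IsConstrained q v ↔ (∀ t ∈ P.I, HasDerivWithinAt q (S.anchor (q t) (v t)) P.I t)
      ∧ P.rT (q P.T, v P.T) = 0 := by
  constructor
  · intro hc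
    refine ⟨fun t ht => ?_, hc.terminal⟩
    have h1 := hc.mem_D2 t ht
    rw [S.D2_eq] at h1
    rw [← show P.dot q t = S.anchor (q t) (v t) from h1.2]
    exact hasDerivWithinAt_dot h.contDiff_q ht
  · rintro ⟨hode, hT⟩
    refine ⟨h, fun t ht => ?_, hT⟩
    rw [S.D2_eq]
    exact ⟨h.mem_dom t ht, dot_eq (hode t ht) ht⟩

theorem isControlled_iff :
    P.IsControlled q v u ↔ P.IsConstrained q v ∧ EqOn u (P.control q v) P.I := by
  constructor
  · intro h
    refine ⟨h.curve.isConstrained_iff.2 ⟨h.eq_q, h.terminal⟩, fun t ht => ?_⟩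
    rw [control, dot_eq (h.eq_v t ht) ht]
    abel
  · rintro ⟨hc, hu⟩
    obtain ⟨hode, hT⟩ := hc.curve.isConstrained_iff.1 hc
    refine ⟨hc.curve, ?_, hode, fun t ht => ?_, hT⟩
    · exact ((continuousOn_dot hc.curve.contDiff_v).add hc.curve.continuousOn_force).congr hu
    · rw [hu ht, control, add_comm (P.dot v t), neg_add_cancel_left]
      exact hasDerivWithinAt_dot hc.curve.contDiff_v ht

theorem J_eq_action (hu : EqOn u (P.control q v) P.I) : P.J q v u = P.action q v := by
  unfold J action
  congr 1
  refine intervalIntegral.integral_congr fun t ht => ?_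
  rw [uIcc_of_le P.T_pos.le] at ht
  simp only [hu ht, lagr, one_mul, control]

theorem isSolution_iff :
    P.IsSolution q v u ↔ P.IsConstrainedMin q v ∧ EqOn u (P.control q v) P.I := by
  constructor
  · rintro ⟨h, hmin⟩
    obtain ⟨hc, hu⟩ := isControlled_iff.1 h
    refine ⟨⟨hc, fun q' v' hc' => ?_⟩, hu⟩
    have h1 := hmin q' v' (P.control q' v') (isControlled_iff.2 ⟨hc', fun _ _ => rfl⟩)
    rwa [J_eq_action hu, J_eq_action fun _ _ => rfl] at h1
  · rintro ⟨⟨hc, hmin⟩, hu⟩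
    refine ⟨isControlled_iff.2 ⟨hc, hu⟩, fun q' v' u' h' => ?_⟩
    obtain ⟨hc', hu'⟩ := isControlled_iff.1 h'
    rw [J_eq_action hu, J_eq_action hu']
    exact hmin q' v' hc'

/-- The case of fixed end points: the multipliers do not both vanish at the final time. -/
theorem IsConstrainedMin.exists_eulerLagrange (h : P.IsConstrainedMin q v) :
    ∃ (lam0 : ℝ) (lam : ℝ → E n), 0 ≤ lam0 ∧ (lam0 ≠ 0 ∨ lam P.T ≠ 0)
      ∧ P.EulerLagrange lam0 q v lam := by
  have hcurve := h.1.curve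
  obtain ⟨hode, hT⟩ := hcurve.isConstrained_iff.1 h.1
  obtain ⟨lam0, ell, lam, h0, hne, hEL, h1, h2⟩ := hcurve.exists_extremal hode
    (g := fun z => z) contDiffAt_id fun q' v' hc' hode' hend =>
      h.2 q' v' (hc'.isConstrained_iff.2 ⟨hode', by rw [hend, hT]⟩)
  refine ⟨lam0, lam, h0, ?_, hEL⟩
  by_contra! h3
  obtain ⟨rfl, hlam⟩ := h3
  -- for `λ₀ = 0` also `∂ℒ/∂v̇ = 0`, so the terminal multiplier is `(λ(T), 0)`
  refine hne.elim (fun h => h rfl) fun hell => hell (LinearMap.ext fun z => ?_)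
  have h4 := h1 z.1
  have h5 := h2 z.2
  rw [hlam, inner_zero_left, zero_mul, zero_mul, zero_add, fderiv_fun_id] at h4
  rw [Pi.neg_apply, P.momentum_smul 0, zero_smul, neg_zero, inner_zero_left, zero_mul, zero_mul,
    zero_add, fderiv_fun_id] at h5
  have h6 : z = (z.1, 0) + (0, z.2) := by simp
  rw [h6, map_add]
  simp only [ContinuousLinearMap.id_apply] at h4 h5
  rw [← h4, ← h5, add_zero, LinearMap.zero_apply]

theorem IsConstrainedMin.exists_transversality (h : P.IsConstrainedMin q v) :
    ∃ (lam0 : ℝ) (lam : ℝ → E n) (lamT : E d), 0 ≤ lam0 ∧ (lam0 ≠ 0 ∨ lamT ≠ 0)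
      ∧ P.EulerLagrange lam0 q v lam
      ∧ P.Transversality (lam0 * P.weight) q v lam (-P.momentum lam0 q v) lamT := by
  have hcurve := h.1.curve
  have hqT := hcurve.mem_dom _ P.T_mem_I
  obtain ⟨hode, hT⟩ := hcurve.isConstrained_iff.1 h.1
  obtain ⟨lam0, ell, lam, h0, hne, hEL, h1, h2⟩ := hcurve.exists_extremal hode (g := P.rT)
    (P.contDiff_r.contDiffAt (S.isOpen_phase.mem_nhds ⟨hqT, mem_univ _⟩))
    fun q' v' hc' hode' hend => h.2 q' v' (hc'.isConstrained_iff.2 ⟨hode', by rw [hend, hT]⟩)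
  set lamT := (InnerProductSpace.toDual ℝ (E d)).symm (LinearMap.toContinuousLinearMap ell)
    with hlamT
  have hell : ∀ e, inner ℝ lamT e = ell e := fun e => by
    rw [hlamT, InnerProductSpace.toDual_symm_apply]
    rfl
  refine ⟨lam0, lam, lamT, h0, hne.imp_right fun hl hz => hl (LinearMap.ext fun e => ?_), hEL,
    (P.transversality_iff hqT).2 ⟨hT, fun x => ?_, fun y => ?_⟩⟩
  · rw [terminalVar_apply, hell, h1]
  · rw [terminalVar_apply, hell, h2]
  · rw [← hell, hz, inner_zero_left, LinearMap.zero_apply]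

theorem IsConstrainedMin.exists_normal (h : P.IsConstrainedMin q v)
    (hc : P.LinearizedControllable q v) : ∃ lam : ℝ → E n, P.EulerLagrange 1 q v lam := by
  obtain ⟨lam0, lam, -, hne, hEL⟩ := h.exists_eulerLagrange
  have hdom := h.1.curve.mem_dom
  have h0 : lam0 ≠ 0 := by
    rintro rfl
    exact hne.elim (fun h => h rfl) fun h => h (hEL.eq_zero_of_linearizedControllable hdom hc)
  exact ⟨_, inv_mul_cancel₀ h0 ▸ hEL.smul hdom lam0⁻¹⟩

theorem IsConstrainedMin.exists_isCritical (h : P.IsConstrainedMin q v)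
    (hc : P.LinearizedControllable q v)
    (hsurj : Function.Surjective (fderiv ℝ P.rT (q P.T, v P.T))) :
    ∃ (lam : ℝ → E n) (lamT : E d), ContinuousOn lam P.I ∧ P.IsCritical 1 q v lam lamT := by
  obtain ⟨lam0, lam, lamT, -, hne, hEL, htrans⟩ := h.exists_transversality
  have hcurve := h.1.curve
  have hdom := hcurve.mem_dom
  obtain ⟨hr, h1, h2⟩ := (P.transversality_iff (hdom _ P.T_mem_I)).1 htrans
  have h0 : lam0 ≠ 0 := by
    rintro rfl
    refine hne.elim (fun h => h rfl) fun hl => hl ?_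
    obtain ⟨z, hz⟩ := hsurj lamT
    have h3 := h1 z.1
    have h4 := h2 z.2
    rw [hEL.eq_zero_of_linearizedControllable hdom hc, inner_zero_left] at h3
    rw [Pi.neg_apply, P.momentum_smul 0, zero_smul, neg_zero, inner_zero_left] at h4
    have h5 : P.terminalVar (0 * P.weight) (q P.T) (v P.T) lamT z = 0 := by
      have h6 : z = (z.1, 0) + (0, z.2) := by simp
      rw [h6, map_add, ← h3, ← h4, add_zero]
    rw [terminalVar_apply, hz, zero_mul, zero_mul, zero_add] at h5
    exact inner_self_eq_zero.1 h5
  have hEL' := hEL.smul hdom lam0⁻¹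
  have hlam : ContinuousOn (fun t => lam0⁻¹ • lam t) P.I := fun t ht =>
    (((P.eulerLagrange_iff hdom).1 hEL').1 t ht).continuousWithinAt
  rw [inv_mul_cancel₀ h0] at hEL'
  refine ⟨_, lam0⁻¹ • lamT, hlam, hcurve.isCritical_of_eulerLagrange hlam hEL' ?_⟩
  have hscale : ∀ z, P.terminalVar P.weight (q P.T) (v P.T) (lam0⁻¹ • lamT) z
      = lam0⁻¹ * P.terminalVar (lam0 * P.weight) (q P.T) (v P.T) lamT z := fun z => by
    rw [terminalVar_apply, terminalVar_apply, real_inner_smul_left]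
    field_simp
  refine (P.transversality_iff (hdom _ P.T_mem_I)).2 ⟨hr, fun x => ?_, fun y => ?_⟩
  · rw [hscale, ← h1, real_inner_smul_left]
  · rw [hscale, ← h2, ← real_inner_smul_left, Pi.neg_apply, Pi.neg_apply, P.momentum_smul lam0,
      smul_neg, smul_smul, inv_mul_cancel₀ h0, one_smul]

end Tracking

/-! ### Explicit gradients -/

theorem pd_eq_of_hasFDerivAt {m : ℕ} {f : E m → ℝ} {f' : E m →L[ℝ] ℝ} {x g : E m}
    (h : HasFDerivAt f f' x) (hg : ∀ z, f' z = inner ℝ g z) (i : Fin m) : pd f x i = g i := by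
  rw [pd, h.fderiv, hg]
  simp [EuclideanSpace.inner_single_right]

namespace System

variable {n k : ℕ} (S : System n k)

/-- The partial derivative of the force in the direction of the base. -/
def forceQ (q : E n) (v : E k) : E n →L[ℝ] E k := fderiv ℝ (fun z => S.force z v) q

/-- The partial derivative of the force in the direction of the fibre. -/
def forceV (q : E n) (v : E k) : E k →L[ℝ] E k := fderiv ℝ (fun z => S.force q z) v

theorem hasFDerivAt_forceQ {q : E n} (hq : q ∈ S.dom) (v : E k) :
    HasFDerivAt (fun z => S.force z v) (S.forceQ q v) q :=
  (HasFDerivAt.comp (f := fun a => (a, v)) q (S.differentiableAt_force hq v).hasFDerivAt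
    ((hasFDerivAt_id q).prodMk (hasFDerivAt_const v q))).differentiableAt.hasFDerivAt

theorem hasFDerivAt_forceV {q : E n} (hq : q ∈ S.dom) (v : E k) :
    HasFDerivAt (fun z => S.force q z) (S.forceV q v) v :=
  (HasFDerivAt.comp (f := fun a => (q, a)) v (S.differentiableAt_force hq v).hasFDerivAt
    ((hasFDerivAt_const q v).prodMk (hasFDerivAt_id v))).differentiableAt.hasFDerivAt

theorem hasFDerivAt_anchorQ {q : E n} (hq : q ∈ S.dom) (v : E k) :
    HasFDerivAt (fun z => S.anchor z v) (S.anchorQ q v) q :=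
  (HasFDerivAt.comp (f := fun a => (a, v)) q (S.differentiableAt_anchor hq v).hasFDerivAt
    ((hasFDerivAt_id q).prodMk (hasFDerivAt_const v q))).differentiableAt.hasFDerivAt

theorem hasFDerivAt_anchorL (q : E n) (v : E k) :
    HasFDerivAt (fun z => S.anchor q z) (S.anchorL q) v :=
  (S.anchorL q).hasFDerivAt.congr_of_eventuallyEq
    (.of_forall fun w => (S.anchorL_apply q w).symm)

end System

namespace Tracking

variable {n k d : ℕ} {S : System n k} (P : Tracking S d)

theorem gradW_eq (lam0 t : ℝ) (q : E n) (v w : E k) :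
    P.gradW lam0 t q v w = (lam0 * P.ε) • (w + S.force q v) := by
  ext A
  have h := ((((hasFDerivAt_id w).add_const (S.force q v)).norm_sq.const_mul P.ε).const_add
    (‖q - P.qr t‖ ^ 2 + ‖v - P.vr t‖ ^ 2)).const_mul (1 / 2) |>.const_mul lam0
  exact pd_eq_of_hasFDerivAt h (fun z => by
    rw [real_inner_smul_left]
    simp [inner_add_left]
    ring) A

theorem gradQ_eq (lam0 t : ℝ) {q : E n} (hq : q ∈ S.dom) (v w : E k) :
    P.gradQ lam0 t q v w = lam0 • (q - P.qr t)
      + (lam0 * P.ε) • ContinuousLinearMap.adjoint (S.forceQ q v) (w + S.force q v) := by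
  ext i
  have h := ((((hasFDerivAt_id q).sub_const (P.qr t)).norm_sq.add_const (‖v - P.vr t‖ ^ 2)).add
    (((S.hasFDerivAt_forceQ hq v).const_add w).norm_sq.const_mul P.ε)).const_mul (1 / 2)
    |>.const_mul lam0
  exact pd_eq_of_hasFDerivAt h (fun z => by
    simp [real_inner_smul_left, inner_add_left, inner_sub_left,
      ContinuousLinearMap.adjoint_inner_left]
    ring) i

theorem gradV_eq (lam0 t : ℝ) {q : E n} (hq : q ∈ S.dom) (v w : E k) :
    P.gradV lam0 t q v w = lam0 • (v - P.vr t)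
      + (lam0 * P.ε) • ContinuousLinearMap.adjoint (S.forceV q v) (w + S.force q v) := by
  ext i
  have h := ((((hasFDerivAt_id v).sub_const (P.vr t)).norm_sq.const_add (‖q - P.qr t‖ ^ 2)).add
    (((S.hasFDerivAt_forceV hq v).const_add w).norm_sq.const_mul P.ε)).const_mul (1 / 2)
    |>.const_mul lam0
  exact pd_eq_of_hasFDerivAt h (fun z => by
    simp [real_inner_smul_left, inner_add_left, inner_sub_left,
      ContinuousLinearMap.adjoint_inner_left]
    ring) i

theorem ham_eq (lam0 t : ℝ) (q : E n) (v : E k) (lam : E n) (mu u : E k) :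
    P.ham lam0 t q v lam mu u = lam0 * P.cost t q v u + inner ℝ lam (S.anchor q v)
      + inner ℝ mu (-S.force q v + u) := by
  unfold ham
  rw [PiLp.inner_apply, PiLp.inner_apply]
  congr 1
  · congr 1
    refine Finset.sum_congr rfl fun i _ => ?_
    rw [S.anchor_apply]
    simp only [mul_assoc, ← Finset.mul_sum]
    simp [mul_comm]
  · exact Finset.sum_congr rfl fun A _ => by simp [mul_comm]

theorem pd_ham_q (lam0 t : ℝ) {q : E n} (hq : q ∈ S.dom) (v : E k) (lam : E n) (mu u : E k)
    (i : Fin n) : pd (fun x => P.ham lam0 t x v lam mu u) q i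
      = (lam0 • (q - P.qr t) + ContinuousLinearMap.adjoint (S.anchorQ q v) lam
        - ContinuousLinearMap.adjoint (S.forceQ q v) mu) i := by
  simp only [ham_eq]
  have h := (((((hasFDerivAt_id q).sub_const (P.qr t)).norm_sq.add_const
    (‖v - P.vr t‖ ^ 2)).add_const (P.ε * ‖u‖ ^ 2)).const_mul (1 / 2) |>.const_mul lam0).add
    ((innerSL ℝ lam).hasFDerivAt.comp q (S.hasFDerivAt_anchorQ hq v)) |>.add
    ((innerSL ℝ mu).hasFDerivAt.comp q ((S.hasFDerivAt_forceQ hq v).neg.add_const u))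
  exact pd_eq_of_hasFDerivAt h (fun z => by
    simp [real_inner_smul_left, inner_add_left, inner_sub_left,
      ContinuousLinearMap.adjoint_inner_left]
    ring) i

theorem pd_ham_v (lam0 t : ℝ) {q : E n} (hq : q ∈ S.dom) (v : E k) (lam : E n) (mu u : E k)
    (A : Fin k) : pd (fun y => P.ham lam0 t q y lam mu u) v A
      = (lam0 • (v - P.vr t) + ContinuousLinearMap.adjoint (S.anchorL q) lam
        - ContinuousLinearMap.adjoint (S.forceV q v) mu) A := by
  simp only [ham_eq]
  have h := (((((hasFDerivAt_id v).sub_const (P.vr t)).norm_sq.const_add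
    (‖q - P.qr t‖ ^ 2)).add_const (P.ε * ‖u‖ ^ 2)).const_mul (1 / 2) |>.const_mul lam0).add
    ((innerSL ℝ lam).hasFDerivAt.comp v (S.hasFDerivAt_anchorL q v)) |>.add
    ((innerSL ℝ mu).hasFDerivAt.comp v ((S.hasFDerivAt_forceV hq v).neg.add_const u))
  exact pd_eq_of_hasFDerivAt h (fun z => by
    simp [real_inner_smul_left, inner_add_left, inner_sub_left,
      ContinuousLinearMap.adjoint_inner_left]
    ring) A

theorem pd_ham_u (lam0 t : ℝ) (q : E n) (v : E k) (lam : E n) (mu u : E k) (A : Fin k) :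
    pd (fun z => P.ham lam0 t q v lam mu z) u A = ((lam0 * P.ε) • u + mu) A := by
  simp only [ham_eq]
  have h := ((((hasFDerivAt_id u).norm_sq.const_mul P.ε).const_add
    (‖q - P.qr t‖ ^ 2 + ‖v - P.vr t‖ ^ 2)).const_mul (1 / 2) |>.const_mul lam0).add_const
    (inner ℝ lam (S.anchor q v)) |>.add
    ((innerSL ℝ mu).hasFDerivAt.comp u ((hasFDerivAt_id u).const_add (-S.force q v)))
  exact pd_eq_of_hasFDerivAt h (fun z => by
    simp [real_inner_smul_left, inner_add_left]
    ring) A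

/-! ### Regularity -/

theorem hessian_eq (lam0 t : ℝ) (q : E n) (v w : E k) :
    P.hessian lam0 t q v w = (lam0 * P.ε) • (1 : Matrix (Fin k) (Fin k) ℝ) := by
  ext A B
  have h1 : ∀ w', pd (fun w'' => P.lagr lam0 t q v w'') w' B
      = ((lam0 * P.ε) • (w' + S.force q v)) B := fun w' => by
    rw [← P.gradW_eq lam0 t]
    rfl
  have h2 : HasFDerivAt (fun w' : E k => ((lam0 * P.ε) • (w' + S.force q v)) B) _ w :=
    (EuclideanSpace.proj B : E k →L[ℝ] ℝ).hasFDerivAt.comp w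
      (((hasFDerivAt_id w).add_const (S.force q v)).const_smul (lam0 * P.ε))
  rw [hessian, Matrix.of_apply]
  simp only [h1]
  rw [pd, h2.fderiv]
  simp [Matrix.one_apply, eq_comm]

theorem det_hessian (lam0 t : ℝ) (q : E n) (v w : E k) :
    (P.hessian lam0 t q v w).det = (lam0 * P.ε) ^ k := by
  rw [hessian_eq, Matrix.det_smul, Matrix.det_one, mul_one, Fintype.card_fin]

/-! ### The maximum principle -/

theorem stationary_iff {lam0 : ℝ} {q : ℝ → E n} {v : ℝ → E k} {lam : ℝ → E n} {mu u : ℝ → E k} :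
    P.Stationary lam0 q v lam mu u ↔ ∀ t ∈ P.I, mu t = -((lam0 * P.ε) • u t) := by
  refine forall_congr' fun t => forall_congr' fun _ => ?_
  simp only [pd_ham_u]
  rw [eq_neg_iff_add_eq_zero, add_comm]
  exact ⟨fun h => by ext A; exact h A, fun h A => by rw [h]; rfl⟩

theorem stationary_iff_minimizing {lam0 : ℝ} (h0 : 0 < lam0) (hε : 0 < P.ε) {q : ℝ → E n}
    {v : ℝ → E k} {lam : ℝ → E n} {mu u : ℝ → E k} :
    P.Stationary lam0 q v lam mu u ↔ P.Minimizing lam0 q v lam mu u := by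
  constructor
  · intro h t ht z
    have hmu := P.stationary_iff.1 h t ht
    have hsq : 0 ≤ ‖z - u t‖ ^ 2 := sq_nonneg _
    rw [norm_sub_sq_real, real_inner_comm] at hsq
    rw [ham_eq, ham_eq, hmu, cost, cost]
    simp only [inner_neg_left, real_inner_smul_left, inner_add_right]
    rw [real_inner_self_eq_norm_sq]
    nlinarith [mul_nonneg (mul_pos h0 hε).le hsq]
  · intro h t ht A
    have h1 : IsLocalMin (fun z => P.ham lam0 t (q t) (v t) (lam t) (mu t) z) (u t) :=
      Filter.Eventually.of_forall (h t ht)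
    rw [pd, h1.fderiv_eq_zero]
    rfl

variable {P} {lam0 : ℝ} {q : ℝ → E n} {v : ℝ → E k} {lam : ℝ → E n} {mu u : ℝ → E k}

/-- For the control of a curve and `μ = -∂ℒ/∂v̇`, the terms with the derivative of the force in
`∂ℋ/∂q` and `∂ℋ/∂v` are the ones in `∂ℒ/∂q` and `∂ℒ/∂v`. -/
theorem IsCurve.hamiltonEquations_iff (h : P.IsCurve q v) (hu : EqOn u (P.control q v) P.I)
    (hmu : EqOn mu (-P.momentum lam0 q v) P.I) :
    P.HamiltonEquations lam0 q v lam mu u ↔ P.EulerLagrange lam0 q v lam := by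
  have hgrad : ∀ t, P.momentum lam0 q v t = (lam0 * P.ε) • (P.dot v t + S.force (q t) (v t)) :=
    fun t => P.gradW_eq lam0 t (q t) (v t) (P.dot v t)
  have hQ : ∀ t ∈ P.I, lam0 • (q t - P.qr t)
      + ContinuousLinearMap.adjoint (S.anchorQ (q t) (v t)) (lam t)
        - ContinuousLinearMap.adjoint (S.forceQ (q t) (v t)) (mu t)
      = P.gradQ lam0 t (q t) (v t) (P.dot v t)
        + ContinuousLinearMap.adjoint (S.anchorQ (q t) (v t)) (lam t) := fun t ht => by
    rw [P.gradQ_eq lam0 t (h.mem_dom t ht), hmu ht, Pi.neg_apply, hgrad, map_neg, map_smul]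
    abel
  have hV : ∀ t ∈ P.I, lam0 • (v t - P.vr t)
      + ContinuousLinearMap.adjoint (S.anchorL (q t)) (lam t)
        - ContinuousLinearMap.adjoint (S.forceV (q t) (v t)) (mu t)
      = P.gradV lam0 t (q t) (v t) (P.dot v t)
        + ContinuousLinearMap.adjoint (S.anchorL (q t)) (lam t) := fun t ht => by
    rw [P.gradV_eq lam0 t (h.mem_dom t ht), hmu ht, Pi.neg_apply, hgrad, map_neg, map_smul]
    abel
  rw [P.eulerLagrange_iff h.mem_dom]
  constructor
  · intro hH
    refine ⟨fun t ht => hasDerivWithinAt_coord_iff.2 fun i => ?_, hH.eq_q, fun t ht => ?_⟩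
    · have h1 := hH.eq_lam t ht i
      rw [P.pd_ham_q lam0 t (h.mem_dom t ht), hQ t ht] at h1
      exact h1
    · have h1 : HasDerivWithinAt mu (-(P.gradV lam0 t (q t) (v t) (P.dot v t)
          + ContinuousLinearMap.adjoint (S.anchorL (q t)) (lam t))) P.I t :=
        hasDerivWithinAt_coord_iff.2 fun A => by
          have h2 := hH.eq_mu t ht A
          rw [P.pd_ham_v lam0 t (h.mem_dom t ht), hV t ht] at h2
          exact h2
      refine (h1.neg.congr (fun s hs => ?_) ?_).congr_deriv (neg_neg _)
      · rw [Pi.neg_apply, hmu hs, Pi.neg_apply, neg_neg]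
      · rw [Pi.neg_apply, hmu ht, Pi.neg_apply, neg_neg]
  · rintro ⟨h1, h2, h3⟩
    refine ⟨h2, fun t ht => ?_, fun t ht i => ?_, fun t ht A => ?_⟩
    · rw [hu ht, control, add_comm (P.dot v t), neg_add_cancel_left]
      exact hasDerivWithinAt_dot h.contDiff_v ht
    · rw [P.pd_ham_q lam0 t (h.mem_dom t ht), hQ t ht]
      exact hasDerivWithinAt_coord_iff.1 (h1 t ht) i
    · rw [P.pd_ham_v lam0 t (h.mem_dom t ht), hV t ht]
      exact hasDerivWithinAt_coord_iff.1 ((h3 t ht).neg.congr hmu (hmu ht)) A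

theorem IsCurve.hamilton_iff_eulerLagrange (h : P.IsCurve q v) :
    P.HamiltonEquations lam0 q v lam mu u ∧ P.Stationary lam0 q v lam mu u ↔
      P.EulerLagrange lam0 q v lam ∧ EqOn u (P.control q v) P.I
        ∧ EqOn mu (-P.momentum lam0 q v) P.I := by
  have hgrad : ∀ t, P.momentum lam0 q v t = (lam0 * P.ε) • P.control q v t :=
    fun t => P.gradW_eq lam0 t (q t) (v t) (P.dot v t)
  constructor
  · rintro ⟨hH, hs⟩
    have hu : EqOn u (P.control q v) P.I := fun t ht => by
      rw [control, dot_eq (hH.eq_v t ht) ht]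
      abel
    have hmu : EqOn mu (-P.momentum lam0 q v) P.I := fun t ht => by
      rw [P.stationary_iff.1 hs t ht, hu ht, Pi.neg_apply, hgrad]
    exact ⟨(h.hamiltonEquations_iff hu hmu).1 hH, hu, hmu⟩
  · rintro ⟨hEL, hu, hmu⟩
    refine ⟨(h.hamiltonEquations_iff hu hmu).2 hEL, P.stationary_iff.2 fun t ht => ?_⟩
    rw [hu ht, hmu ht, Pi.neg_apply, hgrad]

theorem transversality_congr {w : ℝ} {mu' : ℝ → E k} {lamT : E d} (h : mu P.T = mu' P.T)
    (hT : P.Transversality w q v lam mu lamT) : P.Transversality w q v lam mu' lamT :=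
  ⟨hT.terminal, hT.lam_T, fun A => by rw [← h]; exact hT.mu_T A⟩

theorem IsCurve.hamilton_iff_isCritical (h : P.IsCurve q v) {lamT : E d}
    (hlam : ContinuousOn lam P.I) :
    P.HamiltonEquations lam0 q v lam mu u ∧ P.Stationary lam0 q v lam mu u
        ∧ P.Transversality P.weight q v lam mu lamT ↔
      P.IsCritical lam0 q v lam lamT ∧ EqOn u (P.control q v) P.I
        ∧ EqOn mu (-P.momentum lam0 q v) P.I := by
  constructor
  · rintro ⟨hH, hs, hT⟩
    obtain ⟨hEL, hu, hmu⟩ := h.hamilton_iff_eulerLagrange.1 ⟨hH, hs⟩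
    exact ⟨h.isCritical_of_eulerLagrange hlam hEL (transversality_congr (hmu P.T_mem_I) hT),
      hu, hmu⟩
  · rintro ⟨hc, hu, hmu⟩
    obtain ⟨hEL, hT⟩ := h.eulerLagrange_of_isCritical hlam hc
    obtain ⟨hH, hs⟩ := h.hamilton_iff_eulerLagrange.2 ⟨hEL, hu, hmu⟩
    exact ⟨hH, hs, transversality_congr (hmu P.T_mem_I).symm hT⟩

end Tracking

end Nonholonomic

end

theorem mainTheorem2 {n k d : ℕ} (S : Nonholonomic.System n k) (P : Nonholonomic.Tracking S d) :
    -- description of `D^(2)` by the constraint `q̇ = ρ_A v^A`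
    S.D2 = {a | a.1 ∈ S.dom ∧ a.2.2.1 = S.anchor a.1 a.2.1}
    -- the tracking problem is the constrained variational problem on `D^(2)`
    ∧ (∀ (q : ℝ → Nonholonomic.E n) (v u : ℝ → Nonholonomic.E k), P.IsControlled q v u ↔
        P.IsConstrained q v ∧ Set.EqOn u (P.control q v) P.I)
    ∧ (∀ (q : ℝ → Nonholonomic.E n) (v u : ℝ → Nonholonomic.E k), P.IsControlled q v u → P.J q v u = P.action q v)
    ∧ (∀ (q : ℝ → Nonholonomic.E n) (v u : ℝ → Nonholonomic.E k), P.IsSolution q v u ↔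
        P.IsConstrainedMin q v ∧ Set.EqOn u (P.control q v) P.I)
    -- solutions satisfy the Euler-Lagrange equations with multipliers
    ∧ (∀ (q : ℝ → Nonholonomic.E n) (v : ℝ → Nonholonomic.E k), P.IsConstrainedMin q v →
        (∃ (lam0 : ℝ) (lam : ℝ → Nonholonomic.E n), 0 ≤ lam0 ∧ (lam0 ≠ 0 ∨ ∃ t ∈ P.I, lam t ≠ 0)
          ∧ P.EulerLagrange lam0 q v lam)
        ∧ (∃ (lam0 : ℝ) (lam : ℝ → Nonholonomic.E n) (lamT : Nonholonomic.E d),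
          0 ≤ lam0 ∧ (lam0 ≠ 0 ∨ lamT ≠ 0)
          ∧ P.EulerLagrange lam0 q v lam
          ∧ P.Transversality (lam0 * P.weight) q v lam (-P.momentum lam0 q v) lamT)
        ∧ (P.LinearizedControllable q v → ∃ lam : ℝ → Nonholonomic.E n, P.EulerLagrange 1 q v lam)
        ∧ (P.LinearizedControllable q v →
          Function.Surjective (fderiv ℝ P.rT (q P.T, v P.T)) →
          ∃ (lam : ℝ → Nonholonomic.E n) (lamT : Nonholonomic.E d),
            ContinuousOn lam P.I ∧ P.IsCritical 1 q v lam lamT))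
    -- critical points of the augmented functional
    ∧ (∀ (lam0 : ℝ) (q : ℝ → Nonholonomic.E n) (v : ℝ → Nonholonomic.E k)
        (lam : ℝ → Nonholonomic.E n) (lamT : Nonholonomic.E d), 0 ≤ lam0 → P.IsCurve q v → ContinuousOn lam P.I →
        (P.IsCritical lam0 q v lam lamT ↔
          P.EulerLagrange lam0 q v lam
          ∧ P.Transversality P.weight q v lam (-P.momentum lam0 q v) lamT))
    -- regularity
    ∧ (∀ lam0 : ℝ, 0 < lam0 → (P.ε ≠ 0 → P.Regular lam0) ∧ (P.ε = 0 → 0 < k → ¬ P.Regular lam0))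
    -- equivalence with the maximum principle
    ∧ (∀ (lam0 : ℝ) (q : ℝ → Nonholonomic.E n) (v : ℝ → Nonholonomic.E k)
        (lam : ℝ → Nonholonomic.E n) (mu u : ℝ → Nonholonomic.E k), 0 < lam0 → P.ε ≠ 0 → P.IsCurve q v →
        (P.HamiltonEquations lam0 q v lam mu u ∧ P.Stationary lam0 q v lam mu u ↔
          P.EulerLagrange lam0 q v lam ∧ Set.EqOn u (P.control q v) P.I
          ∧ Set.EqOn mu (-P.momentum lam0 q v) P.I)
        ∧ (∀ lamT : Nonholonomic.E d, ContinuousOn lam P.I →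
          (P.HamiltonEquations lam0 q v lam mu u ∧ P.Stationary lam0 q v lam mu u
              ∧ P.Transversality P.weight q v lam mu lamT ↔
            P.IsCritical lam0 q v lam lamT ∧ Set.EqOn u (P.control q v) P.I
            ∧ Set.EqOn mu (-P.momentum lam0 q v) P.I))
        ∧ (0 < P.ε →
          (P.Stationary lam0 q v lam mu u ↔ P.Minimizing lam0 q v lam mu u))) := by
  refine ⟨S.D2_eq, fun _ _ _ => Nonholonomic.Tracking.isControlled_iff,
    fun q v u h =>
      Nonholonomic.Tracking.J_eq_action (Nonholonomic.Tracking.isControlled_iff.1 h).2,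
    fun _ _ _ => Nonholonomic.Tracking.isSolution_iff, fun q v h => ⟨?_,
      h.exists_transversality, h.exists_normal, h.exists_isCritical⟩,
    fun lam0 q v lam lamT _ hc hlam => ⟨hc.eulerLagrange_of_isCritical hlam,
      fun h => hc.isCritical_of_eulerLagrange hlam h.1 h.2⟩,
    fun lam0 h0 => ⟨fun hε t _ q _ v w => ?_, fun hε hk h => ?_⟩,
    fun lam0 q v lam mu u h0 _ hc => ⟨hc.hamilton_iff_eulerLagrange,
      fun lamT hlam => hc.hamilton_iff_isCritical hlam,
      fun hε => P.stationary_iff_minimizing h0 hε⟩⟩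
  · obtain ⟨lam0, lam, h0, hne, hEL⟩ := h.exists_eulerLagrange
    exact ⟨lam0, lam, h0, hne.imp_right fun hT => ⟨P.T, P.T_mem_I, hT⟩, hEL⟩
  · rw [P.det_hessian]
    exact pow_ne_zero _ (mul_ne_zero h0.ne' hε)
  · refine h 0 P.zero_mem_I P.q0 P.q0_mem 0 0 ?_
    rw [P.det_hessian, hε, mul_zero, zero_pow hk.ne']
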